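/- **Setting.** Let $H=L^2(0,1)$ with norm $|\cdot|$ and inner product $\langle\cdot,\cdot\rangle$, $\lambda_p=(\pi p)^2$ and $e_p=\sqrt2\sin(p\pi\,\cdot)$ for $p=1,2,\dots$ (the eigenvalues and eigenfunctions of $-A$, where $A$ is the Laplacian on $(0,1)$ with homogeneous Dirichlet boundary conditions). Put $e^{tA}u=\sum_p e^{-\lambda_pt}\langle u,e_p\rangle e_p$ and, for $s\in\mathbb R$, $|u|_s=\big(\sum_p\lambda_p^{2s}\langle u,e_p\rangle^2\big)^{1/2}\in[0,\infty]$; for $s\ge 0$ let $D((-A)^s)=\{u\in H:|u|_s<\infty\}$. *Nonlinearity.* $F:H\to H$ is globally Lipschitz and twice Fréchet differentiable with bounded first and second derivatives. For all $\alpha\in(0,\frac12)$ and $\kappa\in(0,\frac12-\alpha)$ there is $C_{F,\alpha,\kappa}\in(0,\infty)$ such that $$|DF(u).h|_{-\alpha}\le C_{F,\alpha,\kappa}(1+|u|_{\alpha+\kappa})|h|_{-\alpha}\qquad\text{for } u\in D((-A)^{\alpha+\kappa}),\ h\in H,$$ $$|DF(u).h|_{\alpha-\kappa}\le C_{F,\alpha,\kappa}(1+|u|_{\alpha})|h|_{\alpha}\qquad\text{for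 } u,h\in D((-A)^{\alpha}),$$ $$|(DF(u_2)-DF(u_1)).h|_{-\alpha}\le C_{F,\alpha,\kappa}(1+|u_1|_{\alpha+\kappa}+|u_2|_{\alpha+\kappa})|u_2-u_1|_{-\alpha}|h|_{\alpha+\kappa}\qquad\text{for } u_1,u_2,h\in D((-A)^{\alpha+\kappa}).$$ *Noise.* On a probability space let $(\beta_p)_{p}$ be independent standard real Brownian motions, $(\epsilon_p)_p$ a complete orthonormal system of $H$, $\gamma_p\ge0$, $Q^{1/2}\epsilon_p=\sqrt{\gamma_p}\,\epsilon_p$, and let $W^Q(t)=\sum_p\sqrt{\gamma_p}\,\beta_p(t)\epsilon_p$ be the associated (possibly cylindrical) $Q$-Wiener process, so that $e^{\tau A}(W^Q(t)-W^Q(s))=\sum_p\sqrt{\gamma_p}\,(\beta_p(t)-\beta_p(s))\,e^{\tau A}\epsilon_p$, the series being summed in $L^2(\Omega;H)$. Let $$\overline\alpha=\sup\{\alpha>0:\ \|(-A)^{\alpha-\frac12}Q^{\frac12}\|_{\mathcal L_2(H)}<\infty\},$$ where $\|\cdot\|_{\mathcal L_2(H)}$ is the Hilbert–Schmidt norm;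 $\overline\alpha$ may be $+\infty$, and it is assumed that $\overline\alpha>0$. *Scheme.* Let $\Delta T>0$, let $J\ge1$ be an integer, $\delta t=\Delta T/J$, $t_n=n\Delta T$. For a step size $\tau$ and a time $s$, put $$\Phi_{\tau,s}(u)=e^{\tau A}u+\tau e^{\tau A}F(u)+e^{\tau A}\big(W^Q(s+\tau)-W^Q(s)\big)$$ (exponential Euler step). The coarse integrator is $\mathcal G_n=\Phi_{\Delta T,t_n}$ and the fine integrator is $\mathcal F_n=\Phi_{\delta t,t_n+(J-1)\delta t}\circ\cdots\circ\Phi_{\delta t,t_n}$. Given $u_0\in H$, the parareal iterates are defined by $u^{(k)}_0=u_0$ and $$u^{(0)}_{n+1}=\mathcal G_n(u^{(0)}_n),\qquad u^{(k+1)}_{n+1}=\mathcal G_n(u^{(k+1)}_n)+\mathcal F_n(u^{(k)}_n)-\mathcal G_n(u^{(k)}_n),$$ the reference solution by $u^{\rm ref}_0=u_0$, $u^{\rm ref}_{n+1}=\mathcal F_n(u^{\rm ref}_n)$, and the error is $\epsilon^{(k)}_n=u^{(k)}_n-u^{\rm ref}_n$. **Theorem.** Let $T\in(0,\infty)$, let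 $k\ge2$ and $q\ge1$ be integers, $\alpha\in(0,\min(\overline\alpha,\frac12))$ and $\kappa>0$. For every $u_0\in D((-A)^\alpha)$ there exists $C=C_{T,k,q,\alpha,\kappa}(u_0)\in(0,\infty)$ (which may also depend on $F$ and on the noise, but not on $\Delta T$ or $J$) such that, for all $\Delta T\in(0,1)$ and all integers $J\ge1$, $$\sup_{n\ge 0,\ n\Delta T\le T}\big(\mathbb E\,|\epsilon^{(k)}_n|^q\big)^{1/q}\le C\,\Delta T^{(k-1)\left(\min(2\alpha,\frac12)-\kappa\right)+2\alpha}.$$ -/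

import Mathlib

open MeasureTheory ProbabilityTheory
open scoped NNReal ENNReal

namespace Parareal

noncomputable section

/-- The Hilbert space `H = L²(0,1)`. -/
abbrev H : Type := Lp ℝ 2 (volume.restrict (Set.Ioo (0 : ℝ) 1))

/-- Eigenvalues of the negative Dirichlet Laplacian on `(0,1)`. The modes `1, 2, 3, …` are indexed
by `p = 0, 1, 2, …`, so the eigenvalue with index `p` is `((p + 1) π)²`. -/
def eigval (p : ℕ) : ℝ := (((p : ℝ) + 1) * Real.pi) ^ 2

lemma memLp_eigfun (p : ℕ) :
    MemLp (fun x : ℝ => Real.sqrt 2 * Real.sin (((p : ℝ) + 1) * Real.pi * x)) 2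
      (volume.restrict (Set.Ioo (0 : ℝ) 1)) := by
  refine MemLp.of_bound (Continuous.aestronglyMeasurable (by fun_prop)) (Real.sqrt 2) ?_
  refine Filter.Eventually.of_forall fun x => ?_
  rw [norm_mul, Real.norm_eq_abs, Real.norm_eq_abs, abs_of_nonneg (Real.sqrt_nonneg 2)]
  exact mul_le_of_le_one_right (Real.sqrt_nonneg 2) (Real.abs_sin_le_one _)

/-- Eigenfunctions `x ↦ √2 sin((p + 1) π x)` of the Dirichlet Laplacian, as elements of `H`. -/
def eigfun (p : ℕ) : H := (memLp_eigfun p).toLp _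

/-- The heat semigroup `e^{tA} u = ∑ₚ e^{-λₚ t} ⟨u, eₚ⟩ eₚ` of the Dirichlet Laplacian `A`. -/
def semigroup (t : ℝ) (u : H) : H :=
  ∑' p : ℕ, (Real.exp (-(eigval p * t)) * inner ℝ (eigfun p) u) • eigfun p

/-- The norm `|u|_s = (∑ₚ λₚ^{2s} ⟨u, eₚ⟩²)^{1/2} ∈ [0, ∞]`, that is `|(-A)^s u|`, for real `s` of
either sign. The domain `D((-A)^s)` is the set of `u` with `fracNorm s u < ∞`. -/
def fracNorm (s : ℝ) (u : H) : ℝ≥0∞ :=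
  (∑' p : ℕ, ENNReal.ofReal (eigval p ^ (2 * s) * (inner ℝ (eigfun p) u) ^ 2)) ^ (1 / 2 : ℝ)

/-- The assumptions on the nonlinearity: globally Lipschitz, twice Fréchet differentiable with
bounded derivatives, and three estimates in the norms `fracNorm`. -/
structure NonlinearityAssumption (F : H → H) : Prop where
  lipschitz : ∃ L : ℝ≥0, LipschitzWith L F
  differentiable : Differentiable ℝ F
  differentiable_fderiv : Differentiable ℝ (fderiv ℝ F)
  bounded_fderiv : ∃ M : ℝ, ∀ u, ‖fderiv ℝ F u‖ ≤ M
  bounded_fderiv_fderiv : ∃ M : ℝ, ∀ u, ‖fderiv ℝ (fderiv ℝ F) u‖ ≤ M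
  frac_estimates : ∀ α κ : ℝ, 0 < α → α < 1 / 2 → 0 < κ → κ < 1 / 2 - α →
    ∃ C : ℝ≥0, 0 < C ∧
      (∀ u h : H, fracNorm (α + κ) u < ∞ →
        fracNorm (-α) (fderiv ℝ F u h) ≤ C * (1 + fracNorm (α + κ) u) * fracNorm (-α) h) ∧
      (∀ u h : H, fracNorm α u < ∞ → fracNorm α h < ∞ →
        fracNorm (α - κ) (fderiv ℝ F u h) ≤ C * (1 + fracNorm α u) * fracNorm α h) ∧
      (∀ u₁ u₂ h : H, fracNorm (α + κ) u₁ < ∞ → fracNorm (α + κ) u₂ < ∞ →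
        fracNorm (α + κ) h < ∞ →
        fracNorm (-α) ((fderiv ℝ F u₂ - fderiv ℝ F u₁) h) ≤
          C * (1 + fracNorm (α + κ) u₁ + fracNorm (α + κ) u₂) * fracNorm (-α) (u₂ - u₁)
            * fracNorm (α + κ) h)

variable {Ω : Type*} [MeasurableSpace Ω]

/-- The data of a (possibly cylindrical) `Q`-Wiener process `∑ₚ √γₚ βₚ(t) εₚ`: a complete
orthonormal system `ε` of `H`, eigenvalues `γₚ ≥ 0` of `Q`, and independent standard real
Brownian motions `βₚ`. -/
structure QWiener (P : Measure Ω) where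
  basis : HilbertBasis ℕ ℝ H
  γ : ℕ → ℝ≥0
  β : ℕ → ℝ≥0 → Ω → ℝ
  brownian : ∀ p, IsBrownianReal (β p) P
  indep : iIndepFun (fun (p : ℕ) (ω : Ω) (t : ℝ≥0) => β p t ω) P

namespace QWiener

variable {P : Measure Ω} (W : QWiener P)

/-- The Hilbert–Schmidt norm of `(-A)^{α - 1/2} Q^{1/2}`, computed in the basis `ε` of
eigenvectors of `Q` (where `Q^{1/2} εₚ = √γₚ εₚ`), with value in `[0, ∞]`. -/
def hsNorm (α : ℝ) : ℝ≥0∞ :=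
  (∑' p : ℕ, fracNorm (α - 1 / 2) (Real.sqrt (W.γ p) • W.basis p) ^ 2) ^ (1 / 2 : ℝ)

/-- `ᾱ = sup {α > 0 : ‖(-A)^{α - 1/2} Q^{1/2}‖_{HS} < ∞}`, possibly `+∞`. -/
def alphaBar : EReal := sSup ((fun α : ℝ => (α : EReal)) '' {α : ℝ | 0 < α ∧ W.hsNorm α < ∞})

/-- The `p`-th term `√γₚ (βₚ(t) - βₚ(s)) e^{τA} εₚ` of the series for `e^{τA}(W(t) - W(s))`. -/
def noiseTerm (τ s t : ℝ) (p : ℕ) (ω : Ω) : H :=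
  (Real.sqrt (W.γ p) * (W.β p t.toNNReal ω - W.β p s.toNNReal ω)) • semigroup τ (W.basis p)

lemma memLp_noiseTerm (τ s t : ℝ) (p : ℕ) : MemLp (W.noiseTerm τ s t p) 2 P := by
  have h := fun r : ℝ≥0 => ((W.brownian p).hasLaw_eval r).hasGaussianLaw.memLp_two
  have h1 : MemLp (fun ω => Real.sqrt (W.γ p) *
      (W.β p t.toNNReal ω - W.β p s.toNNReal ω)) 2 P :=
    ((h _).sub (h _)).const_mul _
  exact ((ContinuousLinearMap.toSpanSingleton ℝ (semigroup τ (W.basis p))).comp_memLp' h1)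

/-- The random variable `e^{τA}(W(t) - W(s)) = ∑ₚ √γₚ (βₚ(t) - βₚ(s)) e^{τA} εₚ` with values in `H`;
the series is summed in `L²(Ω; H)`. For `τ > 0` it converges there as soon as
`‖(-A)^{α - 1/2} Q^{1/2}‖_{HS} < ∞` for some `α > 0`, also when `W` itself is not `H`-valued. -/
def noise (τ s t : ℝ) : Ω → H :=
  ((∑' p : ℕ, (W.memLp_noiseTerm τ s t p).toLp (W.noiseTerm τ s t p) : Lp H 2 P) : Ω → H)

end QWiener

variable {P : Measure Ω}

/-- One step of the exponential Euler scheme, from time `s` to time `s + τ`. -/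
def expEuler (F : H → H) (W : QWiener P) (τ s : ℝ) (ω : Ω) (u : H) : H :=
  semigroup τ u + τ • semigroup τ (F u) + W.noise τ s (s + τ) ω

/-- The coarse integrator `𝒢(·, tₙ, tₙ₊₁)`, where `tₙ = n ΔT`. -/
def coarse (F : H → H) (W : QWiener P) (ΔT : ℝ) (ω : Ω) (n : ℕ) (u : H) : H :=
  expEuler F W ΔT (n * ΔT) ω u

/-- The first `j` steps, of size `δt`, of the exponential Euler scheme started from `u` at
time `s`. -/
def fineSteps (F : H → H) (W : QWiener P) (δt s : ℝ) (ω : Ω) (u : H) : ℕ → H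
  | 0 => u
  | j + 1 => expEuler F W δt (s + j * δt) ω (fineSteps F W δt s ω u j)

/-- The fine integrator `ℱ(·, tₙ, tₙ₊₁)`: `J` exponential Euler steps of size `δt = ΔT / J`. -/
def fine (F : H → H) (W : QWiener P) (ΔT : ℝ) (J : ℕ) (ω : Ω) (n : ℕ) (u : H) : H :=
  fineSteps F W (ΔT / J) (n * ΔT) ω u J

/-- The parareal iterates `uₙ^{(k)}` (arguments `k`, then `n`) for given coarse and fine
integrators. -/
def parareal (G Φ : ℕ → H → H) (u₀ : H) : ℕ → ℕ → H
  | _, 0 => u₀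
  | 0, n + 1 => G n (parareal G Φ u₀ 0 n)
  | k + 1, n + 1 =>
      G n (parareal G Φ u₀ (k + 1) n) + Φ n (parareal G Φ u₀ k n) - G n (parareal G Φ u₀ k n)

/-- The reference solution, obtained with the fine integrator. -/
def reference (Φ : ℕ → H → H) (u₀ : H) : ℕ → H
  | 0 => u₀
  | n + 1 => Φ n (reference Φ u₀ n)

/-- The error `εₙ^{(k)} = uₙ^{(k)} - uₙ^{ref}`, as a random variable. -/
def error (F : H → H) (W : QWiener P) (u₀ : H) (ΔT : ℝ) (J k n : ℕ) (ω : Ω) : H :=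
  parareal (coarse F W ΔT ω) (fine F W ΔT J ω) u₀ k n - reference (fine F W ΔT J ω) u₀ n

end

end Parareal

namespace Parareal

noncomputable section

variable {Ω : Type*} [MeasurableSpace Ω] {P : Measure Ω}

/-! ### The sine basis -/

/-! The noise is additive and both integrators propagate the linear part exactly, through the
semigroup. Hence, when the parareal correction (fine minus coarse) at $u^{(k)}_m$ is compared with
the correction at the reference solution, noise and linear part cancel. What remains at the $j$-th
fine time of a coarse interval is the residual $[F(x_j)-F(v_j)]-e^{j\delta A}[F(x_0)-F(v_0)]$, where
$x_j$, $v_j$ are the fine trajectories started from $u^{(k)}_m$ and from the reference solution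
(`error_succ_eq`). It is small for two reasons at once: the starting points are close and little
time has elapsed.

The residual splits into $(1-e^{j\delta A})[F(x_j)-F(v_j)]$ and $e^{j\delta A}$ applied to a second
order difference of $F$. The first part, measured in $|\cdot|_{-1/2}$, gains $\Delta T^{1/2}$. By
the mean value inequality (`fracNorm_second_difference_le`) the second is controlled in
$|\cdot|_{-a}$ by two products. One is the time increment of the trajectories in $|\cdot|_{-b}$, of
order $\Delta T^{\alpha+b}$ because negative norms see more time regularity, times $|x_j-v_j|_{b'}$.
The other is the time increment of $x_j-v_j$, which contains no noise and is of order $\Delta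
T^{a+b'}$ relative to the initial error in $|\cdot|_{b'}$. The exponents are balanced by
$\alpha+b=a+b'\le\frac12$.

Discrete convolution with the semigroup brings the residual back to $|\cdot|_{b'}$ with a summable
singularity, since $b'+\frac12<1$, and a Gronwall argument sums up (`exists_error_propagation`). So
each iteration gains $\Delta T^{a+b'}$ (`exists_error_succ_bound`), starting from the order
$\alpha-b'$ of the coarse scheme in $|\cdot|_{b'}$ (`exists_error_zero_bound`). With
$b'=\min(\alpha,\frac12-\alpha)$ and $a$, $b$ equal to $\alpha$, $b'$ minus a small $\rho$, the
total order is $k(\alpha+b'-\rho)+\alpha-b'=(k-1)\min(2\alpha,\frac12)+2\alpha-k\rho$. Hölder's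
inequality makes each iteration consume moments of four times the order, so all orders are carried
along. -/

lemma inner_eigfun (p : ℕ) (u : H) :
    inner ℝ (eigfun p) u =
      ∫ x in Set.Ioo (0 : ℝ) 1, u x * (Real.sqrt 2 * Real.sin (((p : ℝ) + 1) * Real.pi * x)) := by
  rw [L2.inner_def]
  refine integral_congr_ae ?_
  filter_upwards [(memLp_eigfun p).coeFn_toLp] with x hx
  have : (eigfun p) x = Real.sqrt 2 * Real.sin (((p : ℝ) + 1) * Real.pi * x) := hx
  rw [this]
  simp

lemma intervalIntegral_cos_int_mul_pi {m : ℤ} (hm : m ≠ 0) :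
    ∫ x in (0 : ℝ)..1, Real.cos ((m : ℝ) * Real.pi * x) = 0 := by
  have hc : (m : ℝ) * Real.pi ≠ 0 := mul_ne_zero (by exact_mod_cast hm) Real.pi_ne_zero
  rw [intervalIntegral.integral_comp_mul_left _ hc]
  simp [Real.sin_int_mul_pi]

lemma inner_eigfun_eigfun (p r : ℕ) :
    inner ℝ (eigfun p) (eigfun r) = if p = r then (1 : ℝ) else 0 := by
  rw [inner_eigfun]
  have h1 : ∫ x in Set.Ioo (0 : ℝ) 1,
        (eigfun r) x * (Real.sqrt 2 * Real.sin (((p : ℝ) + 1) * Real.pi * x)) =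
      ∫ x in (0 : ℝ)..1, (Real.cos ((((r : ℤ) - p : ℤ) : ℝ) * Real.pi * x)
        - Real.cos ((((r : ℤ) + p + 2 : ℤ) : ℝ) * Real.pi * x)) := by
    rw [intervalIntegral.integral_of_le zero_le_one, integral_Ioc_eq_integral_Ioo]
    refine integral_congr_ae ?_
    filter_upwards [(memLp_eigfun r).coeFn_toLp] with x hx
    have : (eigfun r) x = Real.sqrt 2 * Real.sin (((r : ℝ) + 1) * Real.pi * x) := hx
    rw [this]
    have e1 : (((r : ℤ) - p : ℤ) : ℝ) * Real.pi * x =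
      ((r : ℝ) + 1) * Real.pi * x - ((p : ℝ) + 1) * Real.pi * x := by push_cast; ring
    have e2 : (((r : ℤ) + p + 2 : ℤ) : ℝ) * Real.pi * x =
      ((r : ℝ) + 1) * Real.pi * x + ((p : ℝ) + 1) * Real.pi * x := by push_cast; ring
    rw [e1, e2, Real.cos_sub, Real.cos_add]
    have := Real.mul_self_sqrt (show (0 : ℝ) ≤ 2 by norm_num)
    linear_combination (Real.sin (((r : ℝ) + 1) * Real.pi * x) *
      Real.sin (((p : ℝ) + 1) * Real.pi * x)) * this
  rw [h1, intervalIntegral.integral_sub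
    (Continuous.intervalIntegrable (by fun_prop) _ _)
    (Continuous.intervalIntegrable (by fun_prop) _ _),
    intervalIntegral_cos_int_mul_pi (m := (r : ℤ) + p + 2) (by omega)]
  split_ifs with h
  · subst h; simp
  · rw [intervalIntegral_cos_int_mul_pi (by omega)]; simp

lemma orthonormal_eigfun : Orthonormal ℝ eigfun := by
  rw [orthonormal_iff_ite]
  exact fun i j => by rw [inner_eigfun_eigfun]

lemma integral_sin_int_mul_eq_zero {u : H} (hu : ∀ p, inner ℝ (eigfun p) u = 0) (n : ℤ) :
    ∫ x in Set.Ioo (0 : ℝ) 1, u x * Real.sin ((n : ℝ) * Real.pi * x) = 0 := by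
  have key : ∀ m : ℕ, ∫ x in Set.Ioo (0 : ℝ) 1, u x * Real.sin ((m : ℝ) * Real.pi * x) = 0 := by
    intro m
    rcases m with _ | m
    · simp
    · have := hu m
      rw [inner_eigfun] at this
      have h2 : ∫ x in Set.Ioo (0 : ℝ) 1,
          u x * (Real.sqrt 2 * Real.sin (((m : ℝ) + 1) * Real.pi * x)) =
          Real.sqrt 2 * ∫ x in Set.Ioo (0 : ℝ) 1,
            u x * Real.sin ((((m + 1 : ℕ)) : ℝ) * Real.pi * x) := by
        rw [← integral_const_mul]
        congr 1; ext x; push_cast; ring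
      rw [h2] at this
      simpa using this
  obtain ⟨m, rfl | rfl⟩ := n.eq_nat_or_neg
  · exact_mod_cast key m
  · have := key m
    simp only [Int.cast_neg, Int.cast_natCast, neg_mul, Real.sin_neg, mul_neg]
    rw [integral_neg, this, neg_zero]

/-- Completeness of the sine system: extend $u$ by zero to $f$. The Fourier coefficients on $(-1,1]$
of the odd function $f(x)-f(-x)$ are multiples of sine integrals of $u$, so they vanish. Parseval
makes this function zero, and on $(0,1)$ it coincides with $u$. -/
lemma eq_zero_of_inner_eigfun {u : H} (hu : ∀ p, inner ℝ (eigfun p) u = 0) : u = 0 := by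
  set f : ℝ → ℝ := (Set.Ioo (0 : ℝ) 1).indicator u with hf
  have hfm : MemLp f 2 volume := (memLp_indicator_iff_restrict measurableSet_Ioo).2 (Lp.memLp u)
  have hfi : Integrable f volume :=
    (integrable_indicator_iff measurableSet_Ioo).2 ((Lp.memLp u).integrable (by norm_num))
  have hfn : MemLp (fun x => f (-x)) 2 volume :=
    hfm.comp_measurePreserving (Measure.measurePreserving_neg volume)
  have hg : MemLp (fun x => f x - f (-x)) 2 volume := hfm.sub hfn
  have hgc : MemLp (fun x => ((f x - f (-x) : ℝ) : ℂ)) 2 volume := hg.ofReal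
  have hlt : (-1 : ℝ) < 1 := by norm_num
  have hcoef : ∀ n : ℤ, fourierCoeffOn hlt (fun x => ((f x - f (-x) : ℝ) : ℂ)) n = 0 := by
    intro n
    rw [fourierCoeffOn_eq_integral]
    have hexp : ∀ x : ℝ, (fourier (-n) (x : AddCircle ((1 : ℝ) - (-1))) : ℂ) =
        Complex.exp (-((n * Real.pi * x : ℝ) : ℂ) * Complex.I) := by
      intro x
      rw [fourier_coe_apply]
      congr 1
      push_cast
      ring
    have h1 : ∫ x in (-1 : ℝ)..1, fourier (-n) (x : AddCircle ((1 : ℝ) - (-1))) •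
        ((f x - f (-x) : ℝ) : ℂ) =
        ∫ x : ℝ, (Complex.exp (-((n * Real.pi * x : ℝ) : ℂ) * Complex.I) * (f x : ℂ) -
          Complex.exp (-((n * Real.pi * x : ℝ) : ℂ) * Complex.I) * (f (-x) : ℂ)) := by
      rw [intervalIntegral.integral_of_le hlt.le, ← integral_indicator measurableSet_Ioc]
      congr 1; ext x
      by_cases hx : x ∈ Set.Ioc (-1 : ℝ) 1
      · rw [Set.indicator_of_mem hx, hexp, smul_eq_mul]; push_cast; ring
      · rw [Set.indicator_of_notMem hx]
        have e1 : f x = 0 := Set.indicator_of_notMem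
          (fun h => hx ⟨by linarith [h.1], h.2.le⟩) _
        by_cases hx1 : -x ∈ Set.Ioo (0 : ℝ) 1
        · exact absurd ⟨by linarith [hx1.2], by linarith [hx1.1]⟩ hx
        · have e2 : f (-x) = 0 := Set.indicator_of_notMem hx1 _
          simp [e1, e2]
    -- The values $s=1$ and $s=-1$ serve the exponential and its reflection under $x\mapsto-x$.
    have hE : ∀ s : ℝ, Integrable (fun x : ℝ =>
        Complex.exp (-((n * Real.pi * (s * x) : ℝ) : ℂ) * Complex.I) * (f x : ℂ)) := by
      intro s
      refine Integrable.bdd_mul (c := 1) hfi.ofReal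
        (Continuous.aestronglyMeasurable (by fun_prop)) ?_
      refine Filter.Eventually.of_forall fun x => ?_
      rw [← Complex.ofReal_neg, Complex.norm_exp_ofReal_mul_I]
    have h2 : Integrable (fun x : ℝ =>
        Complex.exp (-((n * Real.pi * x : ℝ) : ℂ) * Complex.I) * (f (-x) : ℂ)) := by
      have := (hE (-1)).comp_neg
      refine this.congr (Filter.Eventually.of_forall fun x => ?_)
      simp
    have h3 : ∫ x : ℝ, Complex.exp (-((n * Real.pi * x : ℝ) : ℂ) * Complex.I) * (f (-x) : ℂ) =
        ∫ x : ℝ, Complex.exp (-((n * Real.pi * ((-1) * x) : ℝ) : ℂ) * Complex.I) * (f x : ℂ) := by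
      rw [← integral_neg_eq_self (fun x : ℝ =>
        Complex.exp (-((n * Real.pi * x : ℝ) : ℂ) * Complex.I) * (f (-x) : ℂ))]
      simp
    have h4 := hE 1
    simp only [one_mul] at h4
    rw [h1, integral_sub h4 h2, h3, ← integral_sub h4 (hE (-1))]
    have h5 : ∀ x : ℝ, Complex.exp (-((n * Real.pi * x : ℝ) : ℂ) * Complex.I) * (f x : ℂ) -
        Complex.exp (-((n * Real.pi * ((-1) * x) : ℝ) : ℂ) * Complex.I) * (f x : ℂ) =
        (-2 * Complex.I) * ((f x * Real.sin (n * Real.pi * x) : ℝ) : ℂ) := by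
      intro x
      have e : (-((n * Real.pi * ((-1) * x) : ℝ) : ℂ)) = ((n * Real.pi * x : ℝ) : ℂ) := by
        push_cast; ring
      rw [e, Complex.exp_mul_I, Complex.exp_mul_I, Complex.cos_neg, Complex.sin_neg]
      push_cast
      ring
    simp_rw [h5]
    rw [integral_const_mul, integral_complex_ofReal]
    have h6 : ∫ x : ℝ, f x * Real.sin (n * Real.pi * x) = 0 := by
      rw [← integral_sin_int_mul_eq_zero hu n, ← integral_indicator measurableSet_Ioo]
      congr 1; ext x
      simp only [hf, Set.indicator_mul_left]
    rw [h6]; simp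
  have hs := tsum_sq_fourierCoeffOn hlt (hgc.restrict (Set.Ioc (-1) 1))
  simp only [hcoef, norm_zero, ne_eq, OfNat.ofNat_ne_zero, not_false_eq_true, zero_pow,
    tsum_zero] at hs
  have hs0 : ∫ x in Set.Ioc (-1 : ℝ) 1, ‖((f x - f (-x) : ℝ) : ℂ)‖ ^ 2 = 0 := by
    rw [intervalIntegral.integral_of_le hlt.le] at hs
    simpa using hs.symm
  rw [integral_eq_zero_iff_of_nonneg (fun x => by positivity)
    ((hgc.restrict (Set.Ioc (-1) 1)).integrable_norm_pow (by norm_num))] at hs0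
  have hs1 : ∀ᵐ x ∂(volume.restrict (Set.Ioo (0 : ℝ) 1)), u x = 0 := by
    have := ae_restrict_of_ae_restrict_of_subset
      (show Set.Ioo (0 : ℝ) 1 ⊆ Set.Ioc (-1) 1 from fun x hx => ⟨by linarith [hx.1], hx.2.le⟩) hs0
    filter_upwards [this, ae_restrict_mem measurableSet_Ioo] with x hx hx1
    have e1 : f x = u x := Set.indicator_of_mem hx1 _
    have e2 : f (-x) = 0 := Set.indicator_of_notMem (fun h => by linarith [h.1, hx1.1]) _
    have : ‖((f x - f (-x) : ℝ) : ℂ)‖ ^ 2 = 0 := hx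
    rw [e1, e2, sub_zero] at this
    simpa using this
  exact (Lp.eq_zero_iff_ae_eq_zero).2 hs1

/-- The eigenfunctions of the Dirichlet Laplacian as a Hilbert basis. -/
def sineBasis : HilbertBasis ℕ ℝ H :=
  HilbertBasis.mkOfOrthogonalEqBot orthonormal_eigfun (by
    rw [Submodule.eq_bot_iff]
    intro u hu
    refine eq_zero_of_inner_eigfun fun p => ?_
    exact (Submodule.mem_orthogonal _ _).1 hu _ (Submodule.subset_span ⟨p, rfl⟩))

lemma sineBasis_apply (p : ℕ) : sineBasis p = eigfun p := by
  rw [sineBasis, HilbertBasis.coe_mkOfOrthogonalEqBot]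

/-- The coordinates in the basis of eigenfunctions. -/
def coord (p : ℕ) : H →L[ℝ] ℝ := innerSL ℝ (eigfun p)

lemma coord_apply (p : ℕ) (u : H) : coord p u = inner ℝ (eigfun p) u := rfl

lemma ext_coord {u v : H} (h : ∀ p, coord p u = coord p v) : u = v := by
  rw [← sub_eq_zero]
  refine eq_zero_of_inner_eigfun fun p => ?_
  rw [← coord_apply, map_sub, h, sub_self]

lemma hasSum_coord_sq (u : H) : HasSum (fun p => coord p u ^ 2) (‖u‖ ^ 2) := by
  have h := sineBasis.hasSum_inner_mul_inner u u
  rw [real_inner_self_eq_norm_sq] at h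
  have e : (fun p => coord p u ^ 2) =
      fun p => inner ℝ u (sineBasis p) * inner ℝ (sineBasis p) u := by
    ext p
    rw [sineBasis_apply, real_inner_comm, coord_apply, sq]
  rw [e]
  exact h

lemma coord_tsum_smul_eigfun {a : ℕ → ℝ} (ha : Summable fun p => a p ^ 2) (p : ℕ) :
    coord p (∑' r, a r • eigfun r) = a p := by
  have hm : Memℓp a 2 := memℓp_gen (by simpa using ha)
  have h := (sineBasis.hasSum_repr_symm ⟨a, hm⟩).tsum_eq
  simp only [sineBasis_apply] at h
  rw [h, coord_apply, ← sineBasis_apply, ← sineBasis.repr_apply_apply]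
  simp

/-! ### Diagonal operators and the semigroup -/

lemma summable_mul_coord_sq {c : ℕ → ℝ} (hc : ∀ p, |c p| ≤ 1) (u : H) :
    Summable fun p => (c p * coord p u) ^ 2 := by
  refine Summable.of_nonneg_of_le (fun p => sq_nonneg _) (fun p => ?_) (hasSum_coord_sq u).summable
  rw [mul_pow]
  refine mul_le_of_le_one_left (sq_nonneg _) ?_
  rw [← sq_abs]
  exact pow_le_one₀ (abs_nonneg _) (hc p)

/-- The diagonal operator with coefficients `c` bounded by `1`. -/
def diag (c : ℕ → ℝ) (hc : ∀ p, |c p| ≤ 1) : H →L[ℝ] H :=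
  LinearMap.mkContinuous
    { toFun := fun u => ∑' p, (c p * coord p u) • eigfun p
      map_add' := fun u v => ext_coord fun p => by
        rw [map_add, coord_tsum_smul_eigfun (summable_mul_coord_sq hc _),
          coord_tsum_smul_eigfun (summable_mul_coord_sq hc _),
          coord_tsum_smul_eigfun (summable_mul_coord_sq hc _), map_add, mul_add]
      map_smul' := fun r u => ext_coord fun p => by
        rw [map_smul, coord_tsum_smul_eigfun (summable_mul_coord_sq hc _),
          coord_tsum_smul_eigfun (summable_mul_coord_sq hc _), map_smul]
        simp only [smul_eq_mul, RingHom.id_apply]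
        ring } 1 (fun u => by
      rw [one_mul]
      refine abs_le_of_sq_le_sq' ?_ (norm_nonneg _) |>.2
      refine hasSum_le (fun p => ?_) (hasSum_coord_sq _) (hasSum_coord_sq u)
      simp only [LinearMap.coe_mk, AddHom.coe_mk]
      rw [coord_tsum_smul_eigfun (summable_mul_coord_sq hc _), mul_pow]
      refine mul_le_of_le_one_left (sq_nonneg _) ?_
      rw [← sq_abs]
      exact pow_le_one₀ (abs_nonneg _) (hc p))

lemma coord_diag (c : ℕ → ℝ) (hc : ∀ p, |c p| ≤ 1) (u : H) (p : ℕ) :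
    coord p (diag c hc u) = c p * coord p u :=
  coord_tsum_smul_eigfun (summable_mul_coord_sq hc u) p

lemma one_le_eigval (p : ℕ) : 1 ≤ eigval p := by
  have h1 : (1 : ℝ) ≤ (p : ℝ) + 1 := by linarith [(Nat.cast_nonneg p : (0 : ℝ) ≤ p)]
  have h2 : (1 : ℝ) ≤ Real.pi := by linarith [Real.pi_gt_three]
  exact one_le_pow₀ (one_le_mul_of_one_le_of_one_le h1 h2)

lemma eigval_pos (p : ℕ) : 0 < eigval p := zero_lt_one.trans_le (one_le_eigval p)

lemma abs_exp_eigval_le {t : ℝ} (ht : 0 ≤ t) (p : ℕ) : |Real.exp (-(eigval p * t))| ≤ 1 := by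
  rw [abs_of_pos (Real.exp_pos _), Real.exp_le_one_iff]
  linarith [mul_nonneg (eigval_pos p).le ht]

/-- The heat semigroup as a continuous linear map. -/
def heat (t : ℝ≥0) : H →L[ℝ] H :=
  diag (fun p => Real.exp (-(eigval p * t))) (fun p => abs_exp_eigval_le t.2 p)

lemma coord_heat (t : ℝ≥0) (u : H) (p : ℕ) :
    coord p (heat t u) = Real.exp (-(eigval p * t)) * coord p u :=
  coord_diag _ _ u p

lemma semigroup_eq_heat {t : ℝ} (ht : 0 ≤ t) (u : H) : semigroup t u = heat t.toNNReal u := by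
  conv_lhs => rw [← Real.coe_toNNReal t ht]
  rfl

lemma heat_zero (u : H) : heat 0 u = u := ext_coord fun p => by simp [coord_heat]

lemma heat_add (s t : ℝ≥0) (u : H) : heat (s + t) u = heat s (heat t u) :=
  ext_coord fun p => by
    rw [coord_heat, coord_heat, coord_heat, ← mul_assoc, ← Real.exp_add]
    push_cast
    ring_nf

/-! ### The norms `fracNorm` -/

/-- As a weighted $\ell^2$ norm, `fracNorm` inherits the triangle inequality and homogeneity from
`eLpNorm`, with the value $\infty$ allowed. -/
lemma fracNorm_eq_eLpNorm (s : ℝ) (u : H) :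
    fracNorm s u = eLpNorm (fun p => eigval p ^ s * coord p u) 2 Measure.count := by
  rw [eLpNorm_eq_lintegral_rpow_enorm_toReal (by norm_num) (by norm_num), lintegral_count, fracNorm]
  congr 1
  refine tsum_congr fun p => ?_
  rw [Real.enorm_eq_ofReal_abs, ENNReal.toReal_ofNat, ENNReal.rpow_ofNat,
    ← ENNReal.ofReal_pow (abs_nonneg _), sq_abs, mul_pow, ← Real.rpow_natCast (eigval p ^ s),
    ← Real.rpow_mul (eigval_pos p).le, coord_apply]
  congr 3
  push_cast; ring

lemma fracNorm_add_le (s : ℝ) (u v : H) : fracNorm s (u + v) ≤ fracNorm s u + fracNorm s v := by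
  simp only [fracNorm_eq_eLpNorm]
  refine le_trans (le_of_eq ?_) (eLpNorm_add_le (by fun_prop) (by fun_prop) (by norm_num))
  congr 1; ext p
  simp [mul_add]

lemma fracNorm_smul (s c : ℝ) (u : H) : fracNorm s (c • u) = ‖c‖ₑ * fracNorm s u := by
  simp only [fracNorm_eq_eLpNorm]
  rw [← eLpNorm_const_smul]
  congr 1; ext p
  simp only [map_smul, smul_eq_mul, Pi.smul_apply]
  ring

lemma fracNorm_neg (s : ℝ) (u : H) : fracNorm s (-u) = fracNorm s u := by
  rw [← neg_one_smul ℝ u, fracNorm_smul]; simp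

@[simp] lemma fracNorm_zero_right (s : ℝ) : fracNorm s 0 = 0 := by
  rw [← zero_smul ℝ (0 : H), fracNorm_smul]; simp

lemma fracNorm_sub_le (s : ℝ) (u v : H) : fracNorm s (u - v) ≤ fracNorm s u + fracNorm s v := by
  rw [sub_eq_add_neg, ← fracNorm_neg s v]; exact fracNorm_add_le s u (-v)

lemma fracNorm_le_of_coord {s r K : ℝ} (hK : 0 ≤ K) {x u : H}
    (h : ∀ p, eigval p ^ s * |coord p x| ≤ K * (eigval p ^ r * |coord p u|)) :
    fracNorm s x ≤ ENNReal.ofReal K * fracNorm r u := by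
  have e : ENNReal.ofReal K = ‖K‖ₑ := by rw [Real.enorm_eq_ofReal_abs, abs_of_nonneg hK]
  simp only [fracNorm_eq_eLpNorm]
  rw [e, ← eLpNorm_const_smul]
  refine eLpNorm_mono fun p => ?_
  simp only [Pi.smul_apply, smul_eq_mul, norm_mul, Real.norm_eq_abs]
  rw [abs_of_nonneg hK, abs_of_pos (Real.rpow_pos_of_pos (eigval_pos p) _),
    abs_of_pos (Real.rpow_pos_of_pos (eigval_pos p) _)]
  exact h p

lemma fracNorm_mono {s r : ℝ} (h : s ≤ r) (u : H) : fracNorm s u ≤ fracNorm r u := by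
  have := fracNorm_le_of_coord (s := s) (r := r) zero_le_one (x := u) (u := u) (fun p => by
    rw [one_mul]
    exact mul_le_mul_of_nonneg_right (Real.rpow_le_rpow_of_exponent_le (one_le_eigval p) h)
      (abs_nonneg _))
  simpa using this

lemma fracNorm_zero (u : H) : fracNorm 0 u = ‖u‖ₑ := by
  rw [fracNorm]
  have : ∀ p, eigval p ^ (2 * (0 : ℝ)) * (inner ℝ (eigfun p) u) ^ 2 = coord p u ^ 2 := fun p => by
    simp [coord_apply]
  simp_rw [this]
  rw [← ENNReal.ofReal_tsum_of_nonneg (fun p => sq_nonneg _) (hasSum_coord_sq u).summable,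
    (hasSum_coord_sq u).tsum_eq, ENNReal.ofReal_rpow_of_nonneg (by positivity) (by norm_num),
    ← Real.sqrt_eq_rpow, Real.sqrt_sq (norm_nonneg u), ofReal_norm]

/-- For $a\ge0$ the operator $(-A)^{-a}$ is bounded, so calculus in the norm $|\cdot|_{-a}$ reduces
to calculus in $H$. -/
lemma fracNorm_eq_enorm_diag {a : ℝ} (h) (u : H) :
    fracNorm (-a) u = ‖diag (fun p => eigval p ^ (-a)) h u‖ₑ := by
  rw [← fracNorm_zero, fracNorm_eq_eLpNorm, fracNorm_eq_eLpNorm]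
  congr 1; ext p
  rw [coord_diag]; simp

lemma abs_eigval_rpow_neg_le {a : ℝ} (ha : 0 ≤ a) (p : ℕ) : |eigval p ^ (-a)| ≤ 1 := by
  rw [abs_of_pos (Real.rpow_pos_of_pos (eigval_pos p) _)]
  exact Real.rpow_le_one_of_one_le_of_nonpos (one_le_eigval p) (by linarith)

lemma aemeasurable_fracNorm {Ω : Type*} [MeasurableSpace Ω] {P : Measure Ω} (s : ℝ) {X : Ω → H}
    (hX : AEStronglyMeasurable X P) : AEMeasurable (fun ω => fracNorm s (X ω)) P := by
  unfold fracNorm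
  refine AEMeasurable.pow_const (AEMeasurable.tsum fun p => ?_) _
  refine ENNReal.measurable_ofReal.comp_aemeasurable
    (AEMeasurable.const_mul (AEMeasurable.pow_const ?_ 2) _)
  exact ((coord p).continuous.comp_aestronglyMeasurable hX).aemeasurable

/-! ### Smoothing -/

lemma rpow_mul_exp_neg_le {θ x : ℝ} (h0 : 0 ≤ θ) (h1 : θ ≤ 1) (hx : 0 ≤ x) :
    x ^ θ * Real.exp (-x) ≤ 1 := by
  rw [Real.exp_neg, ← div_eq_mul_inv, div_le_one (Real.exp_pos x)]
  rcases le_total x 1 with h | h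
  · exact (Real.rpow_le_one hx h h0).trans (Real.one_le_exp hx)
  · refine le_trans ?_ (le_trans (by linarith) (Real.add_one_le_exp x))
    calc x ^ θ ≤ x ^ (1 : ℝ) := Real.rpow_le_rpow_of_exponent_le h h1
      _ = x := Real.rpow_one x

lemma one_sub_exp_neg_le {θ x : ℝ} (h0 : 0 ≤ θ) (h1 : θ ≤ 1) (hx : 0 ≤ x) :
    1 - Real.exp (-x) ≤ x ^ θ := by
  rcases le_total x 1 with h | h
  · calc 1 - Real.exp (-x) ≤ x := by linarith [Real.add_one_le_exp (-x)]
      _ = x ^ (1 : ℝ) := (Real.rpow_one x).symm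
      _ ≤ x ^ θ := Real.rpow_le_rpow_of_exponent_ge' hx h h0 h1
  · have := Real.one_le_rpow h h0
    linarith [Real.exp_pos (-x)]

/-- This is $x^\theta e^{-x}\le1$ at $x=\lambda_pt$, $\theta=s-r\in[0,1]$, coordinate by coordinate;
the constant is therefore $1$. -/
lemma fracNorm_heat_le {s r : ℝ} (h0 : r ≤ s) (h1 : s - r ≤ 1) {t : ℝ≥0} (ht : 0 < t) (u : H) :
    fracNorm s (heat t u) ≤ ENNReal.ofReal ((t : ℝ) ^ (-(s - r))) * fracNorm r u := by
  have ht' : (0 : ℝ) < t := ht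
  refine fracNorm_le_of_coord (by positivity) fun p => ?_
  have hl := eigval_pos p
  have h := rpow_mul_exp_neg_le (θ := s - r) (by linarith) h1 (x := eigval p * t) (by positivity)
  rw [Real.mul_rpow hl.le ht'.le] at h
  rw [coord_heat, abs_mul, abs_of_pos (Real.exp_pos _)]
  have e : eigval p ^ s = eigval p ^ r * eigval p ^ (s - r) := by
    rw [← Real.rpow_add hl]; ring_nf
  have e2 : (t : ℝ) ^ (-(s - r)) * (t : ℝ) ^ (s - r) = 1 := by
    rw [← Real.rpow_add ht']; simp
  calc eigval p ^ s * (Real.exp (-(eigval p * t)) * |coord p u|)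
      = (t : ℝ) ^ (-(s - r)) * (eigval p ^ r * |coord p u|) *
          (eigval p ^ (s - r) * (t : ℝ) ^ (s - r) * Real.exp (-(eigval p * t))) := by
        rw [e]
        linear_combination (-(eigval p ^ r * eigval p ^ (s - r) * Real.exp (-(eigval p * t)) *
          |coord p u|)) * e2
    _ ≤ (t : ℝ) ^ (-(s - r)) * (eigval p ^ r * |coord p u|) * 1 := by gcongr
    _ = _ := mul_one _

lemma fracNorm_heat_self_le (s : ℝ) (t : ℝ≥0) (u : H) : fracNorm s (heat t u) ≤ fracNorm s u := by
  have := fracNorm_le_of_coord (s := s) (r := s) zero_le_one (x := heat t u) (u := u) (fun p => by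
    rw [one_mul, coord_heat, abs_mul]
    exact mul_le_mul_of_nonneg_left (mul_le_of_le_one_left (abs_nonneg _)
      (abs_exp_eigval_le t.2 p)) (Real.rpow_nonneg (eigval_pos p).le _))
  simpa using this

/-- This is $1-e^{-x}\le x^\theta$ at $x=\lambda_pt$: regularity given up in space is regained as a
power of $t$. -/
lemma fracNorm_heat_sub_le {s r : ℝ} (h0 : s ≤ r) (h1 : r - s ≤ 1) (t : ℝ≥0) (u : H) :
    fracNorm s (heat t u - u) ≤ ENNReal.ofReal ((t : ℝ) ^ (r - s)) * fracNorm r u := by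
  refine fracNorm_le_of_coord (by positivity) fun p => ?_
  have hl := eigval_pos p
  have h := one_sub_exp_neg_le (θ := r - s) (by linarith) h1 (x := eigval p * t) (by positivity)
  rw [Real.mul_rpow hl.le t.coe_nonneg] at h
  have e3 : coord p (heat t u - u) = -((1 - Real.exp (-(eigval p * t))) * coord p u) := by
    rw [map_sub, coord_heat]; ring
  have e1 : 0 ≤ 1 - Real.exp (-(eigval p * t)) := by
    have := abs_exp_eigval_le t.2 p
    rw [abs_of_pos (Real.exp_pos _)] at this
    exact sub_nonneg.2 this
  have e : eigval p ^ r = eigval p ^ s * eigval p ^ (r - s) := by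
    rw [← Real.rpow_add hl]; ring_nf
  rw [e3, abs_neg, abs_mul, abs_of_nonneg e1, e]
  calc eigval p ^ s * ((1 - Real.exp (-(eigval p * t))) * |coord p u|)
      ≤ eigval p ^ s * ((eigval p ^ (r - s) * (t : ℝ) ^ (r - s)) * |coord p u|) := by gcongr
    _ = _ := by ring

/-! ### Gaussian sums -/

/-- The `L^m` norm of a standard real Gaussian variable. -/
def gaussMoment (m : ℕ) : ℝ≥0∞ := eLpNorm (id : ℝ → ℝ) m (gaussianReal 0 1)

lemma gaussMoment_lt_top (m : ℕ) : gaussMoment m < ∞ :=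
  (memLp_id_gaussianReal' (m : ℝ≥0∞) (ENNReal.natCast_ne_top m)).2

lemma eLpNorm_of_hasLaw_gaussian {X : Ω → ℝ} {v : ℝ≥0} (hX : HasLaw X (gaussianReal 0 v) P)
    (m : ℕ) : eLpNorm X m P = ENNReal.ofReal (Real.sqrt v) * gaussMoment m := by
  have h1 : eLpNorm X m P = eLpNorm (id : ℝ → ℝ) m (gaussianReal 0 v) := by
    rw [← hX.map_eq, eLpNorm_map_measure aestronglyMeasurable_id hX.aemeasurable]
    rfl
  have h2 : gaussianReal 0 v = (gaussianReal 0 1).map (Real.sqrt v * ·) := by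
    rw [gaussianReal_map_const_mul, mul_zero, mul_one]
    congr 1
    ext
    simp
  rw [h1, h2, eLpNorm_map_measure aestronglyMeasurable_id (by fun_prop), gaussMoment]
  have h3 : (id ∘ (fun x : ℝ => Real.sqrt v * x)) = Real.sqrt v • (id : ℝ → ℝ) := by
    ext x; simp
  rw [h3, eLpNorm_const_smul, Real.enorm_eq_ofReal_abs, abs_of_nonneg (Real.sqrt_nonneg _)]

lemma hasLaw_gaussian_sum [IsProbabilityMeasure P] {ι : Type*} {X : ι → Ω → ℝ} {v : ι → ℝ≥0}
    (hX : ∀ i, HasLaw (X i) (gaussianReal 0 (v i)) P) (hi : iIndepFun X P) (s : Finset ι) :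
    HasLaw (∑ i ∈ s, X i) (gaussianReal 0 (∑ i ∈ s, v i)) P := by
  classical
  induction s using Finset.induction_on with
  | empty =>
    simp only [Finset.sum_empty, gaussianReal_zero_var]
    exact hasLaw_dirac_of_ae_eq (Filter.Eventually.of_forall fun _ => rfl)
  | insert a s ha ih =>
    rw [Finset.sum_insert ha, Finset.sum_insert ha]
    have hind := (hi.indepFun_finsetSum_of_notMem₀ (fun i => (hX i).aemeasurable) ha).symm
    refine ⟨(hX a).aemeasurable.add ih.aemeasurable, ?_⟩
    have := gaussianReal_add_gaussianReal_of_indepFun hind (hX a).map_eq ih.map_eq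
    rwa [zero_add] at this

lemma summable_of_pairwise_inner_eq_zero {E : Type*} [NormedAddCommGroup E]
    [InnerProductSpace ℝ E] [CompleteSpace E] {f : ℕ → E}
    (h0 : ∀ i j, i ≠ j → inner ℝ (f i) (f j) = 0) (hs : Summable fun i => ‖f i‖ ^ 2) :
    Summable f := by
  have hn : ∀ t : Finset ℕ, ‖∑ i ∈ t, f i‖ ^ 2 = ∑ i ∈ t, ‖f i‖ ^ 2 := by
    intro t
    rw [← real_inner_self_eq_norm_sq, sum_inner]
    refine Finset.sum_congr rfl fun i hi => ?_
    rw [inner_sum, Finset.sum_eq_single i (fun j _ hj => h0 i j hj.symm) (fun h => absurd hi h),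
      real_inner_self_eq_norm_sq]
  rw [summable_iff_vanishing_norm] at hs ⊢
  intro ε hε
  obtain ⟨s, hs⟩ := hs (ε ^ 2) (by positivity)
  refine ⟨s, fun t ht => ?_⟩
  have := hs t ht
  rw [← hn, Real.norm_of_nonneg (by positivity)] at this
  exact lt_of_pow_lt_pow_left₀ 2 hε.le this

/-- Independent centred coefficients make the terms orthogonal in $L^2(\Omega;E)$, so square
summability of the vectors suffices. -/
lemma summable_toLp_smul {E : Type*} [NormedAddCommGroup E] [InnerProductSpace ℝ E]
    [CompleteSpace E] {X : ℕ → Ω → ℝ} {v : ℝ≥0}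
    (hX : ∀ l, HasLaw (X l) (gaussianReal 0 v) P) (hi : iIndepFun X P) {h : ℕ → E}
    (hs : Summable fun l => ‖h l‖ ^ 2) (f : ℕ → Ω → E) (hf : ∀ l, MemLp (f l) 2 P)
    (hfX : ∀ l ω, f l ω = X l ω • h l) :
    Summable fun l => (hf l).toLp (f l) := by
  refine summable_of_pairwise_inner_eq_zero (fun i j hij => ?_) ?_
  · rw [L2.inner_def]
    have h1 : ∫ ω, inner ℝ ((hf i).toLp (f i) ω) ((hf j).toLp (f j) ω) ∂P =
        ∫ ω, (X i ω * X j ω) * inner ℝ (h i) (h j) ∂P := by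
      refine integral_congr_ae ?_
      filter_upwards [(hf i).coeFn_toLp, (hf j).coeFn_toLp] with ω h1 h2
      rw [h1, h2, hfX, hfX, real_inner_smul_left, real_inner_smul_right]
      ring
    rw [h1, integral_mul_const, (hi.indepFun hij).integral_fun_mul_eq_mul_integral
      (hX i).aemeasurable.aestronglyMeasurable (hX j).aemeasurable.aestronglyMeasurable,
      (hX i).integral_eq, integral_id_gaussianReal]
    simp
  · have h2 : ∀ l, ‖(hf l).toLp (f l)‖ ^ 2 =
        (ENNReal.ofReal (Real.sqrt v) * gaussMoment 2).toReal ^ 2 * ‖h l‖ ^ 2 := by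
      intro l
      rw [Lp.norm_toLp, ← mul_pow]
      congr 1
      have e : eLpNorm (f l) 2 P = eLpNorm (‖h l‖ • X l) 2 P := by
        refine eLpNorm_congr_norm_ae (Filter.Eventually.of_forall fun ω => ?_)
        rw [hfX, norm_smul, Pi.smul_apply, norm_smul, norm_norm, mul_comm]
      have e2 := eLpNorm_of_hasLaw_gaussian (hX l) 2
      rw [Nat.cast_ofNat] at e2
      rw [e, eLpNorm_const_smul, e2, ENNReal.toReal_mul, mul_comm]
      simp
    simp_rw [h2]
    exact hs.mul_left _

/-- Minkowski's inequality for countable sums of nonnegative functions. -/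
lemma eLpNorm_tsum_le {q : ℝ≥0∞} (hq : 1 ≤ q) (hq' : q ≠ ∞) {y : ℕ → Ω → ℝ≥0∞}
    (hy : ∀ p, AEMeasurable (y p) P) :
    eLpNorm (fun ω => ∑' p, y p ω) q P ≤ ∑' p, eLpNorm (y p) q P := by
  have hq0 : q ≠ 0 := (zero_lt_one.trans_le hq).ne'
  have hqr : 0 < q.toReal := ENNReal.toReal_pos hq0 hq'
  have hfin : ∀ n : ℕ, eLpNorm (fun ω => ∑ p ∈ Finset.range n, y p ω) q P ≤
      ∑' p, eLpNorm (y p) q P := by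
    intro n
    refine le_trans ?_ (ENNReal.sum_le_tsum (Finset.range n))
    refine le_trans (le_of_eq ?_)
      (eLpNorm_sum_le (f := y) (fun i _ => (hy i).aestronglyMeasurable) hq)
    congr 1; ext ω; simp
  set A := ∑' p, eLpNorm (y p) q P with hA
  rw [eLpNorm_eq_lintegral_rpow_enorm_toReal hq0 hq']
  simp only [enorm_eq_self]
  rw [one_div, ENNReal.rpow_inv_le_iff hqr]
  have hint : ∀ n : ℕ, ∫⁻ ω, (∑ p ∈ Finset.range n, y p ω) ^ q.toReal ∂P ≤ A ^ q.toReal := by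
    intro n
    have := hfin n
    rw [eLpNorm_eq_lintegral_rpow_enorm_toReal hq0 hq'] at this
    simp only [enorm_eq_self] at this
    rwa [one_div, ENNReal.rpow_inv_le_iff hqr] at this
  -- The infinite sum is written as a lower limit of partial sums so that Fatou's lemma applies.
  have hlim : ∀ ω, (∑' p, y p ω) ^ q.toReal =
      Filter.liminf (fun n => (∑ p ∈ Finset.range n, y p ω) ^ q.toReal) Filter.atTop := by
    intro ω
    refine (Filter.Tendsto.liminf_eq ?_).symm
    exact (ENNReal.continuous_rpow_const.tendsto _).comp ENNReal.summable.hasSum.tendsto_sum_nat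
  simp_rw [hlim]
  refine (lintegral_liminf_le' fun n =>
    (Finset.aemeasurable_fun_sum _ fun i _ => hy i).pow_const _).trans ?_
  exact Filter.liminf_le_of_le (by isBoundedDefault) (fun b hb => by
    obtain ⟨n, hn⟩ := hb.exists
    exact hn.trans (hint n))

/-! ### Coordinates of the noise -/

namespace QWiener

variable (W : QWiener P)

/-- The coefficient `√γₗ ⟨eₚ, εₗ⟩`. -/
def coef (p l : ℕ) : ℝ := Real.sqrt (W.γ l) * coord p (W.basis l)

/-- The variance `∑ₗ γₗ ⟨eₚ, εₗ⟩²` of the `p`-th coordinate of the Wiener process at time `1`. -/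
def coordVar (p : ℕ) : ℝ := ∑' l, W.coef p l ^ 2

lemma coordVar_nonneg (p : ℕ) : 0 ≤ W.coordVar p := tsum_nonneg fun _ => sq_nonneg _

/-- Exchanging the two sums passes from the eigenbasis of $Q$ to that of $A$. The assumption on the
noise thus becomes summability of $\lambda_p^{2\alpha-1}$ times the variance of the $p$-th
coordinate (`tsum_coordVar`). -/
lemma hsNorm_sq (α : ℝ) : W.hsNorm α ^ 2 =
    ∑' p, ∑' l, ENNReal.ofReal (eigval p ^ (2 * α - 1) * W.coef p l ^ 2) := by
  have h : ∀ x : ℝ≥0∞, (x ^ (1 / 2 : ℝ)) ^ 2 = x := fun x => by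
    rw [← ENNReal.rpow_ofNat, ← ENNReal.rpow_mul]; simp
  rw [hsNorm, h, ENNReal.tsum_comm]
  refine tsum_congr fun l => ?_
  rw [fracNorm, h]
  refine tsum_congr fun p => ?_
  rw [← coord_apply, map_smul, smul_eq_mul, coef]
  ring_nf

variable {W} {α : ℝ}

lemma summable_coef_sq (hW : W.hsNorm α < ∞) (p : ℕ) : Summable fun l => W.coef p l ^ 2 := by
  have h1 : W.hsNorm α ^ 2 < ∞ := ENNReal.pow_lt_top hW
  rw [hsNorm_sq] at h1
  have h2 := (ENNReal.le_tsum p).trans_lt h1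
  have h3 : Summable fun l => eigval p ^ (2 * α - 1) * W.coef p l ^ 2 := by
    refine (ENNReal.summable_toReal h2.ne).congr fun l => ?_
    rw [ENNReal.toReal_ofReal (mul_nonneg (Real.rpow_nonneg (eigval_pos p).le _) (sq_nonneg _))]
  have h4 := (Real.rpow_pos_of_pos (eigval_pos p) (2 * α - 1)).ne'
  exact (summable_mul_left_iff h4).1 h3

lemma tsum_coordVar (hW : W.hsNorm α < ∞) :
    ∑' p, ENNReal.ofReal (eigval p ^ (2 * α - 1) * W.coordVar p) = W.hsNorm α ^ 2 := by
  rw [hsNorm_sq]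
  refine tsum_congr fun p => ?_
  have h0 := Real.rpow_nonneg (eigval_pos p).le (2 * α - 1)
  rw [coordVar, ← tsum_mul_left, ENNReal.ofReal_tsum_of_nonneg
    (fun l => mul_nonneg h0 (sq_nonneg _)) ((summable_coef_sq hW p).mul_left _)]

lemma hsNorm_mono {α' : ℝ} (h : α ≤ α') : W.hsNorm α ≤ W.hsNorm α' := by
  unfold hsNorm
  gcongr
  exact fracNorm_mono (by linarith) _

lemma hsNorm_lt_top_of_lt_alphaBar (h : (α : EReal) < W.alphaBar) : W.hsNorm α < ∞ := by
  rw [alphaBar, lt_sSup_iff] at h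
  obtain ⟨_, ⟨α', hα', rfl⟩, h2⟩ := h
  exact (hsNorm_mono (EReal.coe_lt_coe_iff.1 h2).le).trans_lt hα'.2

lemma iIndepFun_comp (φ : (ℝ≥0 → ℝ) → ℝ) (hφ : Measurable φ) :
    iIndepFun (fun l ω => φ (fun t => W.β l t ω)) P :=
  W.indep.comp (fun _ => φ) (fun _ => hφ)

lemma hasLaw_increment (l : ℕ) (s t : ℝ) :
    HasLaw (fun ω => W.β l t.toNNReal ω - W.β l s.toNNReal ω)
      (gaussianReal 0 (nndist (t.toNNReal : ℝ) (s.toNNReal : ℝ))) P :=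
  (W.brownian l).hasLaw_sub t.toNNReal s.toNNReal

/-- The factor $e^{\tau A}$ with $\tau>0$ recovers the missing order $\frac12-\alpha$, so the series
converges even for cylindrical noise. -/
lemma summable_noiseTerm (h0 : 0 ≤ α) (h1 : α ≤ 1 / 2) (hW : W.hsNorm α < ∞) {τ : ℝ} (hτ : 0 < τ)
    (s t : ℝ) :
    Summable fun l => (W.memLp_noiseTerm τ s t l).toLp (W.noiseTerm τ s t l) := by
  refine summable_toLp_smul (X := fun l ω => W.β l t.toNNReal ω - W.β l s.toNNReal ω)
    (h := fun l => Real.sqrt (W.γ l) • semigroup τ (W.basis l))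
    (fun l => hasLaw_increment l s t)
    (iIndepFun_comp (fun x => x t.toNNReal - x s.toNNReal) (by fun_prop)) ?_ _ _ ?_
  · have hK : W.hsNorm α ^ 2 < ∞ := ENNReal.pow_lt_top hW
    have e : W.hsNorm α ^ 2 =
        ∑' l, fracNorm (α - 1 / 2) (Real.sqrt (W.γ l) • W.basis l) ^ 2 := by
      rw [hsNorm, ← ENNReal.rpow_ofNat, ← ENNReal.rpow_mul]; simp
    rw [e] at hK
    set K := ENNReal.ofReal (τ ^ (-(0 - (α - 1 / 2)))) with hKdef
    have h2 : ∑' l, (K * fracNorm (α - 1 / 2) (Real.sqrt (W.γ l) • W.basis l)) ^ 2 < ∞ := by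
      simp_rw [mul_pow]
      rw [ENNReal.tsum_mul_left]
      exact ENNReal.mul_lt_top (ENNReal.pow_lt_top ENNReal.ofReal_lt_top) hK
    refine Summable.of_nonneg_of_le (fun l => sq_nonneg _) (fun l => ?_)
      (ENNReal.summable_toReal h2.ne)
    have h3 : fracNorm 0 (heat τ.toNNReal (Real.sqrt (W.γ l) • W.basis l)) ≤
        K * fracNorm (α - 1 / 2) (Real.sqrt (W.γ l) • W.basis l) := by
      have := fracNorm_heat_le (s := 0) (r := α - 1 / 2) (by linarith) (by linarith)
        (Real.toNNReal_pos.2 hτ) (Real.sqrt (W.γ l) • W.basis l)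
      rwa [Real.coe_toNNReal _ hτ.le] at this
    rw [fracNorm_zero, map_smul, ← semigroup_eq_heat hτ.le] at h3
    rw [ENNReal.toReal_pow, ← toReal_enorm]
    refine pow_le_pow_left₀ ENNReal.toReal_nonneg (ENNReal.toReal_mono ?_ h3) 2
    have := ENNReal.ne_top_of_tsum_ne_top h2.ne l
    intro h
    rw [h] at this
    simp at this
  · intro l ω
    rw [noiseTerm, smul_smul, mul_comm]

variable (W)

lemma memLp_coordTerm (p l : ℕ) (t : ℝ) :
    MemLp (fun ω => W.coef p l * W.β l t.toNNReal ω) 2 P :=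
  (((W.brownian l).hasLaw_eval _).hasGaussianLaw.memLp_two).const_mul _

/-- The `p`-th coordinate of the Wiener process at time `t`. -/
def coordProc (p : ℕ) (t : ℝ) : Lp ℝ 2 P :=
  ∑' l, (W.memLp_coordTerm p l t).toLp _

variable {W}

lemma hasSum_coordProc (hW : W.hsNorm α < ∞) (p : ℕ) (t : ℝ) :
    HasSum (fun l => (W.memLp_coordTerm p l t).toLp _) (W.coordProc p t) := by
  refine Summable.hasSum ?_
  refine summable_toLp_smul (X := fun l ω => W.β l t.toNNReal ω) (h := fun l => W.coef p l)
    (fun l => (W.brownian l).hasLaw_eval _)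
    (iIndepFun_comp (fun x => x t.toNNReal) (by fun_prop)) ?_ _ _ ?_
  · simpa using summable_coef_sq hW p
  · intro l ω
    rw [smul_eq_mul, mul_comm]

/-- The scalar process on the right does not depend on $\tau$, which is what makes noises smoothed
over different steps comparable. -/
lemma coord_noise (h0 : 0 ≤ α) (h1 : α ≤ 1 / 2) (hW : W.hsNorm α < ∞) {τ : ℝ} (hτ : 0 < τ)
    (s t : ℝ) (p : ℕ) :
    (fun ω => coord p (W.noise τ s t ω)) =ᵐ[P]
      (Real.exp (-(eigval p * τ)) • (W.coordProc p t - W.coordProc p s) : Lp ℝ 2 P) := by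
  have e1 : (fun ω => coord p (W.noise τ s t ω)) =ᵐ[P]
      ((coord p).compLpL 2 P
        (∑' l, (W.memLp_noiseTerm τ s t l).toLp (W.noiseTerm τ s t l)) : Lp ℝ 2 P) :=
    (ContinuousLinearMap.coeFn_compLpL (coord p) _).symm
  refine e1.trans (Filter.EventuallyEq.of_eq ?_)
  refine congrArg (fun g : Lp ℝ 2 P => (g : Ω → ℝ)) ?_
  rw [ContinuousLinearMap.map_tsum _ (summable_noiseTerm h0 h1 hW hτ s t)]
  have h2 := ((hasSum_coordProc hW p t).sub (hasSum_coordProc hW p s)).const_smul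
    (Real.exp (-(eigval p * τ)))
  refine Eq.trans (tsum_congr fun l => ?_) h2.tsum_eq
  apply Lp.ext
  filter_upwards [ContinuousLinearMap.coeFn_compLpL (p := 2) (μ := P) (coord p)
      ((W.memLp_noiseTerm τ s t l).toLp (W.noiseTerm τ s t l)),
    (W.memLp_noiseTerm τ s t l).coeFn_toLp, (W.memLp_coordTerm p l t).coeFn_toLp,
    (W.memLp_coordTerm p l s).coeFn_toLp,
    Lp.coeFn_smul (Real.exp (-(eigval p * τ))) ((W.memLp_coordTerm p l t).toLp _ -
      (W.memLp_coordTerm p l s).toLp _),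
    Lp.coeFn_sub ((W.memLp_coordTerm p l t).toLp _) ((W.memLp_coordTerm p l s).toLp _)]
    with ω a1 a2 a3 a4 a5 a6
  rw [a1, a2, a5, Pi.smul_apply, a6, Pi.sub_apply, a3, a4, noiseTerm, map_smul,
    semigroup_eq_heat hτ.le, coord_heat, coef]
  simp only [smul_eq_mul, Real.coe_toNNReal _ hτ.le]
  ring

/-- For fixed $l$, independence of increments makes the weighted sum of increments of $\beta_l$
Gaussian with variance $V$. Independence in $l$ makes each partial sum over $l$ Gaussian with
variance at most `coordVar p * V`. The bound then passes to the limit. -/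
lemma eLpNorm_sum_coordProc_le [IsProbabilityMeasure P] (hW : W.hsNorm α < ∞) (m p N : ℕ)
    (c r : ℕ → ℝ) (hr : Monotone r) (hr0 : 0 ≤ r 0) :
    eLpNorm (∑ i ∈ Finset.range N, c i • (W.coordProc p (r (i + 1)) - W.coordProc p (r i)) :
        Lp ℝ 2 P) m P ≤
      ENNReal.ofReal (Real.sqrt (W.coordVar p *
        ∑ i ∈ Finset.range N, c i ^ 2 * (r (i + 1) - r i))) * gaussMoment m := by
  set V : ℝ := ∑ i ∈ Finset.range N, c i ^ 2 * (r (i + 1) - r i) with hV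
  have hV0 : 0 ≤ V := Finset.sum_nonneg fun i _ =>
    mul_nonneg (sq_nonneg _) (sub_nonneg.2 (hr (Nat.le_succ i)))
  have hrn : ∀ i, 0 ≤ r i := fun i => hr0.trans (hr (Nat.zero_le i))
  set φ : (ℝ≥0 → ℝ) → ℝ := fun x =>
    ∑ i ∈ Finset.range N, c i * (x (r (i + 1)).toNNReal - x (r i).toNNReal) with hφ
  have hφm : Measurable φ := by fun_prop
  have hlawφ : ∀ l, HasLaw (fun ω => φ (fun t => W.β l t ω)) (gaussianReal 0 V.toNNReal) P := by
    intro l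
    have hinc := (W.brownian l).hasIndepIncrements.nat
      (t := fun i => (r i).toNNReal) (fun i j hij => Real.toNNReal_mono (hr hij))
    have hinc2 : iIndepFun (fun i ω =>
        c i * (W.β l (r (i + 1)).toNNReal ω - W.β l (r i).toNNReal ω)) P :=
      hinc.comp (fun i x => c i * x) (fun i => measurable_const_mul (c i))
    have hl : ∀ i, HasLaw (fun ω => c i * (W.β l (r (i + 1)).toNNReal ω - W.β l (r i).toNNReal ω))
        (gaussianReal 0 (Real.toNNReal (c i ^ 2 * (r (i + 1) - r i)))) P := by
      intro i
      have h1 := gaussianReal_const_mul (hasLaw_increment (W := W) l (r i) (r (i + 1))) (c i)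
      rw [mul_zero] at h1
      convert h1 using 2
      apply NNReal.eq
      have h2 := hr (Nat.le_succ i)
      rw [NNReal.coe_mul, coe_nndist, Real.coe_toNNReal _ (hrn _), Real.coe_toNNReal _ (hrn _),
        Real.coe_toNNReal _ (mul_nonneg (sq_nonneg _) (sub_nonneg.2 h2)), Real.dist_eq,
        abs_of_nonneg (sub_nonneg.2 h2)]
      rfl
    have h3 := hasLaw_gaussian_sum hl hinc2 (Finset.range N)
    rw [← Real.toNNReal_sum_of_nonneg (fun i _ =>
      mul_nonneg (sq_nonneg _) (sub_nonneg.2 (hr (Nat.le_succ i)))), ← hV] at h3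
    convert h3 using 1
    ext ω
    simp [hφ]
  have hlaw : ∀ L : ℕ, HasLaw (∑ l ∈ Finset.range L,
      fun ω => W.coef p l * φ (fun t => W.β l t ω))
      (gaussianReal 0 (Real.toNNReal ((∑ l ∈ Finset.range L, W.coef p l ^ 2) * V))) P := by
    intro L
    have hind : iIndepFun (fun l ω => W.coef p l * φ (fun t => W.β l t ω)) P :=
      (iIndepFun_comp (W := W) φ hφm).comp (fun l x => W.coef p l * x)
        (fun l => measurable_const_mul _)
    have h4 : ∀ l, HasLaw (fun ω => W.coef p l * φ (fun t => W.β l t ω))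
        (gaussianReal 0 (Real.toNNReal (W.coef p l ^ 2 * V))) P := by
      intro l
      have h1 := gaussianReal_const_mul (hlawφ l) (W.coef p l)
      rw [mul_zero] at h1
      convert h1 using 2
      apply NNReal.eq
      rw [NNReal.coe_mul, Real.coe_toNNReal _ hV0,
        Real.coe_toNNReal _ (mul_nonneg (sq_nonneg _) hV0)]
      rfl
    have h5 := hasLaw_gaussian_sum h4 hind (Finset.range L)
    rwa [← Real.toNNReal_sum_of_nonneg (fun l _ => mul_nonneg (sq_nonneg _) hV0),
      ← Finset.sum_mul] at h5
  set F : ℕ → Lp ℝ 2 P := fun l => ∑ i ∈ Finset.range N,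
    c i • ((W.memLp_coordTerm p l (r (i + 1))).toLp _ - (W.memLp_coordTerm p l (r i)).toLp _)
    with hF
  have hsum : HasSum F (∑ i ∈ Finset.range N,
      c i • (W.coordProc p (r (i + 1)) - W.coordProc p (r i))) :=
    hasSum_sum fun i _ => ((hasSum_coordProc hW p _).sub (hasSum_coordProc hW p _)).const_smul _
  have hcoe : ∀ l, F l =ᵐ[P] fun ω => W.coef p l * φ (fun t => W.β l t ω) := by
    intro l
    have h1 : ∀ i, (c i • ((W.memLp_coordTerm p l (r (i + 1))).toLp _ -
        (W.memLp_coordTerm p l (r i)).toLp _) : Lp ℝ 2 P) =ᵐ[P] fun ω =>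
        W.coef p l * (c i * (W.β l (r (i + 1)).toNNReal ω - W.β l (r i).toNNReal ω)) := by
      intro i
      filter_upwards [Lp.coeFn_smul (c i) ((W.memLp_coordTerm p l (r (i + 1))).toLp _ -
          (W.memLp_coordTerm p l (r i)).toLp _), Lp.coeFn_sub
          ((W.memLp_coordTerm p l (r (i + 1))).toLp _) ((W.memLp_coordTerm p l (r i)).toLp _),
        (W.memLp_coordTerm p l (r (i + 1))).coeFn_toLp, (W.memLp_coordTerm p l (r i)).coeFn_toLp]
        with ω a1 a2 a3 a4
      rw [a1, Pi.smul_apply, a2, Pi.sub_apply, a3, a4, smul_eq_mul]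
      ring
    have h2 := ae_all_iff.2 h1
    filter_upwards [h2, Lp.coeFn_fun_finsetSum (Finset.range N) (fun i =>
      c i • ((W.memLp_coordTerm p l (r (i + 1))).toLp _ -
        (W.memLp_coordTerm p l (r i)).toLp _))] with ω a1 a2
    rw [hF, a2, hφ, Finset.mul_sum]
    exact Finset.sum_congr rfl fun i _ => a1 i
  have hcoe2 : ∀ L : ℕ, (∑ l ∈ Finset.range L, F l : Lp ℝ 2 P) =ᵐ[P]
      ∑ l ∈ Finset.range L, fun ω => W.coef p l * φ (fun t => W.β l t ω) := by
    intro L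
    filter_upwards [ae_all_iff.2 hcoe, Lp.coeFn_fun_finsetSum (Finset.range L) F] with ω a1 a2
    rw [a2, Finset.sum_apply]
    exact Finset.sum_congr rfl fun l _ => a1 l
  -- Convergence in $L^2$ gives convergence in measure, under which $L^m$ bounds survive; no
  -- convergence in $L^m$ is needed.
  refine eLpNorm_le_of_tendstoInMeasure (u := Filter.atTop) (Filter.Eventually.of_forall fun L => ?_)
    (tendstoInMeasure_of_tendsto_Lp hsum.tendsto_sum_nat) (fun L => Lp.aestronglyMeasurable _)
  rw [eLpNorm_congr_ae (hcoe2 L), eLpNorm_of_hasLaw_gaussian (hlaw L)]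
  gcongr
  rw [Real.coe_toNNReal _ (mul_nonneg (Finset.sum_nonneg fun _ _ => sq_nonneg _) hV0)]
  gcongr
  exact (summable_coef_sq hW p).sum_le_tsum _ (fun _ _ => sq_nonneg _)

/-- Moments in the norms `fracNorm` of a random variable whose coordinates are stochastic
integrals of step functions. -/
lemma eLpNorm_fracNorm_le [IsProbabilityMeasure P] (hW : W.hsNorm α < ∞) {q : ℕ} (hq : 1 ≤ q)
    {s K : ℝ} (hK : 0 ≤ K) {Y : Ω → H} (hY : AEStronglyMeasurable Y P) (N : ℕ) (c : ℕ → ℕ → ℝ)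
    (r : ℕ → ℝ) (hr : Monotone r) (hr0 : 0 ≤ r 0)
    (hc : ∀ p, (fun ω => coord p (Y ω)) =ᵐ[P] (∑ i ∈ Finset.range N,
      c p i • (W.coordProc p (r (i + 1)) - W.coordProc p (r i)) : Lp ℝ 2 P))
    (hb : ∀ p, eigval p ^ (2 * s) * ∑ i ∈ Finset.range N, c p i ^ 2 * (r (i + 1) - r i) ≤
      K ^ 2 * eigval p ^ (2 * α - 1)) :
    eLpNorm (fun ω => fracNorm s (Y ω)) q P ≤
      ENNReal.ofReal K * (gaussMoment (2 * q) * W.hsNorm α) := by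
  have hq0 : (q : ℝ≥0∞) ≠ 0 := by exact_mod_cast (by omega : q ≠ 0)
  have hq1 : (1 : ℝ≥0∞) ≤ q := by exact_mod_cast hq
  have hqr : (0 : ℝ) < q := by exact_mod_cast hq
  have hqt := ENNReal.natCast_ne_top q
  -- With the exponent $2q$, the squared norm is measured in $L^q$, and being a sum over coordinates
  -- it is accessible to Minkowski's inequality.
  have hmono : eLpNorm (fun ω => fracNorm s (Y ω)) q P ≤
      eLpNorm (fun ω => fracNorm s (Y ω)) ((2 * q : ℕ) : ℝ≥0∞) P :=
    eLpNorm_le_eLpNorm_of_exponent_le (by exact_mod_cast (by omega : q ≤ 2 * q))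
      (aemeasurable_fracNorm s hY).aestronglyMeasurable
  refine hmono.trans ?_
  have hcm : ∀ p, AEMeasurable (fun ω => coord p (Y ω)) P := fun p =>
    ((coord p).continuous.comp_aestronglyMeasurable hY).aemeasurable
  have hsq : ∀ {ε : Type _} [ENorm ε] (g : Ω → ε),
      eLpNorm g ((2 * q : ℕ) : ℝ≥0∞) P ^ 2 = eLpNorm (fun ω => ‖g ω‖ₑ ^ (2 : ℝ)) q P := by
    intro ε _ g
    rw [eLpNorm_enorm_rpow g (by norm_num : (0 : ℝ) < 2), ← ENNReal.rpow_ofNat]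
    congr 2
    push_cast
    rw [mul_comm]
    congr 1
    simp
  suffices h : eLpNorm (fun ω => fracNorm s (Y ω)) ((2 * q : ℕ) : ℝ≥0∞) P ^ 2 ≤
      (ENNReal.ofReal K * (gaussMoment (2 * q) * W.hsNorm α)) ^ 2 by
    exact (ENNReal.pow_le_pow_left_iff two_ne_zero).1 h
  rw [hsq]
  have e1 : (fun ω => ‖fracNorm s (Y ω)‖ₑ ^ (2 : ℝ)) =
      fun ω => ∑' p, ENNReal.ofReal (eigval p ^ (2 * s)) * ‖coord p (Y ω)‖ₑ ^ (2 : ℝ) := by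
    ext ω
    rw [enorm_eq_self, fracNorm, ← ENNReal.rpow_mul]
    norm_num
    refine tsum_congr fun p => ?_
    rw [ENNReal.ofReal_mul (Real.rpow_nonneg (eigval_pos p).le _), Real.enorm_eq_ofReal_abs,
      ← ENNReal.ofReal_pow (abs_nonneg _), sq_abs, coord_apply]
  rw [e1]
  refine (eLpNorm_tsum_le hq1 hqt fun p => ((hcm p).enorm.pow_const _).const_mul _).trans ?_
  have e2 : ∀ p, eLpNorm (fun ω => ENNReal.ofReal (eigval p ^ (2 * s)) *
      ‖coord p (Y ω)‖ₑ ^ (2 : ℝ)) q P ≤ ENNReal.ofReal (K ^ 2) * gaussMoment (2 * q) ^ 2 *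
        ENNReal.ofReal (eigval p ^ (2 * α - 1) * W.coordVar p) := by
    intro p
    have h0 := Real.rpow_nonneg (eigval_pos p).le (2 * s)
    have h1 : eLpNorm (fun ω => ENNReal.ofReal (eigval p ^ (2 * s)) *
        ‖coord p (Y ω)‖ₑ ^ (2 : ℝ)) q P = ENNReal.ofReal (eigval p ^ (2 * s)) *
        eLpNorm (fun ω => ‖coord p (Y ω)‖ₑ ^ (2 : ℝ)) q P := by
      rw [eLpNorm_eq_lintegral_rpow_enorm_toReal hq0 hqt,
        eLpNorm_eq_lintegral_rpow_enorm_toReal hq0 hqt]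
      simp only [enorm_eq_self, ENNReal.toReal_natCast]
      simp_rw [ENNReal.mul_rpow_of_nonneg _ _ hqr.le]
      rw [lintegral_const_mul'' _ (((hcm p).enorm.pow_const _).pow_const _),
        ENNReal.mul_rpow_of_nonneg _ _ (by positivity), ← ENNReal.rpow_mul,
        mul_one_div_cancel hqr.ne', ENNReal.rpow_one]
    set V : ℝ := ∑ i ∈ Finset.range N, c p i ^ 2 * (r (i + 1) - r i) with hV
    have hV0 : 0 ≤ V := Finset.sum_nonneg fun i _ =>
      mul_nonneg (sq_nonneg _) (sub_nonneg.2 (hr (Nat.le_succ i)))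
    have hg := W.coordVar_nonneg p
    have h2 : eLpNorm (fun ω => coord p (Y ω)) ((2 * q : ℕ) : ℝ≥0∞) P ≤
        ENNReal.ofReal (Real.sqrt (W.coordVar p * V)) * gaussMoment (2 * q) := by
      rw [eLpNorm_congr_ae (hc p)]
      exact eLpNorm_sum_coordProc_le hW (2 * q) p N (c p) r hr hr0
    rw [h1, ← hsq]
    calc ENNReal.ofReal (eigval p ^ (2 * s)) *
          eLpNorm (fun ω => coord p (Y ω)) ((2 * q : ℕ) : ℝ≥0∞) P ^ 2
        ≤ ENNReal.ofReal (eigval p ^ (2 * s)) *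
          (ENNReal.ofReal (Real.sqrt (W.coordVar p * V)) * gaussMoment (2 * q)) ^ 2 := by gcongr
      _ = ENNReal.ofReal ((eigval p ^ (2 * s) * V) * W.coordVar p) * gaussMoment (2 * q) ^ 2 := by
        rw [mul_pow, ← ENNReal.ofReal_pow (Real.sqrt_nonneg _),
          Real.sq_sqrt (mul_nonneg hg hV0), ← mul_assoc, ← ENNReal.ofReal_mul h0]
        congr 2; ring
      _ ≤ ENNReal.ofReal ((K ^ 2 * eigval p ^ (2 * α - 1)) * W.coordVar p) *
          gaussMoment (2 * q) ^ 2 := by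
        exact mul_le_mul_left (ENNReal.ofReal_le_ofReal
          (mul_le_mul_of_nonneg_right (hb p) hg)) _
      _ = _ := by
        rw [mul_assoc (K ^ 2), ENNReal.ofReal_mul (sq_nonneg K)]; ring
  refine (ENNReal.tsum_le_tsum e2).trans (le_of_eq ?_)
  rw [ENNReal.tsum_mul_left, tsum_coordVar hW, ENNReal.ofReal_pow hK]
  ring

end QWiener

/-! ### Moment bounds -/

/-- `X` is a random variable whose norm `fracNorm s` has `L^q` norm at most `K`. -/
structure MomentBound (P : Measure Ω) (s : ℝ) (q : ℕ) (X : Ω → H) (K : ℝ) : Prop where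
  meas : AEStronglyMeasurable X P
  nonneg : 0 ≤ K
  le : eLpNorm (fun ω => fracNorm s (X ω)) q P ≤ ENNReal.ofReal K

namespace MomentBound

variable {s r K K' : ℝ} {q : ℕ} {X Y : Ω → H}

lemma aemeas (h : MomentBound P s q X K) : AEStronglyMeasurable (fun ω => fracNorm s (X ω)) P :=
  (aemeasurable_fracNorm s h.meas).aestronglyMeasurable

lemma mono_const (h : MomentBound P s q X K) (hK : K ≤ K') : MomentBound P s q X K' :=
  ⟨h.meas, h.nonneg.trans hK, h.le.trans (ENNReal.ofReal_le_ofReal hK)⟩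

lemma of_le (h : MomentBound P r q X K) {c : ℝ} (hc : 0 ≤ c) (hY : AEStronglyMeasurable Y P)
    (hle : ∀ ω, fracNorm s (Y ω) ≤ ENNReal.ofReal c * fracNorm r (X ω)) :
    MomentBound P s q Y (c * K) := by
  refine ⟨hY, mul_nonneg hc h.nonneg, ?_⟩
  rw [ENNReal.ofReal_mul hc]
  refine le_trans ?_ (mul_le_mul_right h.le (ENNReal.ofReal c))
  have := eLpNorm_le_nnreal_smul_eLpNorm_of_ae_le_mul' (μ := P)
    (f := fun ω => fracNorm s (Y ω)) (g := fun ω => fracNorm r (X ω)) (c := c.toNNReal)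
    (Filter.Eventually.of_forall fun ω => by simp only [enorm_eq_self]; exact hle ω) q
  exact this

lemma mono_norm (h : MomentBound P r q X K) (hs : s ≤ r) : MomentBound P s q X K := by
  have := h.of_le (s := s) zero_le_one h.meas (fun ω => by simpa using fracNorm_mono hs (X ω))
  rwa [one_mul] at this

lemma mono_exp [IsProbabilityMeasure P] {q' : ℕ} (h : MomentBound P s q' X K) (hq : q ≤ q') :
    MomentBound P s q X K :=
  ⟨h.meas, h.nonneg, (eLpNorm_le_eLpNorm_of_exponent_le (by exact_mod_cast hq) h.aemeas).trans h.le⟩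

lemma zero : MomentBound P s q (fun _ => 0) 0 := by
  refine ⟨aestronglyMeasurable_const, le_rfl, ?_⟩
  simp only [fracNorm_zero_right]
  rw [eLpNorm_zero', ENNReal.ofReal_zero]

lemma add (hX : MomentBound P s q X K) (hY : MomentBound P s q Y K') (hq : 1 ≤ q) :
    MomentBound P s q (fun ω => X ω + Y ω) (K + K') := by
  refine ⟨hX.meas.add hY.meas, add_nonneg hX.nonneg hY.nonneg, ?_⟩
  rw [ENNReal.ofReal_add hX.nonneg hY.nonneg]
  refine le_trans (eLpNorm_mono_enorm fun ω => ?_)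
    ((eLpNorm_add_le hX.aemeas hY.aemeas (by exact_mod_cast hq)).trans (add_le_add hX.le hY.le))
  exact fracNorm_add_le s _ _

lemma neg (hX : MomentBound P s q X K) : MomentBound P s q (fun ω => -X ω) K := by
  have := hX.of_le (s := s) zero_le_one hX.meas.neg (fun ω => by simp [fracNorm_neg])
  rwa [one_mul] at this

lemma sub (hX : MomentBound P s q X K) (hY : MomentBound P s q Y K') (hq : 1 ≤ q) :
    MomentBound P s q (fun ω => X ω - Y ω) (K + K') := by
  simpa only [sub_eq_add_neg] using hX.add hY.neg hq

lemma sum (hq : 1 ≤ q) {ι : Type*} {Z : ι → Ω → H} {B : ι → ℝ} {t : Finset ι}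
    (h : ∀ i ∈ t, MomentBound P s q (Z i) (B i)) :
    MomentBound P s q (fun ω => ∑ i ∈ t, Z i ω) (∑ i ∈ t, B i) := by
  classical
  induction t using Finset.induction_on with
  | empty => simpa using zero
  | insert a t ha ih =>
    simp only [Finset.sum_insert ha]
    exact (h a (Finset.mem_insert_self _ _)).add
      (ih fun i hi => h i (Finset.mem_insert_of_mem hi)) hq

lemma smul (h : MomentBound P s q X K) {c : ℝ} (hc : 0 ≤ c) :
    MomentBound P s q (fun ω => c • X ω) (c * K) :=
  h.of_le hc (h.meas.const_smul c) fun ω => by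
    rw [fracNorm_smul, Real.enorm_eq_ofReal_abs, abs_of_nonneg hc]

lemma heat_self (h : MomentBound P s q X K) (t : ℝ≥0) :
    MomentBound P s q (fun ω => heat t (X ω)) K := by
  have := h.of_le (s := s) zero_le_one ((heat t).continuous.comp_aestronglyMeasurable h.meas)
    (fun ω => by simpa using fracNorm_heat_self_le s t (X ω))
  rwa [one_mul] at this

lemma heat_smoothing (h : MomentBound P r q X K) (h0 : r ≤ s) (h1 : s - r ≤ 1) {t : ℝ≥0}
    (ht : 0 < t) : MomentBound P s q (fun ω => heat t (X ω)) ((t : ℝ) ^ (-(s - r)) * K) :=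
  h.of_le (by positivity) ((heat t).continuous.comp_aestronglyMeasurable h.meas)
    fun _ => fracNorm_heat_le h0 h1 ht _

lemma heat_sub_self (h : MomentBound P r q X K) (h0 : s ≤ r) (h1 : r - s ≤ 1) (t : ℝ≥0) :
    MomentBound P s q (fun ω => heat t (X ω) - X ω) ((t : ℝ) ^ (r - s) * K) :=
  h.of_le (by positivity) (((heat t).continuous.comp_aestronglyMeasurable h.meas).sub h.meas)
    fun _ => fracNorm_heat_sub_le h0 h1 t _

lemma const [IsProbabilityMeasure P] {u : H} (hu : fracNorm s u < ∞) (hq : 1 ≤ q) :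
    MomentBound P s q (fun _ => u) (fracNorm s u).toReal := by
  refine ⟨aestronglyMeasurable_const, ENNReal.toReal_nonneg, ?_⟩
  rw [ENNReal.ofReal_toReal hu.ne, eLpNorm_const _ (by exact_mod_cast (by omega : q ≠ 0))
    (IsProbabilityMeasure.ne_zero P)]
  simp

lemma of_norm_le [IsProbabilityMeasure P] (h : MomentBound P 0 q X K) (hq : 1 ≤ q) {L c : ℝ}
    (hL : 0 ≤ L) (hc : 0 ≤ c) (hY : AEStronglyMeasurable Y P)
    (hle : ∀ ω, ‖Y ω‖ ≤ L * ‖X ω‖ + c) :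
    MomentBound P 0 q Y (L * K + c) := by
  refine ⟨hY, by have := h.nonneg; positivity, ?_⟩
  have hK := h.le
  simp only [fracNorm_zero] at hK ⊢
  rw [eLpNorm_enorm] at hK ⊢
  rw [ENNReal.ofReal_add (mul_nonneg hL h.nonneg) hc, ENNReal.ofReal_mul hL]
  have h1 : eLpNorm Y q P ≤ eLpNorm ((fun ω => L * ‖X ω‖) + fun _ => c) q P :=
    eLpNorm_mono_real hle
  refine h1.trans ((eLpNorm_add_le (h.meas.norm.const_mul L) aestronglyMeasurable_const
    (by exact_mod_cast hq)).trans ?_)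
  refine add_le_add ?_ ?_
  · have e : (fun ω => L * ‖X ω‖) = L • fun ω => ‖X ω‖ := by ext; simp
    rw [e, eLpNorm_const_smul, Real.enorm_eq_ofReal_abs, abs_of_nonneg hL, eLpNorm_norm]
    gcongr
  · rw [eLpNorm_const _ (by exact_mod_cast (by omega : q ≠ 0)) (IsProbabilityMeasure.ne_zero P)]
    simp [Real.enorm_eq_ofReal_abs, abs_of_nonneg hc]

end MomentBound

/-! ### Convolution sums -/

/-- A Riemann sum for $\int_0^{N\delta}t^{-\theta}\,dt$, sampled at right end points of a decreasing
function. -/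
lemma sum_mul_rpow_neg_le {θ δ : ℝ} (h0 : 0 ≤ θ) (h1 : θ < 1) (hδ : 0 < δ) (N : ℕ) :
    ∑ i ∈ Finset.range N, δ * (((N - i : ℕ) : ℝ) * δ) ^ (-θ) ≤ (N * δ) ^ (1 - θ) / (1 - θ) := by
  have h1' : 0 < 1 - θ := by linarith
  induction N with
  | zero => simp; positivity
  | succ N ih =>
    -- Removing the term $i=0$, whose elapsed time is the longest, leaves exactly the sum for $N$.
    rw [Finset.sum_range_succ']
    simp only [Nat.add_sub_add_right, Nat.sub_zero]
    refine (add_le_add_left ih _).trans ?_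
    rw [le_div_iff₀ h1', add_mul, div_mul_cancel₀ _ h1'.ne']
    set x : ℝ := ((N + 1 : ℕ) : ℝ) * δ with hx
    have hx0 : 0 < x := by positivity
    have hxδ : (N : ℝ) * δ = x * (1 + -(δ / x)) := by
      field_simp; rw [hx]; push_cast; ring
    have hs : -1 ≤ -(δ / x) := by
      rw [neg_le_neg_iff, div_le_one hx0, hx]
      push_cast
      nlinarith [(Nat.cast_nonneg N : (0 : ℝ) ≤ N)]
    -- Bernoulli's inequality for an exponent in $[0,1]$: $(x-\delta)^{1-\theta}\le
    -- x^{1-\theta}-(1-\theta)\,\delta x^{-\theta}$.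
    have hb := rpow_one_add_le_one_add_mul_self hs h1'.le (by linarith : 1 - θ ≤ 1)
    have hx1 := Real.rpow_pos_of_pos hx0 (1 - θ)
    have e : x ^ (1 - θ) = x * x ^ (-θ) := by
      rw [sub_eq_add_neg, Real.rpow_add hx0, Real.rpow_one]
    rw [hxδ, Real.mul_rpow hx0.le (by linarith)]
    have h3 := mul_le_mul_of_nonneg_left hb hx1.le
    have e2 : x ^ (1 - θ) * (δ / x) = δ * x ^ (-θ) := by rw [e]; field_simp
    nlinarith [h3, e2]

/-- The constant of `sum_mul_rpow_neg_le` on an interval of length `T`. -/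
def singConst (T θ : ℝ) : ℝ := T ^ (1 - θ) / (1 - θ)

lemma singConst_nonneg {T θ : ℝ} (hT : 0 ≤ T) (h1 : θ < 1) : 0 ≤ singConst T θ := by
  have : 0 < 1 - θ := by linarith
  unfold singConst
  positivity

/-- The discrete convolution `∑_{i < N} δ e^{(N - i) δ A} Y_i`. -/
def heatConv (δ : ℝ≥0) (Y : ℕ → H) (N : ℕ) : H :=
  ∑ i ∈ Finset.range N, (δ : ℝ) • heat (((N - i : ℕ) : ℝ≥0) * δ) (Y i)

/-- All times $(N-i)\delta$ are at least $\delta>0$, so every term is smoothed, and the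
singularities sum to a constant independent of $\delta$ and $N$. -/
lemma MomentBound.heatConv {s r T K : ℝ} {q : ℕ} (hq : 1 ≤ q) (h0 : r ≤ s) (h1 : s - r < 1)
    {δ : ℝ≥0} (hδ : 0 < δ) {N : ℕ} (hN : N * (δ : ℝ) ≤ T) (hK : 0 ≤ K) {Y : ℕ → Ω → H}
    (hY : ∀ i < N, MomentBound P r q (Y i) K) :
    MomentBound P s q (fun ω => heatConv δ (fun i => Y i ω) N) (singConst T (s - r) * K) := by
  have hδ' : (0 : ℝ) < δ := hδ
  have h : ∀ i ∈ Finset.range N, MomentBound P s q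
      (fun ω => (δ : ℝ) • heat (((N - i : ℕ) : ℝ≥0) * δ) (Y i ω))
      (δ * (((N - i : ℕ) : ℝ) * δ) ^ (-(s - r)) * K) := by
    intro i hi
    have hi' := Finset.mem_range.1 hi
    have hpos : (0 : ℝ≥0) < ((N - i : ℕ) : ℝ≥0) * δ :=
      mul_pos (by exact_mod_cast (by omega : 0 < N - i)) hδ
    have := ((hY i hi').heat_smoothing h0 h1.le hpos).smul hδ'.le
    rw [← mul_assoc] at this
    exact this
  refine (MomentBound.sum hq h).mono_const ?_
  rw [← Finset.sum_mul]
  refine mul_le_mul_of_nonneg_right ?_ hK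
  refine (sum_mul_rpow_neg_le (by linarith) h1 hδ' N).trans ?_
  unfold singConst
  have h2 : 0 < 1 - (s - r) := by linarith
  gcongr

lemma MomentBound.heatConv_self {s T K : ℝ} {q : ℕ} (hq : 1 ≤ q)
    {δ : ℝ≥0} (hδ : 0 < δ) {N : ℕ} (hN : N * (δ : ℝ) ≤ T) (hK : 0 ≤ K) {Y : ℕ → Ω → H}
    (hY : ∀ i < N, MomentBound P s q (Y i) K) :
    MomentBound P s q (fun ω => Parareal.heatConv δ (fun i => Y i ω) N) (T * K) := by
  have := MomentBound.heatConv hq (le_refl s) (by simp) hδ hN hK hY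
  simpa [singConst] using this

lemma sum_range_mul_eq {M : Type*} [AddCommMonoid M] (f : ℕ → M) (n J : ℕ) :
    ∑ i ∈ Finset.range (n * J), f i =
      ∑ m ∈ Finset.range n, ∑ j ∈ Finset.range J, f (m * J + j) := by
  induction n with
  | zero => simp
  | succ n ih => rw [Finset.sum_range_succ, ← ih, Nat.succ_mul, Finset.sum_range_add]

/-- Constant in the discrete Gronwall inequality. -/
def gronConst (T L s : ℝ) : ℝ := 1 + singConst T s * (L * ((1 + T) * Real.exp (L * T)) + 1)

lemma gronConst_nonneg {T L s : ℝ} (hT : 0 ≤ T) (hL : 0 ≤ L) (hs : s < 1) :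
    0 ≤ gronConst T L s := by
  have := singConst_nonneg hT hs
  unfold gronConst
  positivity

/-- A discrete Gronwall inequality for moments. -/
lemma MomentBound.gronwall [IsProbabilityMeasure P] {s T L c D : ℝ} {q : ℕ} (hq : 1 ≤ q)
    (hs0 : 0 ≤ s) (hs1 : s < 1) (hL : 0 ≤ L) (hc : 0 ≤ c) (hD : 0 ≤ D) {δ : ℝ≥0} (hδ : 0 < δ)
    {J N : ℕ} (hJ : 1 ≤ J) (hN : (N * J : ℕ) * (δ : ℝ) ≤ T) {X Z A : ℕ → Ω → H}
    (hX : ∀ n ≤ N, ∀ ω, X n ω = Z n ω + Parareal.heatConv δ (fun i => A i ω) (n * J))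
    (hA : ∀ i, AEStronglyMeasurable (A i) P)
    (hAX : ∀ i < N * J, ∀ ω, ‖A i ω‖ ≤ L * ‖X (i / J) ω‖ + c)
    (hZ : ∀ n ≤ N, MomentBound P s q (Z n) D) :
    ∀ n ≤ N, MomentBound P s q (X n) (gronConst T L s * (D + c)) := by
  have hδ' : (0 : ℝ) < δ := hδ
  have hT : 0 ≤ T := le_trans (by positivity) hN
  set τ : ℝ := J * δ with hτ
  have hτ0 : 0 ≤ τ := by positivity
  have hnT : ∀ n ≤ N, n * τ ≤ T := fun n hn => by
    refine le_trans ?_ hN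
    have : (n : ℝ) ≤ N := by exact_mod_cast hn
    rw [hτ]; push_cast
    nlinarith [mul_le_mul_of_nonneg_right this (by positivity : (0 : ℝ) ≤ J * δ)]
  have hdiv : ∀ n ≤ N, ∀ i < n * J, i / J < n := fun n _ i hi => Nat.div_lt_of_lt_mul
    (by rwa [mul_comm])
  have hE : 0 ≤ D + c * T := by positivity
  -- The recursion closes in the norm of $H$, where $F$ is Lipschitz; the order $s$ is recovered
  -- afterwards by one smoothing of the convolution. Strong induction works because $i<nJ$ gives
  -- $i/J<n$ strictly.
  have key : ∀ n ≤ N, MomentBound P 0 q (X n) ((D + c * T) * (1 + L * τ) ^ n) := by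
    intro n
    induction n using Nat.strong_induction_on with
    | _ n ih =>
    intro hn
    have hb : ∀ i ∈ Finset.range (n * J), MomentBound P 0 q
        (fun ω => (δ : ℝ) • heat (((n * J - i : ℕ) : ℝ≥0) * δ) (A i ω))
        (δ * (L * ((D + c * T) * (1 + L * τ) ^ (i / J)) + c)) := by
      intro i hi
      have hi' := hdiv n hn i (Finset.mem_range.1 hi)
      have hiN : i < N * J := (Finset.mem_range.1 hi).trans_le (Nat.mul_le_mul_right J hn)
      exact (((ih (i / J) hi' (by omega)).of_norm_le hq hL hc (hA i) (hAX i hiN)).heat_self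
        _).smul hδ'.le
    have h1 := ((hZ n hn).mono_norm hs0).add (MomentBound.sum hq hb) hq
    have e : (fun ω => Z n ω + ∑ i ∈ Finset.range (n * J),
        (δ : ℝ) • heat (((n * J - i : ℕ) : ℝ≥0) * δ) (A i ω)) = X n := by
      ext1 ω; exact (hX n hn ω).symm
    rw [e] at h1
    refine h1.mono_const ?_
    rw [sum_range_mul_eq]
    have h2 : ∀ m ∈ Finset.range n, ∑ j ∈ Finset.range J,
        δ * (L * ((D + c * T) * (1 + L * τ) ^ ((m * J + j) / J)) + c) =
        (D + c * T) * (L * τ) * (1 + L * τ) ^ m + c * τ := by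
      intro m _
      have : ∀ j ∈ Finset.range J, δ * (L * ((D + c * T) * (1 + L * τ) ^ ((m * J + j) / J)) + c) =
          δ * (L * ((D + c * T) * (1 + L * τ) ^ m) + c) := by
        intro j hj
        have hj' := Finset.mem_range.1 hj
        rw [Nat.add_comm, Nat.add_mul_div_right _ _ (by omega), Nat.div_eq_of_lt hj', Nat.zero_add]
      rw [Finset.sum_congr rfl this, Finset.sum_const, Finset.card_range, nsmul_eq_mul, hτ]
      ring
    rw [Finset.sum_congr rfl h2, Finset.sum_add_distrib, ← Finset.mul_sum, Finset.sum_const,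
      Finset.card_range, nsmul_eq_mul]
    have hgeo : L * τ * ∑ m ∈ Finset.range n, (1 + L * τ) ^ m = (1 + L * τ) ^ n - 1 := by
      have := mul_geom_sum (1 + L * τ) n
      rw [← this]; ring
    have hcn : n * (c * τ) ≤ c * T := by nlinarith [hnT n hn, mul_le_mul_of_nonneg_left (hnT n hn) hc]
    calc D + ((D + c * T) * (L * τ) * ∑ m ∈ Finset.range n, (1 + L * τ) ^ m + n * (c * τ))
        = D + (D + c * T) * (L * τ * ∑ m ∈ Finset.range n, (1 + L * τ) ^ m) + n * (c * τ) := by ring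
      _ = n * (c * τ) - c * T + (D + c * T) * (1 + L * τ) ^ n := by rw [hgeo]; ring
      _ ≤ _ := by linarith
  set M := (1 + T) * Real.exp (L * T) * (D + c) with hM
  have hM0 : 0 ≤ M := by positivity
  have key2 : ∀ n ≤ N, MomentBound P 0 q (X n) M := by
    intro n hn
    refine (key n hn).mono_const ?_
    have h1 : (1 + L * τ) ^ n ≤ Real.exp (L * T) := by
      calc (1 + L * τ) ^ n ≤ Real.exp (L * τ) ^ n := by
            gcongr
            linarith [Real.add_one_le_exp (L * τ)]
        _ = Real.exp (n * (L * τ)) := (Real.exp_nat_mul _ _).symm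
        _ ≤ _ := Real.exp_le_exp.2 (by nlinarith [mul_le_mul_of_nonneg_left (hnT n hn) hL])
    have h2 : D + c * T ≤ (1 + T) * (D + c) := by nlinarith
    calc (D + c * T) * (1 + L * τ) ^ n ≤ ((1 + T) * (D + c)) * Real.exp (L * T) := by gcongr
      _ = M := by rw [hM]; ring
  intro n hn
  have hnJ : (n * J : ℕ) * (δ : ℝ) ≤ T := by
    have := hnT n hn
    push_cast
    rw [hτ] at this
    linarith
  have hconv := MomentBound.heatConv (s := s) (r := 0) (T := T) (K := L * M + c) (N := n * J) hq hs0
    (by simpa using hs1) hδ hnJ (by positivity)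
    (Y := A) (fun i hi => (key2 (i / J) ((hdiv n hn i hi).le.trans hn)).of_norm_le hq hL hc (hA i)
      (hAX i (hi.trans_le (Nat.mul_le_mul_right J hn))))
  have h1 := (hZ n hn).add hconv hq
  have e : (fun ω => Z n ω + Parareal.heatConv δ (fun i => A i ω) (n * J)) = X n := by
    ext1 ω; exact (hX n hn ω).symm
  rw [e] at h1
  refine h1.mono_const ?_
  rw [sub_zero, gronConst]
  have hS := singConst_nonneg hT hs1
  have : c ≤ D + c := by linarith
  calc D + singConst T s * (L * M + c) ≤ (D + c) + singConst T s * (L * M + (D + c)) := by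
        gcongr; linarith
    _ = _ := by rw [hM]; ring

/-! ### Discrete variation of constants -/

/-- The sum `∑_{i < N} e^{(N - 1 - i) δ A} z_i`. -/
def heatSum (δ : ℝ≥0) (z : ℕ → H) (N : ℕ) : H :=
  ∑ i ∈ Finset.range N, heat (((N - 1 - i : ℕ) : ℝ≥0) * δ) (z i)

lemma heatSum_succ (δ : ℝ≥0) (z : ℕ → H) (N : ℕ) :
    heatSum δ z (N + 1) = heat δ (heatSum δ z N) + z N := by
  rw [heatSum, Finset.sum_range_succ, heatSum, map_sum]
  congr 1
  · refine Finset.sum_congr rfl fun i hi => ?_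
    rw [← heat_add]
    have : N + 1 - 1 - i = 1 + (N - 1 - i) := by have := Finset.mem_range.1 hi; omega
    rw [this]; push_cast; ring_nf
  · simp [heat_zero]

lemma heatConv_add (δ : ℝ≥0) (y : ℕ → H) (N J : ℕ) :
    heatConv δ y (N + J) =
      heat (J * δ) (heatConv δ y N) + heatConv δ (fun j => y (N + j)) J := by
  rw [heatConv, Finset.sum_range_add, heatConv, heatConv, map_sum]
  congr 1
  · refine Finset.sum_congr rfl fun i hi => ?_
    rw [map_smul, ← heat_add]
    have : N + J - i = J + (N - i) := by have := Finset.mem_range.1 hi; omega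
    rw [this]; push_cast; ring_nf
  · refine Finset.sum_congr rfl fun i _ => ?_
    rw [Nat.add_sub_add_left]

lemma heatConv_succ (δ : ℝ≥0) (y : ℕ → H) (N : ℕ) :
    heatConv δ y (N + 1) = heat δ (heatConv δ y N) + (δ : ℝ) • heat δ (y N) := by
  rw [heatConv_add]
  simp [heatConv]

lemma heatConv_sub (δ : ℝ≥0) (y z : ℕ → H) (N : ℕ) :
    heatConv δ (fun i => y i - z i) N = heatConv δ y N - heatConv δ z N := by
  simp only [heatConv, map_sub, smul_sub, Finset.sum_sub_distrib]

lemma heatConv_add_fun (δ : ℝ≥0) (y z : ℕ → H) (N : ℕ) :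
    heatConv δ (fun i => y i + z i) N = heatConv δ y N + heatConv δ z N := by
  simp only [heatConv, map_add, smul_add, Finset.sum_add_distrib]

/-- The drift `y` carries the factor $e^{\delta A}$ of its own step, whereas `z` stands for noise
that has already been smoothed. This is why the exponents of `heatConv` and `heatSum` differ by one
step. -/
lemma variation_of_constants (δ : ℝ≥0) {x y z : ℕ → H}
    (h : ∀ j, x (j + 1) = heat δ (x j) + (δ : ℝ) • heat δ (y j) + z j) (j : ℕ) :
    x j = heat (j * δ) (x 0) + heatConv δ y j + heatSum δ z j := by
  induction j with
  | zero => simp [heatConv, heatSum, heat_zero]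
  | succ j ih =>
    rw [h, ih, heatConv_succ, heatSum_succ, map_add, map_add, ← heat_add]
    have : δ + j * δ = ((j + 1 : ℕ) : ℝ≥0) * δ := by push_cast; ring
    rw [this]
    abel

lemma block_variation_of_constants (δ : ℝ≥0) (J : ℕ) {e r : ℕ → H} (h0 : e 0 = 0)
    (h : ∀ n, e (n + 1) = heat (J * δ) (e n) + heatConv δ (fun j => r (n * J + j)) J) (n : ℕ) :
    e n = heatConv δ r (n * J) := by
  induction n with
  | zero => simp [h0, heatConv]
  | succ n ih => rw [h, ih, Nat.succ_mul, heatConv_add]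

lemma heatConv_const (δ : ℝ≥0) (J : ℕ) (y : H) :
    heatConv δ (fun j => heat (j * δ) y) J = (J * δ : ℝ) • heat (J * δ) y := by
  rw [heatConv]
  have : ∀ i ∈ Finset.range J, (δ : ℝ) • heat (((J - i : ℕ) : ℝ≥0) * δ) (heat (i * δ) y) =
      (δ : ℝ) • heat (J * δ) y := by
    intro i hi
    rw [← heat_add, ← add_mul]
    congr 3
    have := Finset.mem_range.1 hi
    rw [← Nat.cast_add, Nat.sub_add_cancel this.le]
  rw [Finset.sum_congr rfl this, Finset.sum_const, Finset.card_range, ← Nat.cast_smul_eq_nsmul ℝ,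
    smul_smul]

/-- Puts a coarse convolution on the fine grid. In position $j$ of a cell the extra factor
$e^{j\delta A}$ restores the time to the coarse node, so the $J$ fine terms are equal. -/
lemma heatConv_block (δ : ℝ≥0) {J : ℕ} (hJ : 1 ≤ J) (y : ℕ → H) (n : ℕ) :
    heatConv (J * δ) y n =
      heatConv δ (fun i => heat ((i % J : ℕ) * δ) (y (i / J))) (n * J) := by
  induction n with
  | zero => simp [heatConv]
  | succ n ih =>
    rw [heatConv_succ, ih, Nat.succ_mul, heatConv_add]
    congr 1
    have e := heatConv_const δ J (y n)
    push_cast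
    rw [← e]
    refine Finset.sum_congr rfl fun j hj => ?_
    have hj' := Finset.mem_range.1 hj
    simp only
    rw [Nat.add_comm (n * J) j, Nat.add_mul_mod_self_right, Nat.mod_eq_of_lt hj',
      Nat.add_mul_div_right _ _ (by omega), Nat.div_eq_of_lt hj', Nat.zero_add]

/-! ### Stochastic convolutions -/

/-- The discrete stochastic convolution with step `δ` started at time `s`. -/
def noiseConv (W : QWiener P) (δ : ℝ≥0) (s : ℝ) (ω : Ω) (N : ℕ) : H :=
  heatSum δ (fun i => W.noise δ (s + i * δ) (s + i * δ + δ) ω) N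

lemma aestronglyMeasurable_noise (W : QWiener P) (τ s t : ℝ) :
    AEStronglyMeasurable (W.noise τ s t) P := Lp.aestronglyMeasurable _

lemma aestronglyMeasurable_noiseConv (W : QWiener P) (δ : ℝ≥0) (s : ℝ) (N : ℕ) :
    AEStronglyMeasurable (fun ω => noiseConv W δ s ω N) P := by
  unfold noiseConv heatSum
  exact Finset.aestronglyMeasurable_fun_sum _ fun i _ =>
    (heat _).continuous.comp_aestronglyMeasurable (aestronglyMeasurable_noise W _ _ _)

section

variable {W : QWiener P} {α : ℝ}

/-- The factor $e^{\delta A}$ inside `noise` turns the exponent $N-1-i$ of `heatSum` into $N-i$. -/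
lemma coord_noiseConv (h0 : 0 ≤ α) (h1 : α ≤ 1 / 2) (hW : W.hsNorm α < ∞) {δ : ℝ≥0} (hδ : 0 < δ)
    (s : ℝ) (N p : ℕ) :
    (fun ω => coord p (noiseConv W δ s ω N)) =ᵐ[P] (∑ i ∈ Finset.range N,
      Real.exp (-(eigval p * ((N - i : ℕ) * δ))) •
        (W.coordProc p (s + (i + 1 : ℕ) * δ) - W.coordProc p (s + i * δ)) : Lp ℝ 2 P) := by
  have hδ' : (0 : ℝ) < δ := hδ
  filter_upwards [ae_all_iff.2 fun i : ℕ => W.coord_noise h0 h1 hW hδ' (s + i * δ)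
      (s + i * δ + δ) p, Lp.coeFn_fun_finsetSum (Finset.range N) (fun i =>
      Real.exp (-(eigval p * ((N - i : ℕ) * δ))) •
        (W.coordProc p (s + (i + 1 : ℕ) * δ) - W.coordProc p (s + i * δ))),
    ae_all_iff.2 fun i : ℕ => Lp.coeFn_smul (Real.exp (-(eigval p * ((N - i : ℕ) * δ))))
      (W.coordProc p (s + (i + 1 : ℕ) * δ) - W.coordProc p (s + i * δ)),
    ae_all_iff.2 fun i : ℕ => Lp.coeFn_smul (Real.exp (-(eigval p * δ)))
      (W.coordProc p (s + (i + 1 : ℕ) * δ) - W.coordProc p (s + i * δ))] with ω a1 a2 a3 a4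
  rw [a2, noiseConv, heatSum, map_sum]
  refine Finset.sum_congr rfl fun i hi => ?_
  have e : s + i * (δ : ℝ) + δ = s + (i + 1 : ℕ) * δ := by push_cast; ring
  have hi' := Finset.mem_range.1 hi
  rw [a3, coord_heat, a1, e, a4, Pi.smul_apply, Pi.smul_apply, smul_eq_mul, smul_eq_mul,
    ← mul_assoc, ← Real.exp_add]
  congr 2
  have : N - i = (N - 1 - i) + 1 := by omega
  rw [NNReal.coe_mul, NNReal.coe_natCast, this, Nat.cast_add, Nat.cast_one]
  ring

lemma sum_exp_sq_le {l δ : ℝ} (hl : 0 < l) (N : ℕ) :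
    ∑ i ∈ Finset.range N, Real.exp (-(l * ((N - i : ℕ) * δ))) ^ 2 * δ ≤ 1 / l := by
  -- The induction needs the sharper bound by $\int_0^{N\delta}e^{-2lt}\,dt$.
  have h : ∀ N : ℕ, ∑ i ∈ Finset.range N, Real.exp (-(l * ((N - i : ℕ) * δ))) ^ 2 * δ ≤
      (1 - Real.exp (-(l * (N * δ))) ^ 2) / (2 * l) := by
    intro N
    induction N with
    | zero => simp
    | succ N ih =>
      rw [Finset.sum_range_succ']
      simp only [Nat.add_sub_add_right, Nat.sub_zero]
      refine (add_le_add_left ih _).trans ?_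
      have e : Real.exp (-(l * (((N + 1 : ℕ) : ℝ) * δ))) ^ 2 =
          Real.exp (-(l * (N * δ))) ^ 2 * Real.exp (-(2 * l * δ)) := by
        rw [← Real.exp_nat_mul, ← Real.exp_nat_mul, ← Real.exp_add]
        congr 1; push_cast; ring
      rw [e, le_div_iff₀ (by positivity), add_mul, div_mul_cancel₀ _ (by positivity)]
      have h1 := Real.add_one_le_exp (2 * l * δ)
      have h2 : Real.exp (-(2 * l * δ)) * Real.exp (2 * l * δ) = 1 := by
        rw [← Real.exp_add]; simp
      have h3 : Real.exp (-(2 * l * δ)) * (2 * l * δ + 1) ≤ 1 := by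
        exact (mul_le_mul_of_nonneg_left h1 (Real.exp_pos _).le).trans h2.le
      have h4 : 0 ≤ Real.exp (-(l * (N * δ))) ^ 2 := sq_nonneg _
      nlinarith [mul_le_mul_of_nonneg_left h3 h4]
  refine (h N).trans ?_
  rw [div_le_div_iff₀ (by positivity) hl]
  nlinarith [sq_nonneg (Real.exp (-(l * (N * δ))))]

lemma sum_exp_sq_le_mul {l δ : ℝ} (hl : 0 < l) (hδ : 0 < δ) (N : ℕ) :
    ∑ i ∈ Finset.range N, Real.exp (-(l * ((N - i : ℕ) * δ))) ^ 2 * δ ≤ N * δ := by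
  have : ∀ i ∈ Finset.range N, Real.exp (-(l * ((N - i : ℕ) * δ))) ^ 2 * δ ≤ δ := by
    intro i _
    refine mul_le_of_le_one_left hδ.le (pow_le_one₀ (Real.exp_pos _).le ?_)
    rw [Real.exp_le_one_iff]
    have : (0 : ℝ) ≤ ((N - i : ℕ) : ℝ) := Nat.cast_nonneg _
    have := mul_nonneg hl.le (mul_nonneg this hδ.le)
    linarith
  simpa using Finset.sum_le_sum this

variable (W α) in
/-- The constant in the moment bounds of the stochastic convolutions. -/
def noiseConst (q : ℕ) : ℝ := (gaussMoment (2 * q) * W.hsNorm α).toReal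

lemma noiseConst_nonneg (q : ℕ) : 0 ≤ noiseConst W α q := ENNReal.toReal_nonneg

lemma momentBound_of_coord [IsProbabilityMeasure P] (hW : W.hsNorm α < ∞) {q : ℕ} (hq : 1 ≤ q)
    {s K : ℝ} (hK : 0 ≤ K) {Y : Ω → H} (hY : AEStronglyMeasurable Y P) (N : ℕ) (c : ℕ → ℕ → ℝ)
    (r : ℕ → ℝ) (hr : Monotone r) (hr0 : 0 ≤ r 0)
    (hc : ∀ p, (fun ω => coord p (Y ω)) =ᵐ[P] (∑ i ∈ Finset.range N,
      c p i • (W.coordProc p (r (i + 1)) - W.coordProc p (r i)) : Lp ℝ 2 P))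
    (hb : ∀ p, eigval p ^ (2 * s) * ∑ i ∈ Finset.range N, c p i ^ 2 * (r (i + 1) - r i) ≤
      K ^ 2 * eigval p ^ (2 * α - 1)) :
    MomentBound P s q Y (noiseConst W α q * K) := by
  refine ⟨hY, mul_nonneg (noiseConst_nonneg q) hK, ?_⟩
  refine (W.eLpNorm_fracNorm_le hW hq hK hY N c r hr hr0 hc hb).trans (le_of_eq ?_)
  rw [mul_comm (noiseConst W α q), ENNReal.ofReal_mul hK, noiseConst, ENNReal.ofReal_toReal
    (ENNReal.mul_lt_top (gaussMoment_lt_top _) hW).ne]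

/-- The variance sum $S$ is at most $1/\lambda_p$ and at most $N\delta$. Geometric interpolation
with weight $2(\alpha-\beta)\le1$ on the second bound gives spatial regularity and the power of time
together. -/
lemma momentBound_noiseConv [IsProbabilityMeasure P] (h0 : 0 ≤ α) (h1 : α ≤ 1 / 2)
    (hW : W.hsNorm α < ∞) {q : ℕ} (hq : 1 ≤ q) {β : ℝ} (hβ : β ≤ α) (hβ' : α - β ≤ 1 / 2)
    {δ : ℝ≥0} (hδ : 0 < δ) {s : ℝ} (hs : 0 ≤ s) (N : ℕ) :
    MomentBound P β q (fun ω => noiseConv W δ s ω N) (noiseConst W α q * (N * δ : ℝ) ^ (α - β)) := by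
  have hδ' : (0 : ℝ) < δ := hδ
  refine momentBound_of_coord hW hq (by positivity) (aestronglyMeasurable_noiseConv W δ s N) N
    (fun p i => Real.exp (-(eigval p * ((N - i : ℕ) * δ)))) (fun i => s + i * δ) ?_ (by simpa)
    (fun p => coord_noiseConv h0 h1 hW hδ s N p) (fun p => ?_)
  · intro i j hij
    have : (i : ℝ) ≤ j := by exact_mod_cast hij
    simp only
    gcongr
  · have hl := eigval_pos p
    have e1 : ∀ i : ℕ, s + ((i + 1 : ℕ) : ℝ) * (δ : ℝ) - (s + i * δ) = δ := fun i => by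
      push_cast; ring
    simp_rw [e1]
    set S := ∑ i ∈ Finset.range N, Real.exp (-(eigval p * ((N - i : ℕ) * δ))) ^ 2 * (δ : ℝ) with hS
    have hS0 : 0 ≤ S := Finset.sum_nonneg fun _ _ => by positivity
    have hS1 : S ≤ 1 / eigval p := sum_exp_sq_le hl N
    have hS2 : S ≤ N * δ := sum_exp_sq_le_mul hl hδ' N
    rcases hS0.eq_or_lt with h | hpos
    · rw [← h, mul_zero]; positivity
    · have hNδ : (0 : ℝ) < N * δ := hpos.trans_le hS2
      have e2 : S = S ^ (2 * (α - β)) * S ^ (1 - 2 * (α - β)) := by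
        rw [← Real.rpow_add hpos, add_sub_cancel, Real.rpow_one]
      have b1 : S ^ (2 * (α - β)) ≤ (N * δ : ℝ) ^ (2 * (α - β)) :=
        Real.rpow_le_rpow hS0 hS2 (by linarith)
      have b2 : S ^ (1 - 2 * (α - β)) ≤ (1 / eigval p) ^ (1 - 2 * (α - β)) :=
        Real.rpow_le_rpow hS0 hS1 (by linarith)
      calc eigval p ^ (2 * β) * S
          = eigval p ^ (2 * β) * (S ^ (2 * (α - β)) * S ^ (1 - 2 * (α - β))) := by
            rw [← e2]
        _ ≤ eigval p ^ (2 * β) * ((N * δ : ℝ) ^ (2 * (α - β)) *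
              (1 / eigval p) ^ (1 - 2 * (α - β))) :=
            mul_le_mul_of_nonneg_left (mul_le_mul b1 b2 (Real.rpow_nonneg hS0 _)
              (Real.rpow_nonneg hNδ.le _)) (Real.rpow_nonneg hl.le _)
        _ = ((N * δ : ℝ) ^ (α - β)) ^ 2 * eigval p ^ (2 * α - 1) := by
            rw [one_div, Real.inv_rpow hl.le, ← Real.rpow_neg hl.le, mul_left_comm,
              ← Real.rpow_add hl, ← Real.rpow_natCast ((N * δ : ℝ) ^ (α - β)),
              ← Real.rpow_mul hNδ.le]
            congr 2
            · push_cast; ring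
            · ring

/-- On a coarse cell the coarse kernel is the fine one times $e^{-\lambda_p(i\bmod J)\delta}$. The
difference carries a factor at most $(\lambda_pJ\delta)^{\alpha-\beta}$, so orders up to $1$ are
available, not only $\frac12$. -/
lemma momentBound_noiseConv_sub [IsProbabilityMeasure P] (h0 : 0 ≤ α) (h1 : α ≤ 1 / 2)
    (hW : W.hsNorm α < ∞) {q : ℕ} (hq : 1 ≤ q) {β : ℝ} (hβ : β ≤ α) (hβ' : α - β ≤ 1)
    {δ : ℝ≥0} (hδ : 0 < δ) {J : ℕ} (hJ : 1 ≤ J) (n : ℕ) :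
    MomentBound P β q (fun ω => noiseConv W (J * δ) 0 ω n - noiseConv W δ 0 ω (n * J))
      (noiseConst W α q * (J * δ : ℝ) ^ (α - β)) := by
  have hδ' : (0 : ℝ) < δ := hδ
  have hJ' : (0 : ℝ) < J := by exact_mod_cast hJ
  have hJδ : (0 : ℝ≥0) < J * δ := mul_pos (by exact_mod_cast hJ) hδ
  refine momentBound_of_coord hW hq (by positivity)
    ((aestronglyMeasurable_noiseConv W _ 0 n).sub (aestronglyMeasurable_noiseConv W δ 0 _)) (n * J)
    (fun p i => Real.exp (-(eigval p * ((n * J - i : ℕ) * δ))) *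
      (Real.exp (-(eigval p * ((i % J : ℕ) * δ))) - 1)) (fun i => 0 + i * δ) ?_ (by simp)
    (fun p => ?_) (fun p => ?_)
  · intro i j hij
    have : (i : ℝ) ≤ j := by exact_mod_cast hij
    simp only
    gcongr
  · have e : (∑ i ∈ Finset.range n, Real.exp (-(eigval p * ((n - i : ℕ) * (J * δ : ℝ≥0)))) •
        (W.coordProc p (0 + (i + 1 : ℕ) * (J * δ : ℝ≥0)) - W.coordProc p (0 + i * (J * δ : ℝ≥0)))) -
        ∑ i ∈ Finset.range (n * J), Real.exp (-(eigval p * ((n * J - i : ℕ) * δ))) •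
          (W.coordProc p (0 + (i + 1 : ℕ) * δ) - W.coordProc p (0 + i * δ)) =
        ∑ i ∈ Finset.range (n * J), (Real.exp (-(eigval p * ((n * J - i : ℕ) * δ))) *
          (Real.exp (-(eigval p * ((i % J : ℕ) * δ))) - 1)) •
          (W.coordProc p (0 + (i + 1 : ℕ) * δ) - W.coordProc p (0 + i * δ)) := by
      simp only [mul_sub, mul_one, sub_smul, Finset.sum_sub_distrib]
      congr 1
      rw [sum_range_mul_eq]
      refine Finset.sum_congr rfl fun m hm => ?_
      have hm' := Finset.mem_range.1 hm
      have h2 : ∀ j ∈ Finset.range J,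
          (Real.exp (-(eigval p * ((n * J - (m * J + j) : ℕ) * δ))) *
          Real.exp (-(eigval p * (((m * J + j) % J : ℕ) * δ)))) •
          (W.coordProc p (0 + (m * J + j + 1 : ℕ) * δ) - W.coordProc p (0 + (m * J + j : ℕ) * δ)) =
          Real.exp (-(eigval p * ((n - m : ℕ) * (J * δ : ℝ≥0)))) •
          (W.coordProc p (0 + (m * J + (j + 1) : ℕ) * δ) -
            W.coordProc p (0 + (m * J + j : ℕ) * δ)) := by
        intro j hj
        have hj' := Finset.mem_range.1 hj
        rw [← Real.exp_add, ← Nat.add_assoc]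
        congr 2
        have hle : m * J + j ≤ n * J := by nlinarith
        rw [Nat.add_comm (m * J) j, Nat.add_mul_mod_self_right, Nat.mod_eq_of_lt hj',
          Nat.add_comm j, Nat.cast_sub hle, Nat.cast_sub hm'.le]
        push_cast
        ring
      -- The combined kernel is constant on the cell, so the fine increments telescope to the coarse
      -- one.
      rw [Finset.sum_congr rfl h2, ← Finset.smul_sum, Finset.sum_range_sub
        (fun j => W.coordProc p (0 + (m * J + j : ℕ) * δ))]
      congr 3
      · congr 1; push_cast; ring
      · congr 1; push_cast; ring
    rw [← e]
    filter_upwards [coord_noiseConv h0 h1 hW hJδ 0 n p, coord_noiseConv h0 h1 hW hδ 0 (n * J) p,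
      Lp.coeFn_sub (∑ i ∈ Finset.range n, Real.exp (-(eigval p * ((n - i : ℕ) * (J * δ : ℝ≥0)))) •
        (W.coordProc p (0 + (i + 1 : ℕ) * (J * δ : ℝ≥0)) - W.coordProc p (0 + i * (J * δ : ℝ≥0))))
        (∑ i ∈ Finset.range (n * J), Real.exp (-(eigval p * ((n * J - i : ℕ) * δ))) •
          (W.coordProc p (0 + (i + 1 : ℕ) * δ) - W.coordProc p (0 + i * δ)))] with ω a1 a2 a3
    rw [a3, map_sub, a1, a2, Pi.sub_apply]
  · have hl := eigval_pos p
    have e1 : ∀ i : ℕ, 0 + ((i + 1 : ℕ) : ℝ) * (δ : ℝ) - (0 + i * δ) = δ := fun i => by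
      push_cast; ring
    simp_rw [e1]
    set ϑ := α - β with hϑ
    have hx : 0 ≤ eigval p * (J * δ) := by positivity
    have b1 : ∑ i ∈ Finset.range (n * J), (Real.exp (-(eigval p * ((n * J - i : ℕ) * δ))) *
        (Real.exp (-(eigval p * ((i % J : ℕ) * δ))) - 1)) ^ 2 * (δ : ℝ) ≤
        ((eigval p * (J * δ)) ^ ϑ) ^ 2 * (1 / eigval p) := by
      refine le_trans ?_ (mul_le_mul_of_nonneg_left (sum_exp_sq_le (δ := (δ : ℝ)) hl (n * J)) (sq_nonneg _))
      rw [Finset.mul_sum]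
      refine Finset.sum_le_sum fun i _ => ?_
      rw [mul_pow, mul_comm (Real.exp _ ^ 2), mul_assoc]
      refine mul_le_mul_of_nonneg_right ?_ (by positivity)
      rw [← neg_sq, neg_sub]
      have hy : (0 : ℝ) ≤ eigval p * ((i % J : ℕ) * δ) := by positivity
      have h3 : Real.exp (-(eigval p * ((i % J : ℕ) * δ))) ≤ 1 := by
        rw [Real.exp_le_one_iff]; linarith
      refine pow_le_pow_left₀ (by linarith) ?_ 2
      refine (one_sub_exp_neg_le (by linarith) hβ' hy).trans ?_
      refine Real.rpow_le_rpow hy ?_ (by linarith)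
      have : ((i % J : ℕ) : ℝ) ≤ J := by exact_mod_cast (Nat.mod_lt i hJ).le
      gcongr
    refine (mul_le_mul_of_nonneg_left b1 (Real.rpow_nonneg hl.le _)).trans (le_of_eq ?_)
    rw [Real.mul_rpow hl.le (by positivity), mul_pow, ← Real.rpow_natCast (eigval p ^ ϑ),
      ← Real.rpow_mul hl.le, one_div, ← Real.rpow_neg_one (eigval p)]
    have e3 : eigval p ^ (2 * α - 1) =
        eigval p ^ (2 * β) * (eigval p ^ (ϑ * (2 : ℕ)) * eigval p ^ (-1 : ℝ)) := by
      rw [← Real.rpow_add hl, ← Real.rpow_add hl]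
      congr 1; push_cast; rw [hϑ]; ring
    rw [e3]
    ring

end

/-! ### Second order differences of the nonlinearity -/

lemma fracNorm_segment_le {s t : ℝ} (ht : t ∈ Set.Icc (0 : ℝ) 1) (u v : H) :
    fracNorm s (v + t • (u - v)) ≤ fracNorm s u + fracNorm s v := by
  have e : v + t • (u - v) = t • u + (1 - t) • v := by module
  rw [e]
  refine (fracNorm_add_le s _ _).trans ?_
  rw [fracNorm_smul, fracNorm_smul]
  have h1 : ‖t‖ₑ ≤ 1 := by
    rw [Real.enorm_eq_ofReal_abs, abs_of_nonneg ht.1]; exact ENNReal.ofReal_le_one.2 ht.2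
  have h2 : ‖1 - t‖ₑ ≤ 1 := by
    rw [Real.enorm_eq_ofReal_abs, abs_of_nonneg (by linarith [ht.2])]
    exact ENNReal.ofReal_le_one.2 (by linarith [ht.1])
  exact add_le_add (mul_le_of_le_one_left zero_le h1) (mul_le_of_le_one_left zero_le h2)

/-- The mean value inequality for the second order difference of `F` along two segments. -/
lemma fracNorm_second_difference_le {F : H → H} (hF : Differentiable ℝ F) {α a b b' : ℝ}
    {C : ℝ≥0} (ha : 0 ≤ a) (hba : b ≤ a) (hb' : b' ≤ α)
    (h1 : ∀ u h : H, fracNorm α u < ∞ →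
      fracNorm (-a) (fderiv ℝ F u h) ≤ C * (1 + fracNorm α u) * fracNorm (-a) h)
    (h2 : ∀ u₁ u₂ h : H, fracNorm b' u₁ < ∞ → fracNorm b' u₂ < ∞ → fracNorm b' h < ∞ →
      fracNorm (-b) ((fderiv ℝ F u₂ - fderiv ℝ F u₁) h) ≤
        C * (1 + fracNorm b' u₁ + fracNorm b' u₂) * fracNorm (-b) (u₂ - u₁) * fracNorm b' h)
    {u₀ v₀ u₁ v₁ : H} (hu₀ : fracNorm α u₀ < ∞) (hv₀ : fracNorm α v₀ < ∞)
    (hu₁ : fracNorm α u₁ < ∞) (hv₁ : fracNorm α v₁ < ∞) :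
    fracNorm (-a) ((F u₁ - F v₁) - (F u₀ - F v₀)) ≤
      C * ((1 + (fracNorm α u₀ + fracNorm α v₀ + fracNorm α u₁ + fracNorm α v₁)) *
        ((fracNorm (-b) (u₁ - u₀) + fracNorm (-b) (v₁ - v₀)) * fracNorm b' (u₁ - v₁) +
          fracNorm (-a) ((u₁ - v₁) - (u₀ - v₀)))) := by
  set B := C * ((1 + (fracNorm α u₀ + fracNorm α v₀ + fracNorm α u₁ + fracNorm α v₁)) *
        ((fracNorm (-b) (u₁ - u₀) + fracNorm (-b) (v₁ - v₀)) * fracNorm b' (u₁ - v₁) +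
          fracNorm (-a) ((u₁ - v₁) - (u₀ - v₀)))) with hB
  -- Only a finite bound can be used in the real-valued mean value inequality below.
  rcases eq_top_or_lt_top B with hBt | hBt
  · rw [hBt]; exact le_top
  set w₀ : ℝ → H := fun t => v₀ + t • (u₀ - v₀) with hw₀
  set w₁ : ℝ → H := fun t => v₁ + t • (u₁ - v₁) with hw₁
  set D := diag (fun p => eigval p ^ (-a)) (abs_eigval_rpow_neg_le ha) with hD
  have hderiv : ∀ t : ℝ, HasDerivAt (fun t => D (F (w₁ t) - F (w₀ t)))
      (D (fderiv ℝ F (w₁ t) (u₁ - v₁) - fderiv ℝ F (w₀ t) (u₀ - v₀))) t := by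
    intro t
    have hw : ∀ u v : H, HasDerivAt (fun t : ℝ => v + t • (u - v)) (u - v) t := fun u v => by
      simpa using ((hasDerivAt_id t).smul_const (u - v)).const_add v
    have hF' : ∀ u v : H, HasDerivAt (fun t : ℝ => F (v + t • (u - v)))
        (fderiv ℝ F (v + t • (u - v)) (u - v)) t := fun u v =>
      (hF _).hasFDerivAt.comp_hasDerivAt t (hw u v)
    exact D.hasFDerivAt.comp_hasDerivAt t ((hF' u₁ v₁).sub (hF' u₀ v₀))
  have hbound : ∀ t ∈ Set.Ico (0 : ℝ) 1,
      ‖D (fderiv ℝ F (w₁ t) (u₁ - v₁) - fderiv ℝ F (w₀ t) (u₀ - v₀))‖ ≤ B.toReal := by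
    intro t ht
    have ht' : t ∈ Set.Icc (0 : ℝ) 1 := ⟨ht.1, ht.2.le⟩
    rw [← toReal_enorm]
    refine ENNReal.toReal_mono hBt.ne ?_
    rw [hD, ← fracNorm_eq_enorm_diag]
    -- Either the base point of the derivative moves, which `h2` controls, or the direction changes,
    -- which `h1` controls.
    have e : fderiv ℝ F (w₁ t) (u₁ - v₁) - fderiv ℝ F (w₀ t) (u₀ - v₀) =
        (fderiv ℝ F (w₁ t) - fderiv ℝ F (w₀ t)) (u₁ - v₁) +
          fderiv ℝ F (w₀ t) ((u₁ - v₁) - (u₀ - v₀)) := by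
      simp only [sub_apply, map_sub]; abel
    have n0 : fracNorm α (w₀ t) ≤ fracNorm α u₀ + fracNorm α v₀ := fracNorm_segment_le ht' _ _
    have n1 : fracNorm α (w₁ t) ≤ fracNorm α u₁ + fracNorm α v₁ := fracNorm_segment_le ht' _ _
    have f0 : fracNorm α (w₀ t) < ∞ := n0.trans_lt (ENNReal.add_lt_top.2 ⟨hu₀, hv₀⟩)
    have f1 : fracNorm α (w₁ t) < ∞ := n1.trans_lt (ENNReal.add_lt_top.2 ⟨hu₁, hv₁⟩)
    have fd : fracNorm α (u₁ - v₁) < ∞ :=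
      (fracNorm_sub_le _ _ _).trans_lt (ENNReal.add_lt_top.2 ⟨hu₁, hv₁⟩)
    have m := fun x : H => fracNorm_mono hb' x
    have nd : fracNorm (-b) (w₁ t - w₀ t) ≤
        fracNorm (-b) (u₁ - u₀) + fracNorm (-b) (v₁ - v₀) := by
      have e2 : w₁ t - w₀ t = (v₁ - v₀) + t • ((u₁ - u₀) - (v₁ - v₀)) := by
        simp only [hw₀, hw₁]; module
      rw [e2]
      exact fracNorm_segment_le ht' _ _
    rw [e]
    refine (fracNorm_add_le _ _ _).trans ?_
    have t1 := (fracNorm_mono (neg_le_neg hba) _).trans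
      (h2 (w₀ t) (w₁ t) (u₁ - v₁) ((m _).trans_lt f0) ((m _).trans_lt f1) ((m _).trans_lt fd))
    have t2 := h1 (w₀ t) ((u₁ - v₁) - (u₀ - v₀)) f0
    have r1 : 1 + fracNorm b' (w₀ t) + fracNorm b' (w₁ t) ≤
        1 + (fracNorm α u₀ + fracNorm α v₀ + fracNorm α u₁ + fracNorm α v₁) := by
      calc 1 + fracNorm b' (w₀ t) + fracNorm b' (w₁ t)
          ≤ 1 + (fracNorm α u₀ + fracNorm α v₀) + (fracNorm α u₁ + fracNorm α v₁) :=
            add_le_add (add_le_add le_rfl ((m _).trans n0)) ((m _).trans n1)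
        _ = _ := by ring
    have r2 : 1 + fracNorm α (w₀ t) ≤
        1 + (fracNorm α u₀ + fracNorm α v₀ + fracNorm α u₁ + fracNorm α v₁) := by
      refine add_le_add le_rfl (n0.trans ?_)
      rw [add_assoc (_ + _)]
      exact le_self_add
    calc _ ≤ C * (1 + fracNorm b' (w₀ t) + fracNorm b' (w₁ t)) *
            fracNorm (-b) (w₁ t - w₀ t) * fracNorm b' (u₁ - v₁) +
          C * (1 + fracNorm α (w₀ t)) * fracNorm (-a) ((u₁ - v₁) - (u₀ - v₀)) :=
          add_le_add t1 t2
      _ ≤ C * (1 + (fracNorm α u₀ + fracNorm α v₀ + fracNorm α u₁ + fracNorm α v₁)) *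
            (fracNorm (-b) (u₁ - u₀) + fracNorm (-b) (v₁ - v₀)) * fracNorm b' (u₁ - v₁) +
          C * (1 + (fracNorm α u₀ + fracNorm α v₀ + fracNorm α u₁ + fracNorm α v₁)) *
            fracNorm (-a) ((u₁ - v₁) - (u₀ - v₀)) := by gcongr
      _ = B := by rw [hB]; ring
  have hmv := norm_image_sub_le_of_norm_deriv_le_segment_01'
    (fun t _ => (hderiv t).hasDerivWithinAt) hbound
  have e3 : D (F (w₁ 1) - F (w₀ 1)) - D (F (w₁ 0) - F (w₀ 0)) =
      D ((F u₁ - F v₁) - (F u₀ - F v₀)) := by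
    rw [← map_sub]
    congr 1
    simp only [hw₀, hw₁, one_smul, zero_smul, add_zero, add_sub_cancel]
    abel
  rw [e3] at hmv
  rw [fracNorm_eq_enorm_diag (abs_eigval_rpow_neg_le ha), ← ofReal_norm]
  exact (ENNReal.ofReal_le_ofReal hmv).trans ENNReal.ofReal_toReal_le

lemma eLpNorm_mul_le_two_mul {q : ℕ} (hq : 1 ≤ q) {f g : Ω → ℝ≥0∞} (hf : AEMeasurable f P)
    (hg : AEMeasurable g P) :
    eLpNorm (fun ω => f ω * g ω) q P ≤
      eLpNorm f ((2 * q : ℕ) : ℝ≥0∞) P * eLpNorm g ((2 * q : ℕ) : ℝ≥0∞) P := by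
  have hq0 : (q : ℝ≥0∞) ≠ 0 := by exact_mod_cast (by omega : q ≠ 0)
  have h2q0 : ((2 * q : ℕ) : ℝ≥0∞) ≠ 0 := by exact_mod_cast (by omega : 2 * q ≠ 0)
  have hqr : (0 : ℝ) < q := by exact_mod_cast hq
  rw [eLpNorm_eq_lintegral_rpow_enorm_toReal hq0 (ENNReal.natCast_ne_top q),
    eLpNorm_eq_lintegral_rpow_enorm_toReal h2q0 (ENNReal.natCast_ne_top _),
    eLpNorm_eq_lintegral_rpow_enorm_toReal h2q0 (ENNReal.natCast_ne_top _)]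
  simp only [enorm_eq_self, ENNReal.toReal_natCast]
  refine ENNReal.lintegral_Lp_mul_le_Lq_mul_Lr hqr ?_ ?_ P hf hg
  · push_cast; linarith
  · push_cast; field_simp; norm_num

/-- Hölder's inequality is used twice: the prefactor and the bracket are put in $L^{2q}$, and the
product inside the bracket needs both its factors in $L^{4q}$. -/
lemma MomentBound.second_difference [IsProbabilityMeasure P] {F : H → H}
    (hF : Differentiable ℝ F) {α a b b' : ℝ}
    {C : ℝ≥0} (ha : 0 ≤ a) (hba : b ≤ a) (hb' : b' ≤ α)
    (h1 : ∀ u h : H, fracNorm α u < ∞ →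
      fracNorm (-a) (fderiv ℝ F u h) ≤ C * (1 + fracNorm α u) * fracNorm (-a) h)
    (h2 : ∀ u₁ u₂ h : H, fracNorm b' u₁ < ∞ → fracNorm b' u₂ < ∞ → fracNorm b' h < ∞ →
      fracNorm (-b) ((fderiv ℝ F u₂ - fderiv ℝ F u₁) h) ≤
        C * (1 + fracNorm b' u₁ + fracNorm b' u₂) * fracNorm (-b) (u₂ - u₁) * fracNorm b' h)
    {q : ℕ} (hq : 1 ≤ q) {u₀ v₀ u₁ v₁ : Ω → H} {M p k g : ℝ}
    (hu₀ : MomentBound P α (4 * q) u₀ M) (hv₀ : MomentBound P α (4 * q) v₀ M)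
    (hu₁ : MomentBound P α (4 * q) u₁ M) (hv₁ : MomentBound P α (4 * q) v₁ M)
    (hu : MomentBound P (-b) (4 * q) (fun ω => u₁ ω - u₀ ω) p)
    (hv : MomentBound P (-b) (4 * q) (fun ω => v₁ ω - v₀ ω) p)
    (hk : MomentBound P b' (4 * q) (fun ω => u₁ ω - v₁ ω) k)
    (hg : MomentBound P (-a) (4 * q) (fun ω => (u₁ ω - v₁ ω) - (u₀ ω - v₀ ω)) g) :
    MomentBound P (-a) q (fun ω => (F (u₁ ω) - F (v₁ ω)) - (F (u₀ ω) - F (v₀ ω)))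
      (C * ((1 + 4 * M) * (2 * p * k + g))) := by
  have hM := hu₀.nonneg
  have hp := hu.nonneg
  have hk0 := hk.nonneg
  have hg0 := hg.nonneg
  have hq4 : (1 : ℝ≥0∞) ≤ ((4 * q : ℕ) : ℝ≥0∞) := by exact_mod_cast (by omega : 1 ≤ 4 * q)
  have hq2 : (1 : ℝ≥0∞) ≤ ((2 * q : ℕ) : ℝ≥0∞) := by exact_mod_cast (by omega : 1 ≤ 2 * q)
  -- The pointwise estimate requires finite norms, which the moment bounds provide almost surely.
  have fin : ∀ {X : Ω → H}, MomentBound P α (4 * q) X M → ∀ᵐ ω ∂P, fracNorm α (X ω) < ∞ := by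
    intro X hX
    have h3 : eLpNorm (fun ω => fracNorm α (X ω)) 1 P < ∞ :=
      ((eLpNorm_le_eLpNorm_of_exponent_le hq4 hX.aemeas).trans hX.le).trans_lt
        ENNReal.ofReal_lt_top
    rw [eLpNorm_one_eq_lintegral_enorm] at h3
    simp only [enorm_eq_self] at h3
    exact ae_lt_top' hX.aemeas.aemeasurable h3.ne
  have hcont := hF.continuous
  refine ⟨((hcont.comp_aestronglyMeasurable hu₁.meas).sub
    (hcont.comp_aestronglyMeasurable hv₁.meas)).sub ((hcont.comp_aestronglyMeasurable hu₀.meas).sub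
    (hcont.comp_aestronglyMeasurable hv₀.meas)), by positivity, ?_⟩
  set R : Ω → ℝ≥0∞ := fun ω => 1 + (fracNorm α (u₀ ω) + fracNorm α (v₀ ω) + fracNorm α (u₁ ω) +
    fracNorm α (v₁ ω)) with hR
  set p' : Ω → ℝ≥0∞ := fun ω => fracNorm (-b) (u₁ ω - u₀ ω) + fracNorm (-b) (v₁ ω - v₀ ω) with hp'
  set k' : Ω → ℝ≥0∞ := fun ω => fracNorm b' (u₁ ω - v₁ ω) with hk'
  set g' : Ω → ℝ≥0∞ := fun ω => fracNorm (-a) ((u₁ ω - v₁ ω) - (u₀ ω - v₀ ω)) with hg'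
  have mR : AEStronglyMeasurable R P := aestronglyMeasurable_const.add
    (((hu₀.aemeas.add hv₀.aemeas).add hu₁.aemeas).add hv₁.aemeas)
  have mp : AEStronglyMeasurable p' P := hu.aemeas.add hv.aemeas
  have mpk : AEStronglyMeasurable (fun ω => p' ω * k' ω) P :=
    (mp.aemeasurable.mul hk.aemeas.aemeasurable).aestronglyMeasurable
  have bR : eLpNorm R ((4 * q : ℕ) : ℝ≥0∞) P ≤ ENNReal.ofReal (1 + 4 * M) := by
    have s1 := eLpNorm_add_le hu₀.aemeas hv₀.aemeas hq4
    have s2 := eLpNorm_add_le (hu₀.aemeas.add hv₀.aemeas) hu₁.aemeas hq4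
    have s3 := eLpNorm_add_le ((hu₀.aemeas.add hv₀.aemeas).add hu₁.aemeas) hv₁.aemeas hq4
    have s4 := eLpNorm_add_le (f := fun _ : Ω => (1 : ℝ≥0∞)) aestronglyMeasurable_const
      (((hu₀.aemeas.add hv₀.aemeas).add hu₁.aemeas).add hv₁.aemeas) hq4
    have s0 : eLpNorm (fun _ : Ω => (1 : ℝ≥0∞)) ((4 * q : ℕ) : ℝ≥0∞) P = 1 := by
      rw [eLpNorm_const _ (zero_lt_one.trans_le hq4).ne' (IsProbabilityMeasure.ne_zero P)]
      simp
    have e : ENNReal.ofReal (1 + 4 * M) = 1 + (ENNReal.ofReal M + ENNReal.ofReal M +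
        ENNReal.ofReal M + ENNReal.ofReal M) := by
      rw [← ENNReal.ofReal_add hM hM, ← ENNReal.ofReal_add (by positivity) hM,
        ← ENNReal.ofReal_add (by positivity) hM, ← ENNReal.ofReal_one,
        ← ENNReal.ofReal_add zero_le_one (by positivity)]
      congr 1; ring
    rw [e]
    refine s4.trans (add_le_add s0.le (s3.trans (add_le_add (s2.trans (add_le_add
      (s1.trans (add_le_add hu₀.le hv₀.le)) hu₁.le)) hv₁.le)))
  have bp : eLpNorm p' ((4 * q : ℕ) : ℝ≥0∞) P ≤ ENNReal.ofReal (2 * p) := by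
    rw [two_mul, ENNReal.ofReal_add hp hp]
    exact (eLpNorm_add_le hu.aemeas hv.aemeas hq4).trans (add_le_add hu.le hv.le)
  have up : ∀ {f : Ω → ℝ≥0∞}, AEStronglyMeasurable f P → eLpNorm f ((2 * q : ℕ) : ℝ≥0∞) P ≤
      eLpNorm f ((4 * q : ℕ) : ℝ≥0∞) P := fun hf =>
    eLpNorm_le_eLpNorm_of_exponent_le (by exact_mod_cast (by omega : 2 * q ≤ 4 * q)) hf
  have bpk : eLpNorm (fun ω => p' ω * k' ω) ((2 * q : ℕ) : ℝ≥0∞) P ≤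
      ENNReal.ofReal (2 * p * k) := by
    refine (eLpNorm_mul_le_two_mul (by omega) mp.aemeasurable hk.aemeas.aemeasurable).trans ?_
    rw [← mul_assoc 2 2 q, ENNReal.ofReal_mul (by positivity)]
    exact mul_le_mul' bp hk.le
  have hmain : eLpNorm (fun ω => R ω * (p' ω * k' ω + g' ω)) q P ≤
      ENNReal.ofReal ((1 + 4 * M) * (2 * p * k + g)) := by
    refine (eLpNorm_mul_le_two_mul hq mR.aemeasurable
      (mpk.add hg.aemeas).aemeasurable).trans ?_
    rw [ENNReal.ofReal_mul (by positivity), ENNReal.ofReal_add (by positivity) hg0]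
    refine mul_le_mul' ((up mR).trans bR) ?_
    exact (eLpNorm_add_le mpk hg.aemeas hq2).trans
      (add_le_add bpk ((up hg.aemeas).trans hg.le))
  rw [ENNReal.ofReal_mul C.coe_nonneg, ENNReal.ofReal_coe_nnreal]
  refine le_trans ?_ (mul_le_mul_right hmain _)
  have hae : ∀ᵐ ω ∂P, ‖fracNorm (-a) ((F (u₁ ω) - F (v₁ ω)) - (F (u₀ ω) - F (v₀ ω)))‖ₑ ≤
      C * ‖R ω * (p' ω * k' ω + g' ω)‖ₑ := by
    filter_upwards [fin hu₀, fin hv₀, fin hu₁, fin hv₁] with ω a1 a2 a3 a4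
    simp only [enorm_eq_self]
    exact fracNorm_second_difference_le hF ha hba hb' h1 h2 a1 a2 a3 a4
  have := eLpNorm_le_nnreal_smul_eLpNorm_of_ae_le_mul' hae q
  exact this

/-! ### The fine scheme -/

section Scheme

variable {F : H → H} {W : QWiener P}

lemma expEuler_coe (τ : ℝ≥0) (s : ℝ) (ω : Ω) (u : H) :
    expEuler F W τ s ω u = heat τ u + (τ : ℝ) • heat τ (F u) + W.noise τ s (s + τ) ω := rfl

lemma aestronglyMeasurable_expEuler (hF : Continuous F) (τ : ℝ≥0) (s : ℝ) {u : Ω → H}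
    (hu : AEStronglyMeasurable u P) :
    AEStronglyMeasurable (fun ω => expEuler F W τ s ω (u ω)) P := by
  simp only [expEuler_coe]
  have h1 : AEStronglyMeasurable (fun ω => heat τ (u ω)) P :=
    (heat τ).continuous.comp_aestronglyMeasurable hu
  have h2 : AEStronglyMeasurable (fun ω => heat τ (F (u ω))) P :=
    (heat τ).continuous.comp_aestronglyMeasurable (hF.comp_aestronglyMeasurable hu)
  have h3 : AEStronglyMeasurable (fun ω => (τ : ℝ) • heat τ (F (u ω))) P := h2.const_smul (τ : ℝ)
  exact (h1.add h3).add (aestronglyMeasurable_noise W τ s (s + τ))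

lemma aestronglyMeasurable_fineSteps (hF : Continuous F) (δ : ℝ≥0) (s : ℝ) {u : Ω → H}
    (hu : AEStronglyMeasurable u P) (j : ℕ) :
    AEStronglyMeasurable (fun ω => fineSteps F W δ s ω (u ω) j) P := by
  induction j with
  | zero => exact hu
  | succ j ih => exact aestronglyMeasurable_expEuler hF δ _ ih

lemma fineSteps_eq (δ : ℝ≥0) (s : ℝ) (ω : Ω) (u : H) (j : ℕ) :
    fineSteps F W δ s ω u j =
      heat (j * δ) u + heatConv δ (fun i => F (fineSteps F W δ s ω u i)) j +
        noiseConv W δ s ω j :=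
  variation_of_constants δ (x := fineSteps F W δ s ω u)
    (y := fun i => F (fineSteps F W δ s ω u i))
    (z := fun i => W.noise δ (s + i * δ) (s + i * δ + δ) ω) (fun _ => rfl) j

lemma fineSteps_add (δ s : ℝ) (ω : Ω) (u : H) (m j : ℕ) :
    fineSteps F W δ s ω u (m + j) =
      fineSteps F W δ (s + m * δ) ω (fineSteps F W δ s ω u m) j := by
  induction j with
  | zero => rfl
  | succ j ih =>
    rw [← Nat.add_assoc, fineSteps, ih, fineSteps]
    congr 1
    push_cast; ring

lemma fineSteps_sub_eq (δ : ℝ≥0) (s : ℝ) (ω : Ω) (u v : H) (j : ℕ) :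
    fineSteps F W δ s ω u j - fineSteps F W δ s ω v j =
      heat (j * δ) (u - v) + heatConv δ (fun i =>
        F (fineSteps F W δ s ω u i) - F (fineSteps F W δ s ω v i)) j := by
  rw [heatConv_sub, fineSteps_eq δ s ω u j, fineSteps_eq δ s ω v j, map_sub]
  abel

variable {L : ℝ≥0} (hL : LipschitzWith L F)

include hL in
lemma norm_le_of_lipschitz (u : H) : ‖F u‖ ≤ L * ‖u‖ + ‖F 0‖ := by
  have h1 := hL.norm_sub_le u 0
  rw [sub_zero] at h1
  have h2 := norm_add_le (F u - F 0) (F 0)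
  rw [sub_add_cancel] at h2
  linarith

variable [IsProbabilityMeasure P] {α T : ℝ}

include hL in
lemma exists_fineSteps_moment (h0 : 0 ≤ α) (h1 : α ≤ 1 / 2) (hW : W.hsNorm α < ∞)
    (hT : 0 ≤ T) {q : ℕ} (hq : 1 ≤ q) :
    ∃ C : ℝ, 0 ≤ C ∧ ∀ (δ : ℝ≥0) (s : ℝ) (u : Ω → H) (K : ℝ) (N : ℕ), 0 < δ → 0 ≤ s →
      N * (δ : ℝ) ≤ T → MomentBound P α q u K → ∀ j ≤ N,
      MomentBound P α q (fun ω => fineSteps F W δ s ω (u ω) j) (C * (1 + K)) := by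
  have hG := gronConst_nonneg (T := T) (L := L) (s := α) hT L.2 (by linarith)
  have hn := noiseConst_nonneg (W := W) (α := α) q
  refine ⟨gronConst T L α * (1 + noiseConst W α q + ‖F 0‖), by positivity, ?_⟩
  intro δ s u K N hδ hs hN hu j hj
  have hK := hu.nonneg
  have := MomentBound.gronwall (P := P) (s := α) (T := T) (L := L) (c := ‖F 0‖)
    (D := K + noiseConst W α q) hq h0 (by linarith) L.2 (norm_nonneg _) (by positivity) hδ
    (J := 1) (N := N) le_rfl (by simpa using hN)
    (X := fun j ω => fineSteps F W δ s ω (u ω) j)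
    (Z := fun j ω => heat (j * δ) (u ω) + noiseConv W δ s ω j)
    (A := fun i ω => F (fineSteps F W δ s ω (u ω) i)) ?_ ?_ ?_ ?_ j hj
  · refine this.mono_const ?_
    rw [mul_assoc]
    gcongr
    nlinarith [mul_nonneg hK (add_nonneg hn (norm_nonneg (F 0)))]
  · intro n _ ω
    simp only [mul_one]
    rw [fineSteps_eq]; abel
  · exact fun i => hL.continuous.comp_aestronglyMeasurable
      (aestronglyMeasurable_fineSteps hL.continuous δ s hu.meas i)
  · intro i _ ω
    rw [Nat.div_one]
    exact norm_le_of_lipschitz hL _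
  · intro n _
    refine (hu.heat_self _).add ?_ hq
    have := momentBound_noiseConv h0 h1 hW hq (le_refl α) (by norm_num) hδ hs n
    simpa using this

include hL in
-- Time regularity in a negative norm. The semigroup acting on the start and the stochastic
-- convolution both contribute order $\alpha-\beta$; the drift contributes order $1$, which is no
-- worse because $N\delta\le1$.
lemma exists_fineSteps_sub_start (h0 : 0 < α) (h1 : α ≤ 1 / 2) (hW : W.hsNorm α < ∞)
    (hT : 0 ≤ T) {q : ℕ} (hq : 1 ≤ q) {β : ℝ} (hβ : β ≤ 0) (hβ' : α - β ≤ 1 / 2) :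
    ∃ C : ℝ, 0 ≤ C ∧ ∀ (δ : ℝ≥0) (s : ℝ) (u : Ω → H) (K : ℝ) (N : ℕ), 0 < δ → 0 ≤ s →
      N * (δ : ℝ) ≤ T → N * (δ : ℝ) ≤ 1 → MomentBound P α q u K → ∀ j ≤ N,
      MomentBound P β q (fun ω => fineSteps F W δ s ω (u ω) j - u ω)
        (C * (1 + K) * (N * δ : ℝ) ^ (α - β)) := by
  obtain ⟨C, hC, hfs⟩ := exists_fineSteps_moment (W := W) hL h0.le h1 hW hT hq
  have hn := noiseConst_nonneg (W := W) (α := α) q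
  refine ⟨1 + (L * C + ‖F 0‖) + noiseConst W α q, by positivity, ?_⟩
  intro δ s u K N hδ hs hN hN1 hu j hj
  have hK := hu.nonneg
  have hjN : (j : ℝ) * δ ≤ N * δ := by
    have : (j : ℝ) ≤ N := by exact_mod_cast hj
    gcongr
  have hpow : ((j : ℝ) * δ) ^ (α - β) ≤ (N * δ : ℝ) ^ (α - β) :=
    Real.rpow_le_rpow (by positivity) hjN (by linarith)
  have hlin : (j : ℝ) * δ ≤ (N * δ : ℝ) ^ (α - β) := by
    refine hjN.trans ?_
    calc (N * δ : ℝ) = (N * δ : ℝ) ^ (1 : ℝ) := (Real.rpow_one _).symm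
      _ ≤ _ := Real.rpow_le_rpow_of_exponent_ge' (by positivity) hN1 (by linarith) (by linarith)
  have a1 := hu.heat_sub_self (s := β) (by linarith) (by linarith) (j * δ)
  have a2 := MomentBound.heatConv_self (s := 0) (T := j * δ) (K := L * (C * (1 + K)) + ‖F 0‖) hq hδ
    (N := j) le_rfl (by positivity) (Y := fun i ω => F (fineSteps F W δ s ω (u ω) i))
    (fun i hi => ((hfs δ s u K N hδ hs hN hu i (by omega)).mono_norm h0.le).of_norm_le hq L.2
      (norm_nonneg _) (hL.continuous.comp_aestronglyMeasurable
        (aestronglyMeasurable_fineSteps hL.continuous δ s hu.meas i))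
      fun ω => norm_le_of_lipschitz hL _)
  have a3 := momentBound_noiseConv h0.le h1 hW hq (by linarith : β ≤ α) hβ' hδ hs j
  have a := (a1.add (a2.mono_norm hβ) hq).add a3 hq
  have e : (fun ω => heat (j * δ) (u ω) - u ω +
      heatConv δ (fun i => F (fineSteps F W δ s ω (u ω) i)) j + noiseConv W δ s ω j) =
      fun ω => fineSteps F W δ s ω (u ω) j - u ω := by
    ext1 ω
    rw [fineSteps_eq δ s ω (u ω) j]; abel
  rw [e] at a
  refine a.mono_const ?_
  set X := (N * δ : ℝ) ^ (α - β) with hX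
  have hX0 : 0 ≤ X := by positivity
  have b1 : ((j * δ : ℝ≥0) : ℝ) ^ (α - β) * K ≤ X * (1 + K) := by
    push_cast
    gcongr
    linarith
  have b2 : (j * δ : ℝ) * (L * (C * (1 + K)) + ‖F 0‖) ≤ X * ((L * C + ‖F 0‖) * (1 + K)) := by
    gcongr
    nlinarith [mul_nonneg (norm_nonneg (F 0)) hK]
  have b3 : noiseConst W α q * (j * δ : ℝ) ^ (α - β) ≤ noiseConst W α q * (X * (1 + K)) := by
    gcongr
    refine hpow.trans ?_
    nlinarith [mul_nonneg hX0 hK]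
  calc _ ≤ X * (1 + K) + X * ((L * C + ‖F 0‖) * (1 + K)) + noiseConst W α q * (X * (1 + K)) :=
        add_le_add (add_le_add b1 b2) b3
    _ = _ := by ring

include hL in
-- Both trajectories see the same noise, which cancels; the Gronwall inequality applies with $J=1$
-- and no inhomogeneity.
lemma exists_fineSteps_sub_fineSteps (hT : 0 ≤ T) {q : ℕ} (hq : 1 ≤ q) {β : ℝ} (hβ : 0 ≤ β)
    (hβ' : β < 1) :
    ∃ C : ℝ, 0 ≤ C ∧ ∀ (δ : ℝ≥0) (s : ℝ) (u v : Ω → H) (K : ℝ) (N : ℕ), 0 < δ →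
      N * (δ : ℝ) ≤ T → AEStronglyMeasurable u P → AEStronglyMeasurable v P →
      MomentBound P β q (fun ω => u ω - v ω) K → ∀ j ≤ N,
      MomentBound P β q (fun ω => fineSteps F W δ s ω (u ω) j - fineSteps F W δ s ω (v ω) j)
        (C * K) := by
  refine ⟨gronConst T L β, gronConst_nonneg hT L.2 hβ', ?_⟩
  intro δ s u v K N hδ hN hu hv huv j hj
  have := MomentBound.gronwall (P := P) (s := β) (T := T) (L := L) (c := 0)
    (D := K) hq hβ hβ' L.2 le_rfl huv.nonneg hδ (J := 1) (N := N) le_rfl (by simpa using hN)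
    (X := fun j ω => fineSteps F W δ s ω (u ω) j - fineSteps F W δ s ω (v ω) j)
    (Z := fun j ω => heat (j * δ) (u ω - v ω))
    (A := fun i ω => F (fineSteps F W δ s ω (u ω) i) - F (fineSteps F W δ s ω (v ω) i))
    ?_ ?_ ?_ ?_ j hj
  · simpa using this
  · intro n _ ω
    simp only [mul_one]
    rw [fineSteps_sub_eq]
  · exact fun i => (hL.continuous.comp_aestronglyMeasurable
      (aestronglyMeasurable_fineSteps hL.continuous δ s hu i)).sub
      (hL.continuous.comp_aestronglyMeasurable
      (aestronglyMeasurable_fineSteps hL.continuous δ s hv i))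
  · intro i _ ω
    rw [Nat.div_one, add_zero]
    exact hL.norm_sub_le _ _
  · exact fun n _ => huv.heat_self _

include hL in
-- With the noise cancelled, the increment of the difference has order $\beta+a$ up to $1$, and
-- stays proportional to the initial distance.
lemma exists_fineSteps_sub_fineSteps_sub (hT : 0 ≤ T) {q : ℕ} (hq : 1 ≤ q) {β a : ℝ} (hβ : 0 ≤ β)
    (hβ' : β < 1) (ha : 0 ≤ a) (hab : β + a ≤ 1) :
    ∃ C : ℝ, 0 ≤ C ∧ ∀ (δ : ℝ≥0) (s : ℝ) (u v : Ω → H) (K : ℝ) (N : ℕ), 0 < δ →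
      N * (δ : ℝ) ≤ T → N * (δ : ℝ) ≤ 1 → AEStronglyMeasurable u P → AEStronglyMeasurable v P →
      MomentBound P β q (fun ω => u ω - v ω) K → ∀ j ≤ N,
      MomentBound P (-a) q (fun ω => (fineSteps F W δ s ω (u ω) j - fineSteps F W δ s ω (v ω) j) -
        (u ω - v ω)) (C * (N * δ : ℝ) ^ (β + a) * K) := by
  obtain ⟨C, hC, hfs⟩ := exists_fineSteps_sub_fineSteps (W := W) hL hT hq hβ hβ'
  refine ⟨1 + L * C, by positivity, ?_⟩
  intro δ s u v K N hδ hN hN1 hu hv huv j hj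
  have hK := huv.nonneg
  have hjN : (j : ℝ) * δ ≤ N * δ := by
    have : (j : ℝ) ≤ N := by exact_mod_cast hj
    gcongr
  have hpow : ((j : ℝ) * δ) ^ (β + a) ≤ (N * δ : ℝ) ^ (β + a) :=
    Real.rpow_le_rpow (by positivity) hjN (by linarith)
  have hlin : (j : ℝ) * δ ≤ (N * δ : ℝ) ^ (β + a) := by
    refine hjN.trans ?_
    calc (N * δ : ℝ) = (N * δ : ℝ) ^ (1 : ℝ) := (Real.rpow_one _).symm
      _ ≤ _ := Real.rpow_le_rpow_of_exponent_ge' (by positivity) hN1 (by linarith) hab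
  have a1 := huv.heat_sub_self (s := -a) (by linarith) (by linarith) (j * δ)
  have a2 := MomentBound.heatConv_self (s := 0) (T := j * δ) (K := L * (C * K) + 0) hq hδ
    (N := j) le_rfl (by positivity)
    (Y := fun i ω => F (fineSteps F W δ s ω (u ω) i) - F (fineSteps F W δ s ω (v ω) i))
    (fun i hi => ((hfs δ s u v K N hδ hN hu hv huv i (by omega)).mono_norm hβ).of_norm_le hq L.2
      le_rfl ((hL.continuous.comp_aestronglyMeasurable
      (aestronglyMeasurable_fineSteps hL.continuous δ s hu i)).sub
      (hL.continuous.comp_aestronglyMeasurable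
      (aestronglyMeasurable_fineSteps hL.continuous δ s hv i)))
      fun ω => by rw [add_zero]; exact hL.norm_sub_le _ _)
  have h := a1.add (a2.mono_norm (neg_nonpos.2 ha)) hq
  have e : (fun ω => heat (j * δ) (u ω - v ω) - (u ω - v ω) +
      heatConv δ (fun i => F (fineSteps F W δ s ω (u ω) i) -
        F (fineSteps F W δ s ω (v ω) i)) j) =
      fun ω => (fineSteps F W δ s ω (u ω) j - fineSteps F W δ s ω (v ω) j) - (u ω - v ω) := by
    ext1 ω
    rw [fineSteps_sub_eq δ s ω (u ω) (v ω) j]; abel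
  rw [e] at h
  refine h.mono_const ?_
  set X := (N * δ : ℝ) ^ (β + a) with hX
  have hX0 : 0 ≤ X := by positivity
  have e2 : β - -a = β + a := by ring
  rw [e2, add_zero]
  have b1 : ((j * δ : ℝ≥0) : ℝ) ^ (β + a) * K ≤ X * K := by
    push_cast
    gcongr
  have b2 : (j * δ : ℝ) * (L * (C * K)) ≤ X * (L * (C * K)) := by
    gcongr
  calc _ ≤ X * K + X * (L * (C * K)) := add_le_add b1 b2
    _ = _ := by ring

end Scheme

/-! ### Representation of the error -/

section Error

variable {F : H → H} {W : QWiener P}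

variable (F W) in
/-- The parareal iterates as random variables, for `ΔT = J δ`. -/
def iterate (u₀ : H) (δ : ℝ≥0) (J k n : ℕ) (ω : Ω) : H :=
  parareal (coarse F W (J * δ) ω) (fine F W (J * δ) J ω) u₀ k n

variable (F W) in
/-- The reference solution on the fine grid. -/
def refPath (u₀ : H) (δ : ℝ≥0) (i : ℕ) (ω : Ω) : H := fineSteps F W δ 0 ω u₀ i

variable (F W) in
/-- The fine trajectories started from `X m` at the coarse times `m J δ`, indexed by the fine
grid. -/
def restarted (δ : ℝ≥0) (J : ℕ) (X : ℕ → Ω → H) (i : ℕ) (ω : Ω) : H :=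
  fineSteps F W δ ((i / J : ℕ) * (J * δ)) ω (X (i / J) ω) (i % J)

lemma fine_eq (δ : ℝ≥0) {J : ℕ} (hJ : 1 ≤ J) (ω : Ω) (n : ℕ) (u : H) :
    fine F W (J * δ) J ω n u = fineSteps F W δ (n * (J * δ)) ω u J := by
  have : (J : ℝ) ≠ 0 := by exact_mod_cast (by omega : J ≠ 0)
  rw [fine, mul_div_cancel_left₀ _ this]

lemma refPath_add (u₀ : H) (δ : ℝ≥0) (J n j : ℕ) (ω : Ω) :
    refPath F W u₀ δ (n * J + j) ω =
      fineSteps F W δ (n * (J * δ)) ω (refPath F W u₀ δ (n * J) ω) j := by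
  rw [refPath, fineSteps_add, refPath]
  congr 1
  push_cast; ring

lemma reference_eq (u₀ : H) (δ : ℝ≥0) {J : ℕ} (hJ : 1 ≤ J) (ω : Ω) (n : ℕ) :
    reference (fine F W (J * δ) J ω) u₀ n = refPath F W u₀ δ (n * J) ω := by
  induction n with
  | zero => rw [Nat.zero_mul]; rfl
  | succ n ih => rw [reference, ih, Nat.succ_mul, refPath_add, fine_eq δ hJ]

lemma restarted_add (δ : ℝ≥0) {J : ℕ} (X : ℕ → Ω → H) (n : ℕ) {j : ℕ} (hj : j < J) (ω : Ω) :
    restarted F W δ J X (n * J + j) ω = fineSteps F W δ (n * (J * δ)) ω (X n ω) j := by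
  rw [restarted, Nat.add_comm (n * J) j, Nat.add_mul_mod_self_right, Nat.mod_eq_of_lt hj,
    Nat.add_mul_div_right _ _ (by omega), Nat.div_eq_of_lt hj, Nat.zero_add]

/-- The coarse run is itself an exponential Euler path with step $J\delta$, so every estimate for
`fineSteps` covers it. -/
lemma iterate_zero (u₀ : H) (δ : ℝ≥0) (J n : ℕ) (ω : Ω) :
    iterate F W u₀ δ J 0 n ω = fineSteps F W (J * δ : ℝ≥0) 0 ω u₀ n := by
  induction n with
  | zero => simp [iterate, parareal, fineSteps]
  | succ n ih =>
    rw [iterate, parareal, fineSteps, ← ih, coarse, iterate]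
    push_cast
    rw [zero_add]

lemma iterate_start (u₀ : H) (δ : ℝ≥0) (J k : ℕ) (ω : Ω) :
    iterate F W u₀ δ J k 0 ω = u₀ := by
  cases k <;> rfl

lemma error_eq (u₀ : H) (δ : ℝ≥0) {J : ℕ} (hJ : 1 ≤ J) (k n : ℕ) (ω : Ω) :
    error F W u₀ (J * δ) J k n ω =
      iterate F W u₀ δ J k n ω - refPath F W u₀ δ (n * J) ω := by
  rw [error, reference_eq u₀ δ hJ, iterate]

/-- The initial datum is propagated identically by both schemes; only the drift and noise
comparisons remain. -/
lemma error_zero_eq (u₀ : H) (δ : ℝ≥0) {J : ℕ} (hJ : 1 ≤ J) (n : ℕ) (ω : Ω) :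
    iterate F W u₀ δ J 0 n ω - refPath F W u₀ δ (n * J) ω =
      heatConv δ (fun i => heat ((i % J : ℕ) * δ) (F (iterate F W u₀ δ J 0 (i / J) ω)) -
        F (refPath F W u₀ δ i ω)) (n * J) +
      (noiseConv W (J * δ) 0 ω n - noiseConv W δ 0 ω (n * J)) := by
  have e1 : iterate F W u₀ δ J 0 n ω = heat ((n * J : ℕ) * δ) u₀ +
      heatConv δ (fun i => heat ((i % J : ℕ) * δ) (F (iterate F W u₀ δ J 0 (i / J) ω))) (n * J) +
      noiseConv W (J * δ) 0 ω n := by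
    rw [iterate_zero, fineSteps_eq, heatConv_block δ hJ]
    simp_rw [iterate_zero]
    congr 3
    push_cast; ring_nf
  rw [e1, refPath, fineSteps_eq, heatConv_sub]
  simp only [refPath]
  abel

/-- The first summand depends on the current error and is left to Gronwall. The rest is the residual
driven by iteration $k$; the noise has cancelled. -/
lemma error_succ_eq (u₀ : H) (δ : ℝ≥0) {J : ℕ} (hJ : 1 ≤ J) (k n : ℕ) (ω : Ω) :
    iterate F W u₀ δ J (k + 1) n ω - refPath F W u₀ δ (n * J) ω =
      heatConv δ (fun i =>
        heat ((i % J : ℕ) * δ) (F (iterate F W u₀ δ J (k + 1) (i / J) ω) -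
          F (refPath F W u₀ δ (i / J * J) ω)) +
        ((F (restarted F W δ J (iterate F W u₀ δ J k) i ω) - F (refPath F W u₀ δ i ω)) -
          heat ((i % J : ℕ) * δ) (F (iterate F W u₀ δ J k (i / J) ω) -
            F (refPath F W u₀ δ (i / J * J) ω)))) (n * J) := by
  refine block_variation_of_constants δ J
    (e := fun n => iterate F W u₀ δ J (k + 1) n ω - refPath F W u₀ δ (n * J) ω) ?_ ?_ n
  · show iterate F W u₀ δ J (k + 1) 0 ω - refPath F W u₀ δ (0 * J) ω = 0
    rw [Nat.zero_mul, iterate_start, refPath, fineSteps, sub_self]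
  · intro n
    set v := refPath F W u₀ δ (n * J) ω with hv
    set x := iterate F W u₀ δ J k n ω with hx
    set y := iterate F W u₀ δ J (k + 1) n ω with hy
    have e1 : iterate F W u₀ δ J (k + 1) (n + 1) ω = coarse F W (J * δ) ω n y +
        fine F W (J * δ) J ω n x - coarse F W (J * δ) ω n x := rfl
    have e2 : ∀ z, coarse F W (J * δ) ω n z = heat (J * δ) z + (J * δ : ℝ) • heat (J * δ) (F z) +
        W.noise (J * δ) (n * (J * δ)) (n * (J * δ) + J * δ) ω := fun z => by
      have := expEuler_coe (F := F) (W := W) (J * δ) (n * (J * δ)) ω z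
      push_cast at this
      exact this
    have e3 : refPath F W u₀ δ ((n + 1) * J) ω = fineSteps F W δ (n * (J * δ)) ω v J := by
      rw [Nat.succ_mul, refPath_add]
    have e4 : heatConv δ (fun j =>
        heat (((n * J + j) % J : ℕ) * δ) (F (iterate F W u₀ δ J (k + 1) ((n * J + j) / J) ω) -
          F (refPath F W u₀ δ ((n * J + j) / J * J) ω)) +
        ((F (restarted F W δ J (iterate F W u₀ δ J k) (n * J + j) ω) -
          F (refPath F W u₀ δ (n * J + j) ω)) -
          heat (((n * J + j) % J : ℕ) * δ) (F (iterate F W u₀ δ J k ((n * J + j) / J) ω) -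
            F (refPath F W u₀ δ ((n * J + j) / J * J) ω)))) J =
        heatConv δ (fun j => heat (j * δ) (F y - F v) +
        ((F (fineSteps F W δ (n * (J * δ)) ω x j) - F (fineSteps F W δ (n * (J * δ)) ω v j)) -
          heat (j * δ) (F x - F v))) J := by
      refine Finset.sum_congr rfl fun j hj => ?_
      have hj' := Finset.mem_range.1 hj
      beta_reduce
      rw [restarted_add δ _ n hj', refPath_add, Nat.add_comm (n * J) j,
        Nat.add_mul_mod_self_right, Nat.mod_eq_of_lt hj', Nat.add_mul_div_right _ _ (by omega),
        Nat.div_eq_of_lt hj', Nat.zero_add]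
    rw [e1, e2, e2, fine_eq δ hJ, e3, e4, heatConv_add_fun, heatConv_sub, heatConv_const,
      heatConv_const]
    have e5 := fineSteps_sub_eq (F := F) (W := W) δ (n * (J * δ)) ω x v J
    -- Isolates the drift convolution, which turns the target into an identity between fine and
    -- coarse differences.
    rw [← sub_eq_iff_eq_add'] at e5
    rw [← e5]
    simp only [map_sub, smul_sub]
    abel

variable {L : ℝ≥0}

lemma aestronglyMeasurable_iterate (hF : Continuous F) (u₀ : H) (δ : ℝ≥0) {J : ℕ} (hJ : 1 ≤ J)
    (k n : ℕ) : AEStronglyMeasurable (iterate F W u₀ δ J k n) P := by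
  have hc : ∀ (n : ℕ) {u : Ω → H}, AEStronglyMeasurable u P →
      AEStronglyMeasurable (fun ω => coarse F W (J * δ) ω n (u ω)) P := fun n u hu => by
    have := aestronglyMeasurable_expEuler (W := W) hF (J * δ) (n * (J * δ)) hu
    push_cast at this
    exact this
  have hf : ∀ (n : ℕ) {u : Ω → H}, AEStronglyMeasurable u P →
      AEStronglyMeasurable (fun ω => fine F W (J * δ) J ω n (u ω)) P := fun n u hu => by
    simp only [fine_eq δ hJ]
    exact aestronglyMeasurable_fineSteps hF δ _ hu J
  induction k generalizing n with
  | zero =>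
    induction n with
    | zero => exact aestronglyMeasurable_const
    | succ n ih => exact hc n ih
  | succ k ihk =>
    induction n with
    | zero => exact aestronglyMeasurable_const
    | succ n ih => exact ((hc n ih).add (hf n (ihk n))).sub (hc n (ihk n))

lemma aestronglyMeasurable_refPath (hF : Continuous F) (u₀ : H) (δ : ℝ≥0) (i : ℕ) :
    AEStronglyMeasurable (refPath F W u₀ δ i) P :=
  aestronglyMeasurable_fineSteps hF δ 0 aestronglyMeasurable_const i

variable (hL : LipschitzWith L F) [IsProbabilityMeasure P] {T : ℝ}

include hL in
/-- Propagation of a bound of the local residuals to the error. -/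
lemma exists_error_propagation (hT : 0 ≤ T) {q : ℕ} (hq : 1 ≤ q) {β r : ℝ} (hβ : 0 ≤ β)
    (hβ' : β < 1) (hr : 0 ≤ r) (hβr : β + r < 1) :
    ∃ C : ℝ, 0 ≤ C ∧ ∀ (δ : ℝ≥0) (J N : ℕ) (e x y : ℕ → Ω → H) (B : ℕ → Ω → H) (Z : ℕ → Ω → H)
      (K : ℝ), 0 < δ → 1 ≤ J → (N * J : ℕ) * (δ : ℝ) ≤ T → 0 ≤ K →
      (∀ n, AEStronglyMeasurable (x n) P) → (∀ n, AEStronglyMeasurable (y n) P) →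
      (∀ n ω, e n ω = x n ω - y n ω) →
      (∀ n ω, e n ω = heatConv δ (fun i => heat ((i % J : ℕ) * δ) (F (x (i / J) ω) -
        F (y (i / J) ω)) + B i ω) (n * J) + Z n ω) →
      (∀ i < N * J, MomentBound P (-r) q (B i) K) →
      (∀ n ≤ N, MomentBound P β q (Z n) K) →
      ∀ n ≤ N, MomentBound P β q (e n) (C * K) := by
  have hS := singConst_nonneg (T := T) hT hβr
  refine ⟨gronConst T L β * (singConst T (β + r) + 1),
    mul_nonneg (gronConst_nonneg hT L.2 hβ') (by positivity), ?_⟩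
  intro δ J N e x y B Z K hδ hJ hN hK hx hy he heq hB hZ n hn
  -- The convolution of `B` joins the inhomogeneity: smoothing from order $-r$ to $\beta$ costs
  -- `singConst T (β + r)`.
  have := MomentBound.gronwall (P := P) (s := β) (T := T) (L := L) (c := 0)
    (D := singConst T (β + r) * K + K) hq hβ hβ' L.2 le_rfl (by positivity) hδ hJ hN
    (X := e) (Z := fun n ω => heatConv δ (fun i => B i ω) (n * J) + Z n ω)
    (A := fun i ω => heat ((i % J : ℕ) * δ) (F (x (i / J) ω) - F (y (i / J) ω)))
    ?_ ?_ ?_ ?_ n hn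
  · refine this.mono_const (le_of_eq ?_)
    ring
  · intro n _ ω
    rw [heq, heatConv_add_fun]; abel
  · exact fun i => (heat _).continuous.comp_aestronglyMeasurable
      ((hL.continuous.comp_aestronglyMeasurable (hx _)).sub
        (hL.continuous.comp_aestronglyMeasurable (hy _)))
  · intro i _ ω
    rw [add_zero, he]
    have h1 := fracNorm_heat_self_le 0 ((i % J : ℕ) * δ) (F (x (i / J) ω) - F (y (i / J) ω))
    rw [fracNorm_zero, fracNorm_zero, enorm_le_iff_norm_le] at h1
    exact h1.trans (hL.norm_sub_le _ _)
  · intro n hn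
    refine MomentBound.add ?_ (hZ n hn) hq
    have hnJ : (n * J : ℕ) * (δ : ℝ) ≤ T := by
      refine le_trans ?_ hN
      have : ((n * J : ℕ) : ℝ) ≤ (N * J : ℕ) := by exact_mod_cast Nat.mul_le_mul_right J hn
      gcongr
    have := MomentBound.heatConv (s := β) (r := -r) hq (by linarith) (by linarith) hδ hnJ hK
      (Y := B) (fun i hi => hB i (hi.trans_le (Nat.mul_le_mul_right J hn)))
    rwa [sub_neg_eq_add] at this

end Error

/-! ### Moment bounds for the iterates and convergence of the parareal algorithm -/

section Convergence

variable {F : H → H} {W : QWiener P} {L : ℝ≥0} (hL : LipschitzWith L F) [IsProbabilityMeasure P]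
  {α T : ℝ} {u₀ : H}

lemma MomentBound.lipschitz (hL : LipschitzWith L F) {q : ℕ} (hq : 1 ≤ q) {β K : ℝ} (hβ : 0 ≤ β)
    {X : Ω → H} (hX : MomentBound P β q X K) :
    MomentBound P 0 q (fun ω => F (X ω)) (L * K + ‖F 0‖) :=
  (hX.mono_norm hβ).of_norm_le hq L.2 (norm_nonneg _)
    (hL.continuous.comp_aestronglyMeasurable hX.meas) fun _ => norm_le_of_lipschitz hL _

lemma MomentBound.lipschitz_sub (hL : LipschitzWith L F) {q : ℕ} (hq : 1 ≤ q) {β K : ℝ}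
    (hβ : 0 ≤ β) {X Y : Ω → H} (hX : AEStronglyMeasurable X P) (hY : AEStronglyMeasurable Y P)
    (h : MomentBound P β q (fun ω => X ω - Y ω) K) :
    MomentBound P 0 q (fun ω => F (X ω) - F (Y ω)) (L * K) := by
  have := (h.mono_norm hβ).of_norm_le hq L.2 le_rfl
    ((hL.continuous.comp_aestronglyMeasurable hX).sub (hL.continuous.comp_aestronglyMeasurable hY))
    fun ω => (hL.norm_sub_le (X ω) (Y ω)).trans_eq (add_zero _).symm
  rwa [add_zero] at this

lemma natCast_mul_le_of_le {δ : ℝ≥0} {M N : ℕ} (hN : N * (δ : ℝ) ≤ T) (h : M ≤ N) :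
    M * (δ : ℝ) ≤ T := by
  refine le_trans ?_ hN
  have : (M : ℝ) ≤ N := by exact_mod_cast h
  gcongr

include hL in
lemma exists_refPath_moment (h0 : 0 ≤ α) (h1 : α ≤ 1 / 2) (hW : W.hsNorm α < ∞)
    (hT : 0 ≤ T) (hu₀ : fracNorm α u₀ < ∞) {q : ℕ} (hq : 1 ≤ q) :
    ∃ C : ℝ, 0 ≤ C ∧ ∀ (δ : ℝ≥0) (N : ℕ), 0 < δ → N * (δ : ℝ) ≤ T → ∀ j ≤ N,
      MomentBound P α q (refPath F W u₀ δ j) C := by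
  obtain ⟨C, hC, hfs⟩ := exists_fineSteps_moment (W := W) hL h0 h1 hW hT hq
  exact ⟨C * (1 + (fracNorm α u₀).toReal), by positivity, fun δ N hδ hN j hj =>
    hfs δ 0 (fun _ => u₀) _ N hδ le_rfl hN (.const hu₀ hq) j hj⟩

include hL in
-- No smallness is needed here: the residuals are bounded crudely in $H$, hence $r=0$, and the
-- reference solution is added back to the error.
lemma exists_iterate_moment (h0 : 0 ≤ α) (h1 : α < 1 / 2) (hW : W.hsNorm α < ∞)
    (hT : 0 ≤ T) (hu₀ : fracNorm α u₀ < ∞) {q : ℕ} (hq : 1 ≤ q) (k : ℕ) :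
    ∃ C : ℝ, 0 ≤ C ∧ ∀ (δ : ℝ≥0) (J N : ℕ), 0 < δ → 1 ≤ J → (N * J : ℕ) * (δ : ℝ) ≤ T →
      ∀ n ≤ N, MomentBound P α q (iterate F W u₀ δ J k n) C := by
  obtain ⟨C₁, hC₁, href⟩ := exists_refPath_moment (W := W) hL h0 h1.le hW hT hu₀ hq
  induction k with
  | zero =>
    refine ⟨C₁, hC₁, fun δ J N hδ hJ hN n hn => ?_⟩
    have e : iterate F W u₀ δ J 0 n = refPath F W u₀ (J * δ) n := by
      ext1 ω; rw [iterate_zero, refPath]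
    rw [e]
    refine href (J * δ) N (mul_pos (by exact_mod_cast hJ) hδ) ?_ n hn
    push_cast at hN ⊢
    linarith
  | succ k ih =>
    obtain ⟨C₂, hC₂, hit⟩ := ih
    obtain ⟨C₃, hC₃, hfs⟩ := exists_fineSteps_moment (W := W) hL h0 h1.le hW hT hq
    obtain ⟨C₄, hC₄, hprop⟩ := exists_error_propagation (P := P) hL hT hq (β := α) (r := 0) h0
      (by linarith) le_rfl (by linarith)
    refine ⟨C₄ * (L * (C₃ * (1 + C₂)) + ‖F 0‖ + (L * C₁ + ‖F 0‖) +
      (L * C₂ + ‖F 0‖ + (L * C₁ + ‖F 0‖))) + C₁, by positivity, fun δ J N hδ hJ hN n hn => ?_⟩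
    have hr : ∀ i ≤ N * J, MomentBound P α q (refPath F W u₀ δ i) C₁ := href δ _ hδ hN
    have key := hprop δ J N
      (fun n ω => iterate F W u₀ δ J (k + 1) n ω - refPath F W u₀ δ (n * J) ω)
      (iterate F W u₀ δ J (k + 1)) (fun n => refPath F W u₀ δ (n * J))
      (fun i ω => (F (restarted F W δ J (iterate F W u₀ δ J k) i ω) - F (refPath F W u₀ δ i ω)) -
          heat ((i % J : ℕ) * δ) (F (iterate F W u₀ δ J k (i / J) ω) -
            F (refPath F W u₀ δ (i / J * J) ω))) (fun _ _ => 0)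
      (L * (C₃ * (1 + C₂)) + ‖F 0‖ + (L * C₁ + ‖F 0‖) +
        (L * C₂ + ‖F 0‖ + (L * C₁ + ‖F 0‖))) hδ hJ hN (by positivity)
      (aestronglyMeasurable_iterate hL.continuous u₀ δ hJ _)
      (fun n => aestronglyMeasurable_refPath hL.continuous u₀ δ _) (fun _ _ => rfl)
      (fun n ω => by rw [add_zero]; exact error_succ_eq u₀ δ hJ k n ω) ?_
      (fun _ _ => MomentBound.zero.mono_const (by positivity)) n hn
    · have := key.add (hr (n * J) (Nat.mul_le_mul_right J hn)) hq
      simpa only [sub_add_cancel] using this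
    · intro i hi
      have hm : i / J < N := Nat.div_lt_of_lt_mul (by rwa [Nat.mul_comm])
      have hJ1 : J ≤ N * J := Nat.le_mul_of_pos_left J ((Nat.zero_le _).trans_lt hm)
      rw [neg_zero]
      have b1 : MomentBound P α q (restarted F W δ J (iterate F W u₀ δ J k) i) (C₃ * (1 + C₂)) :=
        hfs δ ((i / J : ℕ) * (J * δ)) _ C₂ J hδ (by positivity) (natCast_mul_le_of_le hN hJ1)
          (hit δ J N hδ hJ hN (i / J) hm.le) _ (Nat.mod_lt _ hJ).le
      refine ((b1.lipschitz hL hq h0).sub ((hr i hi.le).lipschitz hL hq h0) hq).sub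
        (MomentBound.heat_self (((hit δ J N hδ hJ hN (i / J) hm.le).lipschitz hL hq h0).sub
          ((hr (i / J * J) ?_).lipschitz hL hq h0) hq) _) hq
      exact Nat.mul_le_mul_right J hm.le

include hL in
/-- Error of the coarse scheme. -/
lemma exists_error_zero_bound (h0 : 0 < α) (h1 : α < 1 / 2) (hW : W.hsNorm α < ∞)
    (hT : 0 ≤ T) (hu₀ : fracNorm α u₀ < ∞) {q : ℕ} (hq : 1 ≤ q) {β : ℝ} (hβ : 0 ≤ β)
    (hβα : β ≤ α) :
    ∃ C : ℝ, 0 ≤ C ∧ ∀ (δ : ℝ≥0) (J N : ℕ), 0 < δ → 1 ≤ J → J * (δ : ℝ) ≤ 1 →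
      (N * J : ℕ) * (δ : ℝ) ≤ T → ∀ n ≤ N,
      MomentBound P β q (fun ω => iterate F W u₀ δ J 0 n ω - refPath F W u₀ δ (n * J) ω)
        (C * (J * δ : ℝ) ^ (α - β)) := by
  obtain ⟨C₁, hC₁, href⟩ := exists_refPath_moment (W := W) hL h0.le h1.le hW hT hu₀ hq
  obtain ⟨C₂, hC₂, hinc⟩ := exists_fineSteps_sub_start (W := W) hL h0 h1.le hW hT hq (β := 0)
    le_rfl (by linarith)
  -- Giving up $r=\frac12$ turns $e^{j\delta A}-1$ acting on $F$ into $\Delta T^{1/2}$, which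
  -- suffices as $\alpha<\frac12$; and $\beta+\frac12<1$.
  obtain ⟨C₃, hC₃, hprop⟩ := exists_error_propagation (P := P) hL hT hq (β := β) (r := 1 / 2) hβ
      (by linarith) (by norm_num) (by linarith)
  have hn := noiseConst_nonneg (W := W) (α := α) q
  set K := L * (C₂ * (1 + C₁)) + (L * C₁ + ‖F 0‖) + noiseConst W α q with hK
  have hK0 : 0 ≤ K := by positivity
  refine ⟨C₃ * K, by positivity, fun δ J N hδ hJ hJ1 hN n hn' => ?_⟩
  have hδ' : (0 : ℝ) < δ := hδ
  have hJ' : (0 : ℝ) < J := by exact_mod_cast hJ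
  set X := (J * δ : ℝ) ^ (α - β) with hX
  have hX0 : 0 ≤ X := by positivity
  have hpow : ∀ {x : ℝ}, α - β ≤ x → (J * δ : ℝ) ^ x ≤ X := fun hx =>
    Real.rpow_le_rpow_of_exponent_ge (by positivity) hJ1 hx
  have hr : ∀ i ≤ N * J, MomentBound P α q (refPath F W u₀ δ i) C₁ := href δ _ hδ hN
  have hmeas := fun i => aestronglyMeasurable_refPath (W := W) hL.continuous u₀ δ i
  rw [mul_assoc]
  refine hprop δ J N
    (fun n ω => iterate F W u₀ δ J 0 n ω - refPath F W u₀ δ (n * J) ω)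
    (iterate F W u₀ δ J 0) (fun n => refPath F W u₀ δ (n * J))
    -- The local residual is the time increment of the reference path under $F$, plus the defect of
    -- $e^{j\delta A}$ from the identity.
    (fun i ω => heat ((i % J : ℕ) * δ) (F (refPath F W u₀ δ (i / J * J) ω) -
        F (refPath F W u₀ δ i ω)) +
      (heat ((i % J : ℕ) * δ) (F (refPath F W u₀ δ i ω)) - F (refPath F W u₀ δ i ω)))
    (fun n ω => noiseConv W (J * δ) 0 ω n - noiseConv W δ 0 ω (n * J))
    (K * X) hδ hJ hN (by positivity) (aestronglyMeasurable_iterate hL.continuous u₀ δ hJ _)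
    (fun n => hmeas _) (fun _ _ => rfl) (fun n ω => ?_) ?_ ?_ n hn'
  · rw [error_zero_eq u₀ δ hJ]
    congr 2
    ext1 i
    simp only [map_sub]
    abel
  · intro i hi
    have hm : i / J < N := Nat.div_lt_of_lt_mul (by rwa [Nat.mul_comm])
    have hJN : J ≤ N * J := Nat.le_mul_of_pos_left J ((Nat.zero_le _).trans_lt hm)
    have b1 := hinc δ ((i / J : ℕ) * (J * δ)) _ C₁ J hδ (by positivity)
      (natCast_mul_le_of_le hN hJN) hJ1 (hr (i / J * J) (Nat.mul_le_mul_right J hm.le))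
      _ (Nat.mod_lt i hJ).le
    simp only [← refPath_add, Nat.div_add_mod'] at b1
    have b2 := (b1.lipschitz_sub hL hq le_rfl (hmeas i) (hmeas (i / J * J))).neg
    simp only [neg_sub] at b2
    have b3 := ((hr i hi.le).lipschitz hL hq h0.le).heat_sub_self (s := -(1 / 2)) (by norm_num)
      (by norm_num) ((i % J : ℕ) * δ)
    refine (((b2.heat_self _).mono_norm (by norm_num)).add b3 hq).mono_const ?_
    have c1 : (J * δ : ℝ) ^ (α - 0) ≤ X := hpow (by linarith)
    have c2 : (((i % J : ℕ) * δ : ℝ≥0) : ℝ) ^ ((0 : ℝ) - -(1 / 2)) ≤ X := by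
      refine le_trans ?_ (hpow (x := 0 - -(1 / 2)) (by linarith))
      have : ((i % J : ℕ) : ℝ) ≤ J := by exact_mod_cast (Nat.mod_lt i hJ).le
      push_cast
      refine Real.rpow_le_rpow (by positivity) ?_ (by norm_num)
      gcongr
    calc _ ≤ L * (C₂ * (1 + C₁) * X) + X * (L * C₁ + ‖F 0‖) := by gcongr
      _ ≤ L * (C₂ * (1 + C₁) * X) + X * (L * C₁ + ‖F 0‖) + noiseConst W α q * X :=
        le_add_of_nonneg_right (by positivity)
      _ = K * X := by rw [hK]; ring
  · intro n _
    refine (momentBound_noiseConv_sub h0.le h1.le hW hq hβα (by linarith) hδ hJ n).mono_const ?_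
    refine mul_le_mul_of_nonneg_right ?_ hX0
    rw [hK]
    exact le_add_of_nonneg_left (by positivity)

include hL in
/-- One parareal iteration improves the order of the error by `α + b = a + b'`. -/
lemma exists_error_succ_bound (hF : Differentiable ℝ F) (h0 : 0 < α) (h1 : α < 1 / 2)
    (hW : W.hsNorm α < ∞) (hT : 0 ≤ T) (hu₀ : fracNorm α u₀ < ∞) {a b b' : ℝ} {C₀ : ℝ≥0}
    (hb : 0 ≤ b) (hba : b ≤ a) (hb' : 0 ≤ b') (hbα : b' ≤ α) (hab : α + b = a + b')
    (ha : a + b' ≤ 1 / 2)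
    (hd : ∀ u h : H, fracNorm α u < ∞ →
      fracNorm (-a) (fderiv ℝ F u h) ≤ C₀ * (1 + fracNorm α u) * fracNorm (-a) h)
    (hdd : ∀ u₁ u₂ h : H, fracNorm b' u₁ < ∞ → fracNorm b' u₂ < ∞ → fracNorm b' h < ∞ →
      fracNorm (-b) ((fderiv ℝ F u₂ - fderiv ℝ F u₁) h) ≤
        C₀ * (1 + fracNorm b' u₁ + fracNorm b' u₂) * fracNorm (-b) (u₂ - u₁) * fracNorm b' h)
    {q k : ℕ} (hq : 1 ≤ q) {e C₁ : ℝ} (hC₁ : 0 ≤ C₁)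
    (hk : ∀ (δ : ℝ≥0) (J N : ℕ), 0 < δ → 1 ≤ J → J * (δ : ℝ) ≤ 1 →
      (N * J : ℕ) * (δ : ℝ) ≤ T → ∀ n ≤ N,
      MomentBound P b' (4 * q)
        (fun ω => iterate F W u₀ δ J k n ω - refPath F W u₀ δ (n * J) ω)
        (C₁ * (J * δ : ℝ) ^ e)) :
    ∃ C : ℝ, 0 ≤ C ∧ ∀ (δ : ℝ≥0) (J N : ℕ), 0 < δ → 1 ≤ J → J * (δ : ℝ) ≤ 1 →
      (N * J : ℕ) * (δ : ℝ) ≤ T → ∀ n ≤ N,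
      MomentBound P b' q
        (fun ω => iterate F W u₀ δ J (k + 1) n ω - refPath F W u₀ δ (n * J) ω)
        (C * (J * δ : ℝ) ^ (a + b' + e)) := by
  have hq4 : 1 ≤ 4 * q := by omega
  obtain ⟨C₂, hC₂, href⟩ := exists_refPath_moment (W := W) hL h0.le h1.le hW hT hu₀ hq4
  obtain ⟨C₃, hC₃, hit⟩ := exists_iterate_moment (W := W) hL h0.le h1 hW hT hu₀ hq4 k
  obtain ⟨C₄, hC₄, hfs⟩ := exists_fineSteps_moment (W := W) hL h0.le h1.le hW hT hq4
  obtain ⟨C₅, hC₅, hinc⟩ := exists_fineSteps_sub_start (W := W) hL h0 h1.le hW hT hq4 (β := -b)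
    (by linarith) (by linarith)
  obtain ⟨C₆, hC₆, hsub⟩ := exists_fineSteps_sub_fineSteps (W := W) hL hT hq4 hb' (by linarith)
  obtain ⟨C₇, hC₇, hss⟩ := exists_fineSteps_sub_fineSteps_sub (W := W) hL hT hq4 hb'
    (by linarith) (hb.trans hba) (by linarith : b' + a ≤ 1)
  obtain ⟨C₈, hC₈, hprop⟩ := exists_error_propagation (P := P) hL hT hq (β := b') (r := 1 / 2) hb'
      (by linarith) (by norm_num) (by linarith)
  set M := C₂ + C₃ with hM
  set R := C₄ * (1 + M) + M with hR
  set K := L * (C₆ * C₁) + C₀ * ((1 + 4 * R) * (2 * (C₅ * (1 + M)) * (C₆ * C₁) + C₇ * C₁)) with hK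
  have hK0 : 0 ≤ K := by positivity
  refine ⟨C₈ * K, by positivity, fun δ J N hδ hJ hJ1 hN n hn' => ?_⟩
  have hδ' : (0 : ℝ) < δ := hδ
  have hJ' : (0 : ℝ) < J := by exact_mod_cast hJ
  set E := (J * δ : ℝ) ^ e with hE
  set X := (J * δ : ℝ) ^ (a + b') with hX
  have hE0 : 0 ≤ E := by positivity
  have hX0 : 0 ≤ X := by positivity
  have hmeas := fun i => aestronglyMeasurable_refPath (W := W) hL.continuous u₀ δ i
  have hmeas' := fun i => aestronglyMeasurable_iterate (W := W) hL.continuous u₀ δ hJ k i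
  rw [Real.rpow_add (by positivity), mul_assoc]
  refine hprop δ J N
    (fun n ω => iterate F W u₀ δ J (k + 1) n ω - refPath F W u₀ δ (n * J) ω)
    (iterate F W u₀ δ J (k + 1)) (fun n => refPath F W u₀ δ (n * J))
    (fun i ω => (F (restarted F W δ J (iterate F W u₀ δ J k) i ω) - F (refPath F W u₀ δ i ω)) -
        heat ((i % J : ℕ) * δ) (F (iterate F W u₀ δ J k (i / J) ω) -
          F (refPath F W u₀ δ (i / J * J) ω))) (fun _ _ => 0)
    (K * (X * E)) hδ hJ hN (by positivity)
    (aestronglyMeasurable_iterate hL.continuous u₀ δ hJ _)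
    (fun n => hmeas _) (fun _ _ => rfl)
    (fun n ω => by rw [add_zero]; exact error_succ_eq u₀ δ hJ k n ω) ?_
    (fun _ _ => MomentBound.zero.mono_const (by positivity)) n hn'
  intro i hi
  have hm : i / J < N := Nat.div_lt_of_lt_mul (by rwa [Nat.mul_comm])
  have hJN : J ≤ N * J := Nat.le_mul_of_pos_left J ((Nat.zero_le _).trans_lt hm)
  have hJT := natCast_mul_le_of_le hN hJN
  have hj := (Nat.mod_lt i hJ).le
  set s : ℝ := (i / J : ℕ) * (J * δ) with hs
  have hs0 : 0 ≤ s := by positivity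
  set x := iterate F W u₀ δ J k (i / J) with hx
  set v := refPath F W u₀ δ (i / J * J) with hv
  have ev : ∀ ω, refPath F W u₀ δ i ω = fineSteps F W δ s ω (v ω) (i % J) := fun ω => by
    rw [hv, ← refPath_add, Nat.div_add_mod']
  set xf : Ω → H := fun ω => fineSteps F W δ s ω (x ω) (i % J) with hxf
  set vf : Ω → H := fun ω => fineSteps F W δ s ω (v ω) (i % J) with hvf
  have mx : MomentBound P α (4 * q) x M := (hit δ J N hδ hJ hN _ hm.le).mono_const (by linarith)
  have mv : MomentBound P α (4 * q) v M :=
    (href δ _ hδ hN _ (Nat.mul_le_mul_right J hm.le)).mono_const (by linarith)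
  have hM0 : 0 ≤ M := by positivity
  have mR : M ≤ R := by rw [hR]; exact le_add_of_nonneg_left (by positivity)
  have mxf : MomentBound P α (4 * q) xf R :=
    (hfs δ s x M J hδ hs0 hJT mx _ hj).mono_const (le_add_of_nonneg_right hM0)
  have mvf : MomentBound P α (4 * q) vf R :=
    (hfs δ s v M J hδ hs0 hJT mv _ hj).mono_const (le_add_of_nonneg_right hM0)
  have dx := hinc δ s x M J hδ hs0 hJT hJ1 mx _ hj
  have dv := hinc δ s v M J hδ hs0 hJT hJ1 mv _ hj
  have her : MomentBound P b' (4 * q) (fun ω => x ω - v ω) (C₁ * E) :=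
    hk δ J N hδ hJ hJ1 hN _ hm.le
  have df := hsub δ s x v _ J hδ hJT mx.meas mv.meas her _ hj
  have dd := hss δ s x v _ J hδ hJT hJ1 mx.meas mv.meas her _ hj
  -- Here $u_0,v_0$ are the values at the start of the coarse cell and $u_1,v_1$ those after $i\bmod
  -- J$ fine steps.
  have second := MomentBound.second_difference hF (hb.trans hba) hba hbα hd hdd hq
    (mx.mono_const mR) (mv.mono_const mR) mxf mvf dx dv df dd
  -- This part gains $\Delta T^{1/2}$, at least as good as $\Delta T^{a+b'}$ by `ha`.
  have first := ((df.mono_exp (by omega : q ≤ 4 * q)).lipschitz_sub hL hq hb' mxf.meas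
    mvf.meas).heat_sub_self (s := -(1 / 2)) (by norm_num) (by norm_num) ((i % J : ℕ) * δ)
  have total := (first.neg).add ((second.mono_norm (by linarith : -(1 / 2) ≤ -a)).heat_self
    ((i % J : ℕ) * δ)) hq
  have efun : (fun ω => -(heat ((i % J : ℕ) * δ) (F (xf ω) - F (vf ω)) - (F (xf ω) - F (vf ω))) +
      heat ((i % J : ℕ) * δ) (F (xf ω) - F (vf ω) - (F (x ω) - F (v ω)))) =
      fun ω => (F (restarted F W δ J (iterate F W u₀ δ J k) i ω) - F (refPath F W u₀ δ i ω)) -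
        heat ((i % J : ℕ) * δ) (F (x ω) - F (v ω)) := by
    ext1 ω
    rw [ev ω]
    change _ = F (xf ω) - F (vf ω) - _
    simp only [map_sub]
    abel
  rw [efun] at total
  refine total.mono_const ?_
  have c1 : (((i % J : ℕ) * δ : ℝ≥0) : ℝ) ^ ((0 : ℝ) - -(1 / 2)) ≤ X := by
    refine le_trans ?_ (Real.rpow_le_rpow_of_exponent_ge (by positivity) hJ1
      (by linarith : a + b' ≤ 0 - -(1 / 2)))
    have : ((i % J : ℕ) : ℝ) ≤ J := by exact_mod_cast hj
    push_cast
    refine Real.rpow_le_rpow (by positivity) ?_ (by norm_num)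
    gcongr
  have c2 : (J * δ : ℝ) ^ (α - -b) = X := by rw [hX, ← hab, sub_neg_eq_add]
  have c3 : (J * δ : ℝ) ^ (b' + a) = X := by rw [hX, add_comm]
  rw [c2, c3]
  calc _ ≤ X * (L * (C₆ * (C₁ * E))) + C₀ * ((1 + 4 * R) *
        (2 * (C₅ * (1 + M) * X) * (C₆ * (C₁ * E)) + C₇ * X * (C₁ * E))) := by gcongr
    _ = K * (X * E) := by rw [hK]; ring

include hL in
-- The induction keeps $q$ general because the moment of order $q$ at step $k+1$ uses order $4q$ at
-- step $k$.
lemma exists_error_bound (hF : Differentiable ℝ F) (h0 : 0 < α) (h1 : α < 1 / 2)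
    (hW : W.hsNorm α < ∞) (hT : 0 ≤ T) (hu₀ : fracNorm α u₀ < ∞) {a b b' : ℝ} {C₀ : ℝ≥0}
    (hb : 0 ≤ b) (hba : b ≤ a) (hb' : 0 ≤ b') (hbα : b' ≤ α) (hab : α + b = a + b')
    (ha : a + b' ≤ 1 / 2)
    (hd : ∀ u h : H, fracNorm α u < ∞ →
      fracNorm (-a) (fderiv ℝ F u h) ≤ C₀ * (1 + fracNorm α u) * fracNorm (-a) h)
    (hdd : ∀ u₁ u₂ h : H, fracNorm b' u₁ < ∞ → fracNorm b' u₂ < ∞ → fracNorm b' h < ∞ →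
      fracNorm (-b) ((fderiv ℝ F u₂ - fderiv ℝ F u₁) h) ≤
        C₀ * (1 + fracNorm b' u₁ + fracNorm b' u₂) * fracNorm (-b) (u₂ - u₁) * fracNorm b' h)
    (k : ℕ) {q : ℕ} (hq : 1 ≤ q) :
    ∃ C : ℝ, 0 ≤ C ∧ ∀ (δ : ℝ≥0) (J N : ℕ), 0 < δ → 1 ≤ J → J * (δ : ℝ) ≤ 1 →
      (N * J : ℕ) * (δ : ℝ) ≤ T → ∀ n ≤ N,
      MomentBound P b' q
        (fun ω => iterate F W u₀ δ J k n ω - refPath F W u₀ δ (n * J) ω)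
        (C * (J * δ : ℝ) ^ (k * (a + b') + (α - b'))) := by
  induction k generalizing q with
  | zero => simpa using exists_error_zero_bound (W := W) hL h0 h1 hW hT hu₀ hq hb' hbα
  | succ k ih =>
    obtain ⟨C₁, hC₁, hk⟩ := ih (q := 4 * q) (by omega)
    have e : ((k + 1 : ℕ) : ℝ) * (a + b') + (α - b') =
        a + b' + (k * (a + b') + (α - b')) := by push_cast; ring
    rw [e]
    exact exists_error_succ_bound hL hF h0 h1 hW hT hu₀ hb hba hb' hbα hab ha hd hdd hq hC₁ hk

end Convergence

end

end Parareal

/-! ### Choice of the exponents and conclusion -/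

theorem mainTheorem3 {Ω : Type*} [MeasurableSpace Ω] (P : Measure Ω) [IsProbabilityMeasure P]
    (W : Parareal.QWiener P) (F : Parareal.H → Parareal.H)
    (hF : Parareal.NonlinearityAssumption F)
    (T : ℝ) (hT : 0 < T) (k q : ℕ) (hk : 2 ≤ k) (hq : 1 ≤ q)
    (α : ℝ) (hα0 : 0 < α) (hα : (α : EReal) < min W.alphaBar ((1 / 2 : ℝ) : EReal))
    (κ : ℝ) (hκ : 0 < κ)
    (u₀ : Parareal.H) (hu₀ : Parareal.fracNorm α u₀ < ∞) :
    ∃ C : ℝ, 0 < C ∧ ∀ ΔT : ℝ, 0 < ΔT → ΔT < 1 → ∀ J : ℕ, 1 ≤ J → ∀ n : ℕ, n * ΔT ≤ T →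
      MemLp (Parareal.error F W u₀ ΔT J k n) q P ∧
      eLpNorm (Parareal.error F W u₀ ΔT J k n) q P ≤
        ENNReal.ofReal
          (C * ΔT ^ (((k : ℝ) - 1) * (min (2 * α) (1 / 2) - κ) + 2 * α)) := by
  obtain ⟨hαW, hα1⟩ := lt_min_iff.1 hα
  have hα2 : α < 1 / 2 := by exact_mod_cast hα1
  have hW := W.hsNorm_lt_top_of_lt_alphaBar hαW
  obtain ⟨L, hL⟩ := hF.lipschitz
  have hmin : min (2 * α) (1 / 2) = α + min α (1 / 2 - α) := by
    rw [← min_add_add_left]; congr 1 <;> ring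
  rw [hmin]
  set b' := min α (1 / 2 - α) with hb'
  have hb0 : 0 < b' := lt_min hα0 (by linarith)
  have hbα : b' ≤ α := min_le_left _ _
  have hbα' : b' ≤ 1 / 2 - α := min_le_right _ _
  -- The loss must keep $b=b'-\rho$ positive, and $\rho\le\kappa/2$ gives $k\rho\le(k-1)\kappa$
  -- because $k\ge2$.
  set ρ := min (κ / 2) (b' / 2) with hρ
  have hρ0 : 0 < ρ := lt_min (by linarith) (by linarith)
  have hρκ : ρ ≤ κ / 2 := min_le_left _ _
  have hρb : ρ ≤ b' / 2 := min_le_right _ _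
  -- With exponent $\alpha-\rho$ and loss $\rho$ the norm required of $u$ is exactly
  -- $|\cdot|_\alpha$; likewise $|\cdot|_{b'}$ in the next line.
  obtain ⟨C₁, -, hd, -, -⟩ := hF.frac_estimates (α - ρ) ρ (by linarith) (by linarith) hρ0
    (by linarith)
  obtain ⟨C₂, -, -, -, hdd⟩ := hF.frac_estimates (b' - ρ) ρ (by linarith) (by linarith) hρ0
    (by linarith)
  simp only [sub_add_cancel] at hd hdd
  obtain ⟨C, hC, hbound⟩ := Parareal.exists_error_bound (W := W) (P := P) (C₀ := max C₁ C₂) hL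
    hF.differentiable hα0 hα2 hW hT.le hu₀ (a := α - ρ) (b := b' - ρ) (by linarith) (by linarith)
    hb0.le hbα (by ring) (by linarith)
    (fun u h hu => (hd u h hu).trans (by gcongr; exact le_max_left _ _))
    (fun u₁ u₂ h hu₁ hu₂ hh => (hdd u₁ u₂ h hu₁ hu₂ hh).trans (by gcongr; exact le_max_right _ _))
    k hq
  -- Adding $1$ makes the constant positive, since `C` may vanish.
  refine ⟨C + 1, by linarith, fun ΔT hΔ hΔ1 J hJ n hn => ?_⟩
  have hJ' : (0 : ℝ) < J := by exact_mod_cast hJ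
  lift ΔT to ℝ≥0 using hΔ.le
  obtain ⟨δ, rfl⟩ : ∃ δ : ℝ≥0, ΔT = J * δ :=
    ⟨ΔT / J, (mul_div_cancel₀ _ (by exact_mod_cast hJ'.ne')).symm⟩
  push_cast at hΔ hΔ1 hn ⊢
  have hδ : 0 < δ := by
    have := pos_of_mul_pos_right hΔ hJ'.le
    exact_mod_cast this
  have hmb := (hbound δ J n hδ hJ hΔ1.le (by push_cast; linarith) n le_rfl).mono_norm hb0.le
  have herr : Parareal.error F W u₀ (J * δ) J k n = fun ω =>
      Parareal.iterate F W u₀ δ J k n ω - Parareal.refPath F W u₀ δ (n * J) ω :=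
    funext fun ω => Parareal.error_eq u₀ δ hJ k n ω
  have hle := hmb.le
  simp only [Parareal.fracNorm_zero] at hle
  rw [eLpNorm_enorm] at hle
  rw [herr]
  refine ⟨⟨hmb.meas, hle.trans_lt ENNReal.ofReal_lt_top⟩, hle.trans (ENNReal.ofReal_le_ofReal ?_)⟩
  have hk' : (2 : ℝ) ≤ k := by exact_mod_cast hk
  gcongr ?_ * ?_
  · linarith
  · refine Real.rpow_le_rpow_of_exponent_ge hΔ hΔ1.le ?_
    -- After cancelling $(k-1)(\alpha+b')+2\alpha$, this is $k\rho\le(k-1)\kappa$.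
    nlinarith
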